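/- Write $z=\rho+i\zeta$. Fix $\rho_0>0$ and put $\mathcal D=\{\rho>0\}\setminus\{(\rho,0):0<\rho\le\rho_0\}$ and $\Gamma=[-i\rho_0,i\rho_0]\subset\mathbb C$. Let $f=f(\rho,\zeta)$ be a complex-valued function, twice continuously differentiable in $\mathcal D$ and of class $C^1$ up to the rotation axis $\{\rho=0,\ \zeta\ne0\}$, which satisfies the Ernst equation $$\frac{f+\bar f}{2}\Big(f_{\rho\rho}+f_{\zeta\zeta}+\frac1\rho f_\rho\Big)=f_\rho^2+f_\zeta^2\quad\text{in }\mathcal D,$$ with $f\to1$ as $\rho^2+\zeta^2\to\infty$, $f_\rho(+0,\zeta)=0$ for $\zeta\neq0$, and $\operatorname{Re}f>0$ in $\mathcal D$ and on the axis $\{\rho=0,\ \zeta\neq0\}$. For $k\in\mathbb C$ let $\lambda^2=\dfrac{k-i\bar z}{k+iz}$. For fixed $z$ this defines a two-sheeted surface; on the upper (lower) sheet $\lambda\to1$ ($\lambda\to-1$) as $k\to\infty$, and we write $k^+$ ($k^-$) for the point over $k$ on the upper (lower) sheet; for $z=i\zeta$ on the axis $\lambda=\pm1$ at $k^\pm$.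 For $k\in\mathbb C\setminus\Gamma$ the eigenfunction $\Phi(z,k^\pm)$ is the $2\times2$-matrix valued function of the point $(z,\lambda)$, continuous (away from the branch points) over $\mathcal D$ and the axis $\{\rho=0,\ \zeta\ne 0\}$, which satisfies in $\mathcal D$, along every local branch of $\lambda$, the Lax pair $$\Phi_z=\begin{pmatrix}B&\lambda B\\ \lambda A_0&A_0\end{pmatrix}\Phi,\qquad \Phi_{\bar z}=\begin{pmatrix}\overline{A_0}&\lambda^{-1}\overline{A_0}\\ \lambda^{-1}\overline{B}&\overline{B}\end{pmatrix}\Phi,\qquad A_0=\frac{f_z}{f+\bar f},\quad B=\frac{\bar f_z}{f+\bar f},$$ and is normalised on the axis by: the first column of $\Phi(i\zeta,k^-)$ tends to $(1,1)^T$ and the second column of $\Phi(i\zeta,k^+)$ tends to $(1,-1)^T$ as $\zeta\to+\infty$. The spectral functions $F,G:\mathbb C\setminus\Gamma\to\mathbb C$ are defined by $$\Phi(i\zeta,k^+)=\begin{pmatrix}\overline{f(i\zeta)}&1\\ f(i\zeta)&-1\end{pmatrix}A(k),\qquad A(k)=\begin{pmatrix}F(k)&0\\ G(k)&1\end{pmatrix},\qquad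 \zeta>0,\ k\in\mathbb C\setminus\Gamma.$$ Suppose that $f$ is equatorially symmetric, $f(z)=\overline{f(\bar z)}$. Let $k\in\Gamma$ and let $A_+(k)$ and $A_-(k)$ be the limits of $A$ at $k$ from the right ($\operatorname{Re}>0$) and from the left ($\operatorname{Re}<0$) of $\Gamma$, supposed to exist and to be invertible. Then, with $\sigma_1=\begin{pmatrix}0&1\\1&0\end{pmatrix}$ and the bar denoting entrywise complex conjugation, the global relation holds: $$\overline{A_+(k)}\,\sigma_1\,\overline{A_+^{-1}(k)}\,\sigma_1=\sigma_1A_-(k)\,\sigma_1A_-^{-1}(k).$$ -/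

import Mathlib

open Filter Topology
open scoped ComplexConjugate

namespace Ernst

noncomputable section

/-- Points are written `z = ρ + iζ`.  The exterior of the disk of radius `ρ₀`: the open half-plane
`ρ > 0` with the segment `0 < ρ ≤ ρ₀`, `ζ = 0` removed. -/
def exteriorDomain (ρ₀ : ℝ) : Set ℂ :=
  {z | 0 < z.re ∧ ¬ (z.im = 0 ∧ z.re ≤ ρ₀)}

/-- The two open half-axes `{iζ : ζ ≠ 0}` of the rotation axis. -/
def rotationAxis : Set ℂ :=
  {z | z.re = 0 ∧ z.im ≠ 0}

/-- The contour `Γ = [-iρ₀, iρ₀]` in the `k`-plane. -/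
def contour (ρ₀ : ℝ) : Set ℂ :=
  {k | k.re = 0 ∧ |k.im| ≤ ρ₀}

/-- `∂g/∂ρ`. -/
def dRho (g : ℂ → ℂ) (z : ℂ) : ℂ := fderiv ℝ g z 1

/-- `∂g/∂ζ`. -/
def dZeta (g : ℂ → ℂ) (z : ℂ) : ℂ := fderiv ℝ g z Complex.I

/-- `∂g/∂z = (g_ρ - i g_ζ)/2`. -/
def dz (g : ℂ → ℂ) (z : ℂ) : ℂ := (dRho g z - Complex.I * dZeta g z) / 2

/-- `∂g/∂z̄ = (g_ρ + i g_ζ)/2`. -/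
def dzbar (g : ℂ → ℂ) (z : ℂ) : ℂ := (dRho g z + Complex.I * dZeta g z) / 2

/-- An asymptotically flat Ernst potential in the exterior of the disk, regular on the rotation
axis and without ergospheres. -/
structure IsErnstPotential (ρ₀ : ℝ) (f : ℂ → ℂ) : Prop where
  contDiffOn : ContDiffOn ℝ 2 f (exteriorDomain ρ₀)
  /-- The elliptic Ernst equation. -/
  ernst : ∀ z ∈ exteriorDomain ρ₀,
    (f z + conj (f z)) / 2 * (dRho (dRho f) z + dZeta (dZeta f) z + 1 / (z.re : ℂ) * dRho f z)
      = dRho f z ^ 2 + dZeta f z ^ 2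
  /-- `f → 1` as `ρ² + ζ² → ∞`. -/
  flat : Tendsto f (Bornology.cobounded ℂ ⊓ 𝓟 (exteriorDomain ρ₀)) (𝓝 1)
  /-- `f` is of class `C¹` up to the axis `ρ = 0`, `ζ ≠ 0` (this field and the next two), -/
  continuousOn : ContinuousOn f (exteriorDomain ρ₀ ∪ rotationAxis)
  dZeta_axis : ∀ a ∈ rotationAxis, ∃ c, Tendsto (dZeta f) (𝓝[exteriorDomain ρ₀] a) (𝓝 c)
  /-- and `f_ρ(+0, ζ) = 0` for `ζ ≠ 0`. -/
  dRho_axis : ∀ a ∈ rotationAxis, Tendsto (dRho f) (𝓝[exteriorDomain ρ₀] a) (𝓝 0)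
  /-- No ergospheres. -/
  re_pos : ∀ z ∈ exteriorDomain ρ₀ ∪ rotationAxis, 0 < (f z).re

/-- `f(z) = conj f(z̄)`. -/
def IsEquatoriallySymmetric (ρ₀ : ℝ) (f : ℂ → ℂ) : Prop :=
  ∀ z ∈ exteriorDomain ρ₀, f z = conj (f (conj z))

/-- The coefficient `A = f_z / (f + f̄)` of the Lax pair. -/
def laxA (f : ℂ → ℂ) (z : ℂ) : ℂ := dz f z / (f z + conj (f z))

/-- The coefficient `B = (f̄)_z / (f + f̄)` of the Lax pair. -/
def laxB (f : ℂ → ℂ) (z : ℂ) : ℂ := dz (fun w => conj (f w)) z / (f z + conj (f z))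

/-- The matrix `U` of the Lax pair at the point `(z, lam)`. -/
def laxU (f : ℂ → ℂ) (z lam : ℂ) : Matrix (Fin 2) (Fin 2) ℂ :=
  !![laxB f z, lam * laxB f z; lam * laxA f z, laxA f z]

/-- The matrix `V` of the Lax pair at the point `(z, lam)`. -/
def laxV (f : ℂ → ℂ) (z lam : ℂ) : Matrix (Fin 2) (Fin 2) ℂ :=
  !![conj (laxA f z), 1 / lam * conj (laxA f z); 1 / lam * conj (laxB f z), conj (laxB f z)]

/-- `lam² = (k - i z̄) / (k + i z)`, `lam ≠ 0`: for fixed `z` this is the two-sheeted Riemann surface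
of the spectral parameter `k`, without its two branch points.  On the upper (lower) sheet `lam` is
the root with `lam → 1` (`lam → -1`) as `k → ∞`. -/
def IsLambda (k z lam : ℂ) : Prop :=
  lam ≠ 0 ∧ lam ^ 2 * (k + Complex.I * z) = k - Complex.I * conj z

/-- All points `(z, lam)` over the exterior domain and the axis, for fixed `k`.  On the axis the
surface degenerates: `lam = 1` on the upper sheet and `lam = -1` on the lower sheet. -/
def laxSurface (ρ₀ : ℝ) (k : ℂ) : Set (ℂ × ℂ) :=
  {p | (p.1 ∈ exteriorDomain ρ₀ ∧ IsLambda k p.1 p.2) ∨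
    (p.1 ∈ rotationAxis ∧ (p.2 = 1 ∨ p.2 = -1))}

/-- `Φ z lam` is the eigenfunction at the spectral parameter `k`: a continuous function on the
two-sheeted surface, which solves the Lax pair `Φ_z = U Φ`, `Φ_z̄ = V Φ` along every local branch
`ℓ` of `lam`, normalised on the axis at `z = i∞` by its first column on the lower sheet and its
second column on the upper sheet. -/
structure IsEigenfunction (ρ₀ : ℝ) (f : ℂ → ℂ) (k : ℂ)
    (Φ : ℂ → ℂ → Matrix (Fin 2) (Fin 2) ℂ) : Prop where
  continuousOn : ContinuousOn (fun p : ℂ × ℂ => Φ p.1 p.2) (laxSurface ρ₀ k)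
  lax : ∀ (Ω : Set ℂ) (ℓ : ℂ → ℂ), IsOpen Ω → Ω ⊆ exteriorDomain ρ₀ → ContinuousOn ℓ Ω →
    (∀ z ∈ Ω, IsLambda k z (ℓ z)) → ∀ z ∈ Ω, ∀ i j : Fin 2,
      DifferentiableAt ℝ (fun w => Φ w (ℓ w) i j) z ∧
      dz (fun w => Φ w (ℓ w) i j) z = (laxU f z (ℓ z) * Φ z (ℓ z)) i j ∧
      dzbar (fun w => Φ w (ℓ w) i j) z = (laxV f z (ℓ z) * Φ z (ℓ z)) i j
  lower : Tendsto (fun ζ : ℝ => (Φ (Complex.I * ζ) (-1)).col 0) atTop (𝓝 ![1, 1])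
  upper : Tendsto (fun ζ : ℝ => (Φ (Complex.I * ζ) 1).col 1) atTop (𝓝 ![1, -1])

/-- The matrix `A = [[F, 0], [G, 1]]`. -/
def spectralMatrix (F G : ℂ → ℂ) (k : ℂ) : Matrix (Fin 2) (Fin 2) ℂ :=
  !![F k, 0; G k, 1]

/-- `F` and `G` are the spectral functions of `f` on `ℂ \ Γ`: on the half-axis `ζ > 0` and on the
upper sheet, the eigenfunction is `[[f̄, 1], [f, -1]] [[F(k), 0], [G(k), 1]]`. -/
def IsSpectralPair (ρ₀ : ℝ) (f F G : ℂ → ℂ) : Prop :=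
  ∀ k ∉ contour ρ₀, ∃ Φ, IsEigenfunction ρ₀ f k Φ ∧
    ∀ ζ : ℝ, 0 < ζ → Φ (Complex.I * ζ) 1 =
      !![conj (f (Complex.I * ζ)), 1; f (Complex.I * ζ), -1] * spectralMatrix F G k

/-- The Pauli matrix `σ₁`. -/
def pauli1 : Matrix (Fin 2) (Fin 2) ℂ := !![0, 1; 1, 0]

end

end Ernst

/-! For triangular `A`, the global relation at a point of the contour amounts to two scalar
identities between the limits from the two sides. They are proved off the contour as `G (-conj k) =
-conj (G k)` and `F (-conj k) * conj (F k) = 1 - conj (G k) ^ 2` (`global_relation`). The map `k ↦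
-conj k` is reflection in the imaginary axis, so letting `k` tend to the contour from the right
gives the theorem.

The matrices of the Lax pair have trace `∂ log (f + f̄)`, whatever `lam` is. Hence the symplectic
product of two solutions at the same `k` is `f + f̄` times a constant matrix (`wronskian_const`). A
loop around the branch point exchanges the sheets, so this constant is the same on both
(`wronskian_sheets`). Together with the normalisation on the axis this yields `Φ(z, k⁻) = σ₃ Φ(z,
k⁺) σ₁` (`sheet_exchange`).

Equatorial symmetry turns a solution at `k` into one at `-conj k` (`reflect`). On the equatorial
plane outside the disk the reflection fixes `z` but exchanges the sheets (`conj_branch_ofReal`).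
Comparing the two sheets there gives an algebraic relation between the eigenfunctions at `k` and
`-conj k` (`equator_relation`).

It remains to express these eigenfunctions through `A` by going to infinity. This is the analytic
part, because `f → 1` is assumed without a rate and without decay of the gradient. A Caccioppoli
inequality for the Ernst equation (`energy_estimate`) bounds the weighted Dirichlet integral at
scale `R`, and averaging selects one vertical and one horizontal segment on which the gradient is
small (`exists_goodPath`). A Grönwall estimate along them, from the axis to the equatorial plane,
shows that `Φ` tends to `[[1, 1], [1, -1]] A(k)` along a sequence of equatorial points (`transport`,
`exists_equator_approx`). Near the axis the energy controls only `ρ |∇f|²`, so there `Φ` is written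
in the frame `[[f̄, 1], [f, -1]]`, which solves the Lax pair for `lam = 1`. The remaining
coefficient carries a factor `lam - 1 = O(ρ / R)`. -/

namespace Ernst

/-! ### Square roots and branches of the spectral surface -/

/-- The principal square root. -/
noncomputable def csqrt (z : ℂ) : ℂ := z ^ (1 / 2 : ℂ)

lemma csqrt_sq (z : ℂ) : csqrt z ^ 2 = z := by
  simp [csqrt]

lemma csqrt_ne_zero {z : ℂ} (hz : z ≠ 0) : csqrt z ≠ 0 := by
  intro h
  have := csqrt_sq z
  rw [h] at this
  exact hz (by simpa using this.symm)

lemma continuousAt_csqrt {z : ℂ} (hz : z ∈ Complex.slitPlane) : ContinuousAt csqrt z :=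
  continuousAt_id.cpow continuousAt_const hz

lemma csqrt_eq_exp {z : ℂ} (hz : z ≠ 0) : csqrt z = Complex.exp (Complex.log z / 2) := by
  rw [csqrt, Complex.cpow_def_of_ne_zero hz]
  congr 1
  ring

lemma csqrt_re_pos {z : ℂ} (hz : z ∈ Complex.slitPlane) : 0 < (csqrt z).re := by
  have h0 := Complex.slitPlane_ne_zero hz
  rw [csqrt_eq_exp h0, Complex.exp_re]
  refine mul_pos (Real.exp_pos _) (Real.cos_pos_of_mem_Ioo ?_)
  have h1 : (Complex.log z / 2).im = z.arg / 2 := by simp [Complex.log_im]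
  have h2 := Complex.neg_pi_lt_arg z
  have h3 := (Complex.arg_le_pi z).lt_of_ne (Complex.mem_slitPlane_iff_arg.1 hz).1
  rw [h1]
  constructor <;> linarith

lemma eq_csqrt_of_sq {z w : ℂ} (hz : z ∈ Complex.slitPlane) (hw : 0 ≤ w.re) (h : w ^ 2 = z) :
    w = csqrt z := by
  have h1 : (w - csqrt z) * (w + csqrt z) = 0 := by
    have := csqrt_sq z
    linear_combination h - this
  rcases mul_eq_zero.1 h1 with h2 | h2
  · exact sub_eq_zero.1 h2
  · have h3 := congrArg Complex.re h2
    have h4 := csqrt_re_pos hz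
    simp only [Complex.add_re, Complex.zero_re] at h3
    linarith

lemma csqrt_conj {z : ℂ} (hz : z ∈ Complex.slitPlane) : csqrt (conj z) = conj (csqrt z) := by
  refine (eq_csqrt_of_sq ?_ ?_ ?_).symm
  · rw [Complex.mem_slitPlane_iff] at hz ⊢
    simpa using hz
  · simpa using (csqrt_re_pos hz).le
  · rw [← map_pow, csqrt_sq]

/-- `2 (Re √z) (Im √z) = Im z`. -/
lemma csqrt_re_mul_im (z : ℂ) : 2 * (csqrt z).re * (csqrt z).im = z.im := by
  have h := congrArg Complex.im (csqrt_sq z)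
  rw [pow_two, Complex.mul_im] at h
  linarith

lemma csqrt_re_sq_sub (z : ℂ) : (csqrt z).re ^ 2 - (csqrt z).im ^ 2 = z.re := by
  have h := congrArg Complex.re (csqrt_sq z)
  rw [pow_two, Complex.mul_re] at h
  linarith

lemma csqrt_neg_of_im_pos {z : ℂ} (hz : 0 < z.im) : csqrt (-z) = -Complex.I * csqrt z := by
  have hs : z ∈ Complex.slitPlane := Complex.mem_slitPlane_iff.2 (Or.inr hz.ne')
  have hs' : -z ∈ Complex.slitPlane := Complex.mem_slitPlane_iff.2 (Or.inr (by simpa using hz.ne'))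
  refine (eq_csqrt_of_sq hs' ?_ ?_).symm
  · have h1 := csqrt_re_mul_im z
    have h2 := csqrt_re_pos hs
    have h3 : 0 < (csqrt z).im := by
      by_contra h
      nlinarith
    simpa using h3.le
  · rw [mul_pow, csqrt_sq]; simp

lemma csqrt_neg_of_im_neg {z : ℂ} (hz : z.im < 0) : csqrt (-z) = Complex.I * csqrt z := by
  have h := csqrt_neg_of_im_pos (z := -z) (by simpa using hz)
  rw [neg_neg] at h
  rw [h, ← mul_assoc]
  simp

/-- The branch of `lam` which is cut along the ray from the branch point towards `-i∞`, and equals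
`1` on the part of the axis above the branch point. -/
noncomputable def branch (k z : ℂ) : ℂ :=
  csqrt (-(k - Complex.I * conj z)) / csqrt (-(k + Complex.I * z))

/-- The branch of `lam` which is cut along the ray from the branch point towards `+i∞`. -/
noncomputable def branchUp (k z : ℂ) : ℂ :=
  csqrt (k - Complex.I * conj z) / csqrt (k + Complex.I * z)

lemma num_ne_zero {k z : ℂ} (h : z.im ≠ k.re ∨ z.re ≠ |k.im|) (hz : 0 ≤ z.re) :
    k - Complex.I * conj z ≠ 0 := by
  intro h0
  have h1 := congrArg Complex.re h0
  have h2 := congrArg Complex.im h0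
  simp at h1 h2
  have h3 : z.re = k.im := by linarith
  rcases h with h | h
  · exact h (by linarith)
  · rw [← h3, abs_of_nonneg hz] at h; exact h rfl

lemma den_ne_zero {k z : ℂ} (h : z.im ≠ k.re ∨ z.re ≠ |k.im|) (hz : 0 ≤ z.re) :
    k + Complex.I * z ≠ 0 := by
  intro h0
  have h1 := congrArg Complex.re h0
  have h2 := congrArg Complex.im h0
  simp at h1 h2
  have h3 : z.re = - k.im := by linarith
  rcases h with h | h
  · exact h (by linarith)
  · rw [← abs_neg, ← h3, abs_of_nonneg hz] at h; exact h rfl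

lemma isLambda_branch {k z : ℂ} (h : z.im ≠ k.re ∨ z.re ≠ |k.im|) (hz : 0 ≤ z.re) :
    IsLambda k z (branch k z) := by
  have h1 := num_ne_zero h hz
  have h2 := den_ne_zero h hz
  refine ⟨div_ne_zero (csqrt_ne_zero (neg_ne_zero.2 h1)) (csqrt_ne_zero (neg_ne_zero.2 h2)), ?_⟩
  rw [branch, div_pow, csqrt_sq, csqrt_sq]
  field_simp

lemma isLambda_branchUp {k z : ℂ} (h : z.im ≠ k.re ∨ z.re ≠ |k.im|) (hz : 0 ≤ z.re) :
    IsLambda k z (branchUp k z) := by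
  have h1 := num_ne_zero h hz
  have h2 := den_ne_zero h hz
  refine ⟨div_ne_zero (csqrt_ne_zero h1) (csqrt_ne_zero h2), ?_⟩
  rw [branchUp, div_pow, csqrt_sq, csqrt_sq]
  field_simp

lemma IsLambda.neg {k z l : ℂ} (h : IsLambda k z l) : IsLambda k z (-l) :=
  ⟨neg_ne_zero.2 h.1, by rw [neg_sq]; exact h.2⟩

lemma re_ne_of_abs_ne {x y : ℝ} (hx : 0 ≤ x) (h : x ≠ |y|) : x ≠ y ∧ x ≠ -y := by
  constructor
  · rintro rfl; exact h (abs_of_nonneg hx).symm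
  · rintro rfl; exact h (by rw [← abs_neg, abs_of_nonneg hx])

lemma neg_num_mem_slitPlane {k z : ℂ} (h : k.re < z.im ∨ z.re ≠ |k.im|) (hz : 0 ≤ z.re) :
    -(k - Complex.I * conj z) ∈ Complex.slitPlane := by
  rw [Complex.mem_slitPlane_iff]
  rcases h with h | h
  · left; simpa using h
  · right
    simpa [sub_eq_zero] using fun h' => (re_ne_of_abs_ne hz h).1 (by linarith)

lemma neg_den_mem_slitPlane {k z : ℂ} (h : k.re < z.im ∨ z.re ≠ |k.im|) (hz : 0 ≤ z.re) :
    -(k + Complex.I * z) ∈ Complex.slitPlane := by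
  rw [Complex.mem_slitPlane_iff]
  rcases h with h | h
  · left; simpa using h
  · right
    simp only [Complex.neg_im, Complex.add_im, Complex.mul_im, Complex.I_re, Complex.I_im]
    intro h'
    exact (re_ne_of_abs_ne hz h).2 (by linarith)

lemma num_mem_slitPlane {k z : ℂ} (h : z.im < k.re ∨ z.re ≠ |k.im|) (hz : 0 ≤ z.re) :
    k - Complex.I * conj z ∈ Complex.slitPlane := by
  rw [Complex.mem_slitPlane_iff]
  rcases h with h | h
  · left; simpa using h
  · right
    simpa [sub_eq_zero] using fun h' => (re_ne_of_abs_ne hz h).1 (by linarith)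

lemma den_mem_slitPlane {k z : ℂ} (h : z.im < k.re ∨ z.re ≠ |k.im|) (hz : 0 ≤ z.re) :
    k + Complex.I * z ∈ Complex.slitPlane := by
  rw [Complex.mem_slitPlane_iff]
  rcases h with h | h
  · left; simpa using h
  · right
    simp only [Complex.add_im, Complex.mul_im, Complex.I_re, Complex.I_im]
    intro h'
    exact (re_ne_of_abs_ne hz h).2 (by linarith)

lemma continuousAt_branch {k z : ℂ} (h : k.re < z.im ∨ z.re ≠ |k.im|) (hz : 0 ≤ z.re) :
    ContinuousAt (branch k) z := by
  have h1 := neg_num_mem_slitPlane h hz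
  have h2 := neg_den_mem_slitPlane h hz
  refine ContinuousAt.div ?_ ?_ (csqrt_ne_zero (Complex.slitPlane_ne_zero h2))
  · exact ContinuousAt.comp (f := fun z => -(k - Complex.I * conj z)) (continuousAt_csqrt h1)
      (by fun_prop)
  · exact ContinuousAt.comp (f := fun z => -(k + Complex.I * z)) (continuousAt_csqrt h2)
      (by fun_prop)

lemma continuousAt_branchUp {k z : ℂ} (h : z.im < k.re ∨ z.re ≠ |k.im|) (hz : 0 ≤ z.re) :
    ContinuousAt (branchUp k) z := by
  have h1 := num_mem_slitPlane h hz
  have h2 := den_mem_slitPlane h hz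
  refine ContinuousAt.div ?_ ?_ (csqrt_ne_zero (Complex.slitPlane_ne_zero h2))
  · exact ContinuousAt.comp (f := fun z => (k - Complex.I * conj z)) (continuousAt_csqrt h1)
      (by fun_prop)
  · exact ContinuousAt.comp (f := fun z => (k + Complex.I * z)) (continuousAt_csqrt h2)
      (by fun_prop)

/-- The numerator and the denominator have imaginary parts of opposite signs, so removing the minus
signs under the two roots produces factors `i` and `-i`. In `branchUp_eq_branch` the imaginary parts
have equal signs and the factors cancel. The two lemmas together record the monodromy around the
branch point. -/
lemma branchUp_eq_neg_branch {k z : ℂ} (h : |k.im| < z.re) : branchUp k z = -branch k z := by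
  have h1 := abs_lt.1 h
  have hn : (k - Complex.I * conj z).im < 0 := by
    simp; linarith
  have hd : 0 < (k + Complex.I * z).im := by
    simp; linarith
  rw [branchUp, branch, csqrt_neg_of_im_pos hd, csqrt_neg_of_im_neg hn, mul_div_mul_comm]
  simp

lemma branchUp_eq_branch {k z : ℂ} (h : z.re < |k.im|) (hz : 0 ≤ z.re) :
    branchUp k z = branch k z := by
  rcases le_or_gt 0 k.im with hk | hk
  · rw [abs_of_nonneg hk] at h
    have hn : 0 < (k - Complex.I * conj z).im := by simp; linarith
    have hd : 0 < (k + Complex.I * z).im := by simp; linarith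
    rw [branchUp, branch, csqrt_neg_of_im_pos hd, csqrt_neg_of_im_pos hn, mul_div_mul_comm]
    simp
  · rw [abs_of_neg hk] at h
    have hn : (k - Complex.I * conj z).im < 0 := by simp; linarith
    have hd : (k + Complex.I * z).im < 0 := by simp; linarith
    rw [branchUp, branch, csqrt_neg_of_im_neg hd, csqrt_neg_of_im_neg hn, mul_div_mul_comm]
    simp

lemma branch_axis {k : ℂ} {t : ℝ} (h : k.re < t) : branch k (Complex.I * t) = 1 := by
  have h1 : k - Complex.I * conj (Complex.I * (t : ℂ)) = k + Complex.I * (Complex.I * t) := by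
    simp
  rw [branch, h1]
  apply div_self
  apply csqrt_ne_zero
  intro h0
  have := congrArg Complex.re h0
  simp at this
  linarith

/-- Reflection of the branch in the equatorial plane. -/
lemma conj_branch_ofReal {k : ℂ} {x : ℝ} (h : |k.im| < x) :
    conj (branch k x) = -branch (-conj k) x := by
  have hx : 0 ≤ ((x : ℝ) : ℂ).re := (abs_nonneg _).trans h.le
  have h' : |k.im| < ((x : ℝ) : ℂ).re := h
  -- For real `x`, conjugating `-(k ∓ ix)` gives `-k̄ ∓ ix`, so the conjugate of `branch k` is
  -- `branchUp` at `-k̄`.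
  rw [← branchUp_eq_neg_branch (by simpa using h'), branch, branchUp, map_div₀,
    ← csqrt_conj (neg_num_mem_slitPlane (Or.inr h'.ne') hx),
    ← csqrt_conj (neg_den_mem_slitPlane (Or.inr h'.ne') hx)]
  congr 2
  · simp; ring
  · simp; ring

/-- Near the axis, above the branch point, `lam` is close to `1`. -/
lemma branch_re_pos {k z : ℂ} (h : k.re < z.im) : 0 < (branch k z).re := by
  -- Roots of numbers in the right half-plane lie in the sector `|arg| < π/4`, so the quotient of
  -- two of them has `|arg| < π/2`.
  have key : ∀ u : ℂ, 0 < u.re → |(csqrt u).im| < (csqrt u).re := fun u hu => by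
    have h1 := csqrt_re_pos (Complex.mem_slitPlane_iff.2 (Or.inl hu))
    have h2 := csqrt_re_sq_sub u
    exact abs_lt_of_sq_lt_sq (by linarith) h1.le
  have hu : 0 < (-(k - Complex.I * conj z)).re := by simpa using h
  have hv : 0 < (-(k + Complex.I * z)).re := by simpa using h
  have h1 := key _ hu
  have h2 := key _ hv
  have h3 : csqrt (-(k + Complex.I * z)) ≠ 0 := by
    intro h0; rw [h0] at h2; simp at h2
  rw [branch, Complex.div_re, ← add_div]
  refine div_pos ?_ (Complex.normSq_pos.2 h3)
  have h4 := abs_mul (csqrt (-(k - Complex.I * conj z))).im (csqrt (-(k + Complex.I * z))).im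
  have h5 := neg_abs_le ((csqrt (-(k - Complex.I * conj z))).im * (csqrt (-(k + Complex.I * z))).im)
  have h6 := mul_lt_mul'' h1 h2 (abs_nonneg _) (abs_nonneg _)
  linarith

/-- From `lam² - 1 = -2iρ / (k + iz)`, after division by `lam + 1`, whose real part exceeds `1`.
This is the linear vanishing of `lam - 1` at the axis. -/
lemma norm_branch_sub_one_le {k z : ℂ} (h : k.re < z.im) (hz : 0 ≤ z.re) :
    ‖branch k z - 1‖ * (z.im - k.re) ≤ 2 * z.re := by
  have h1 := (isLambda_branch (k := k) (z := z) (Or.inl h.ne') hz).2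
  have h2 : (branch k z - 1) * (branch k z + 1) * (k + Complex.I * z) = -(2 * z.re * Complex.I) := by
    have : conj z = 2 * z.re - z := by
      apply Complex.ext <;> simp; ring
    rw [this] at h1
    linear_combination h1
  have h3 := congrArg norm h2
  rw [norm_mul, norm_mul, norm_neg, norm_mul, Complex.norm_I, mul_one, norm_mul, Complex.norm_real,
    Real.norm_of_nonneg hz, Complex.norm_ofNat] at h3
  rw [← h3]
  have h4 : 1 ≤ ‖branch k z + 1‖ := by
    have h5 := Complex.abs_re_le_norm (branch k z + 1)
    have h6 := branch_re_pos h
    have h7 := le_abs_self (branch k z + 1).re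
    simp at h7
    simp at h5
    linarith
  have h5 : z.im - k.re ≤ ‖k + Complex.I * z‖ := by
    have h6 := Complex.abs_re_le_norm (k + Complex.I * z)
    have h7 := neg_abs_le (k + Complex.I * z).re
    simp at h7
    simp at h6
    linarith
  have h8 := norm_nonneg (branch k z - 1)
  calc ‖branch k z - 1‖ * (z.im - k.re)
      ≤ ‖branch k z - 1‖ * ‖branch k z + 1‖ * (z.im - k.re) := by
        have : 0 ≤ z.im - k.re := by linarith
        exact mul_le_mul_of_nonneg_right (le_mul_of_one_le_right h8 h4) this
    _ ≤ _ := by gcongr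

/-- Far from the branch point, `|lam|` is bounded above and below. -/
lemma norm_lambda_bounds {k z l : ℂ} (hl : IsLambda k z l) (hk : k ≠ 0) (hz : 5 * ‖k‖ ≤ ‖z‖) :
    ‖l‖ ≤ 2 ∧ ‖l⁻¹‖ ≤ 2 := by
  have h1 := congrArg norm hl.2
  rw [norm_mul, norm_pow] at h1
  have hz' : ‖Complex.I * z‖ = ‖z‖ := by simp
  have hz'' : ‖Complex.I * conj z‖ = ‖z‖ := by simp
  -- For `‖k‖ ≤ ‖z‖ / 5`, both `|lam|²` and its inverse are at most `(6/5) / (4/5) = 3/2`.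
  have a1 := norm_sub_le k (Complex.I * conj z)
  have a2 := norm_sub_norm_le (Complex.I * conj z) k
  have a3 := norm_add_le k (Complex.I * z)
  have a4 := norm_sub_norm_le (Complex.I * z) (-k)
  rw [sub_neg_eq_add, add_comm (Complex.I * z), norm_neg] at a4
  rw [norm_sub_rev] at a2
  rw [hz'] at a3 a4
  rw [hz''] at a1 a2
  have hk0 : 0 < ‖k‖ := norm_pos_iff.2 hk
  have hl0 : 0 < ‖l‖ := norm_pos_iff.2 hl.1
  constructor
  · by_contra! h
    have h2 : 4 ≤ ‖l‖ ^ 2 := by nlinarith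
    have h3 := mul_le_mul_of_nonneg_right h2 (norm_nonneg (k + Complex.I * z))
    linarith
  · rw [norm_inv]
    by_contra! h
    have h2 : ‖l‖ < 1 / 2 := by
      by_contra! h3
      have := inv_anti₀ (by norm_num) h3
      norm_num at this
      linarith
    have h3 : ‖l‖ ^ 2 ≤ 1 / 4 := by nlinarith
    have h4 := mul_le_mul_of_nonneg_right h3 (norm_nonneg (k + Complex.I * z))
    linarith

end Ernst

/-! ### Wirtinger calculus -/

namespace Ernst

lemma dRho_eq (g : ℂ → ℂ) (z : ℂ) : dRho g z = dz g z + dzbar g z := by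
  simp only [dz, dzbar]; ring

lemma dZeta_eq (g : ℂ → ℂ) (z : ℂ) : dZeta g z = Complex.I * (dz g z - dzbar g z) := by
  simp only [dz, dzbar]
  linear_combination dZeta g z * Complex.I_sq

lemma dRho_mul {g h : ℂ → ℂ} {z : ℂ} (hg : DifferentiableAt ℝ g z) (hh : DifferentiableAt ℝ h z) :
    dRho (fun w => g w * h w) z = dRho g z * h z + g z * dRho h z := by
  simp only [dRho, fderiv_fun_mul hg hh]
  simp; ring

lemma dZeta_mul {g h : ℂ → ℂ} {z : ℂ} (hg : DifferentiableAt ℝ g z) (hh : DifferentiableAt ℝ h z) :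
    dZeta (fun w => g w * h w) z = dZeta g z * h z + g z * dZeta h z := by
  simp only [dZeta, fderiv_fun_mul hg hh]
  simp; ring

lemma dz_mul {g h : ℂ → ℂ} {z : ℂ} (hg : DifferentiableAt ℝ g z) (hh : DifferentiableAt ℝ h z) :
    dz (fun w => g w * h w) z = dz g z * h z + g z * dz h z := by
  simp only [dz, dRho_mul hg hh, dZeta_mul hg hh]; ring

lemma dzbar_mul {g h : ℂ → ℂ} {z : ℂ} (hg : DifferentiableAt ℝ g z) (hh : DifferentiableAt ℝ h z) :
    dzbar (fun w => g w * h w) z = dzbar g z * h z + g z * dzbar h z := by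
  simp only [dzbar, dRho_mul hg hh, dZeta_mul hg hh]; ring

lemma dz_sub {g h : ℂ → ℂ} {z : ℂ} (hg : DifferentiableAt ℝ g z) (hh : DifferentiableAt ℝ h z) :
    dz (fun w => g w - h w) z = dz g z - dz h z := by
  simp only [dz, dRho, dZeta, fderiv_fun_sub hg hh]
  simp; ring

lemma dzbar_sub {g h : ℂ → ℂ} {z : ℂ} (hg : DifferentiableAt ℝ g z) (hh : DifferentiableAt ℝ h z) :
    dzbar (fun w => g w - h w) z = dzbar g z - dzbar h z := by
  simp only [dzbar, dRho, dZeta, fderiv_fun_sub hg hh]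
  simp; ring

lemma dz_add {g h : ℂ → ℂ} {z : ℂ} (hg : DifferentiableAt ℝ g z) (hh : DifferentiableAt ℝ h z) :
    dz (fun w => g w + h w) z = dz g z + dz h z := by
  simp only [dz, dRho, dZeta, fderiv_fun_add hg hh]
  simp; ring

lemma differentiableAt_conj {g : ℂ → ℂ} {z : ℂ} (hg : DifferentiableAt ℝ g z) :
    DifferentiableAt ℝ (fun w => conj (g w)) z :=
  Complex.conjCLE.differentiableAt.comp z hg

lemma fderiv_conj {g : ℂ → ℂ} {z : ℂ} (hg : DifferentiableAt ℝ g z) (v : ℂ) :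
    fderiv ℝ (fun w => conj (g w)) z v = conj (fderiv ℝ g z v) := by
  have := (Complex.conjCLE.hasFDerivAt.comp z hg.hasFDerivAt).fderiv
  have h2 : (⇑Complex.conjCLE ∘ g) = fun w => conj (g w) := by ext; simp
  rw [h2] at this
  rw [this]; simp

lemma dRho_conj {g : ℂ → ℂ} {z : ℂ} (hg : DifferentiableAt ℝ g z) :
    dRho (fun w => conj (g w)) z = conj (dRho g z) := fderiv_conj hg 1

lemma dZeta_conj {g : ℂ → ℂ} {z : ℂ} (hg : DifferentiableAt ℝ g z) :
    dZeta (fun w => conj (g w)) z = conj (dZeta g z) := fderiv_conj hg Complex.I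

lemma dz_conj {g : ℂ → ℂ} {z : ℂ} (hg : DifferentiableAt ℝ g z) :
    dz (fun w => conj (g w)) z = conj (dzbar g z) := by
  simp only [dz, dzbar, dRho_conj hg, dZeta_conj hg]
  simp only [map_div₀, map_add, map_mul, Complex.conj_I, map_ofNat]; ring

lemma dzbar_conj {g : ℂ → ℂ} {z : ℂ} (hg : DifferentiableAt ℝ g z) :
    dzbar (fun w => conj (g w)) z = conj (dz g z) := by
  simp only [dz, dzbar, dRho_conj hg, dZeta_conj hg]
  simp only [map_div₀, map_sub, map_mul, Complex.conj_I, map_ofNat]; ring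

lemma differentiableAt_comp_conj {g : ℂ → ℂ} {z : ℂ} (hg : DifferentiableAt ℝ g (conj z)) :
    DifferentiableAt ℝ (fun w => g (conj w)) z :=
  DifferentiableAt.comp (f := fun w => conj w) z hg Complex.conjCLE.differentiableAt

lemma fderiv_comp_conj {g : ℂ → ℂ} {z : ℂ} (hg : DifferentiableAt ℝ g (conj z)) (v : ℂ) :
    fderiv ℝ (fun w => g (conj w)) z v = fderiv ℝ g (conj z) (conj v) := by
  have := (HasFDerivAt.comp (f := ⇑Complex.conjCLE) z (by simpa using hg.hasFDerivAt)
    Complex.conjCLE.hasFDerivAt).fderiv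
  have h2 : (g ∘ ⇑Complex.conjCLE) = fun w => g (conj w) := by ext; simp
  rw [h2] at this
  rw [this]; simp

lemma dRho_comp_conj {g : ℂ → ℂ} {z : ℂ} (hg : DifferentiableAt ℝ g (conj z)) :
    dRho (fun w => g (conj w)) z = dRho g (conj z) := by
  simp [dRho, fderiv_comp_conj hg]

lemma dZeta_comp_conj {g : ℂ → ℂ} {z : ℂ} (hg : DifferentiableAt ℝ g (conj z)) :
    dZeta (fun w => g (conj w)) z = -dZeta g (conj z) := by
  simp [dZeta, fderiv_comp_conj hg]

lemma dz_comp_conj {g : ℂ → ℂ} {z : ℂ} (hg : DifferentiableAt ℝ g (conj z)) :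
    dz (fun w => g (conj w)) z = dzbar g (conj z) := by
  simp only [dz, dzbar, dRho_comp_conj hg, dZeta_comp_conj hg]; ring

lemma dzbar_comp_conj {g : ℂ → ℂ} {z : ℂ} (hg : DifferentiableAt ℝ g (conj z)) :
    dzbar (fun w => g (conj w)) z = dz g (conj z) := by
  simp only [dz, dzbar, dRho_comp_conj hg, dZeta_comp_conj hg]; ring

lemma fderiv_eq_zero_of_dz {g : ℂ → ℂ} {z : ℂ} (h1 : dz g z = 0) (h2 : dzbar g z = 0) :
    fderiv ℝ g z = 0 := by
  have h3 : fderiv ℝ g z 1 = 0 := by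
    have := dRho_eq g z
    rwa [h1, h2, add_zero] at this
  have h4 : fderiv ℝ g z Complex.I = 0 := by
    have := dZeta_eq g z
    rwa [h1, h2, sub_zero, mul_zero] at this
  ext v
  have : v = v.re • (1 : ℂ) + v.im • Complex.I := by simp
  rw [this, map_add, map_smul, map_smul, h3, h4]
  simp

lemma isOpen_exteriorDomain (ρ₀ : ℝ) : IsOpen (exteriorDomain ρ₀) := by
  have h1 : IsOpen {z : ℂ | 0 < z.re} := isOpen_lt continuous_const Complex.continuous_re
  have h2 : IsClosed {z : ℂ | z.im = 0 ∧ z.re ≤ ρ₀} :=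
    (isClosed_eq Complex.continuous_im continuous_const).inter
      (isClosed_le Complex.continuous_re continuous_const)
  exact h1.inter h2.isOpen_compl

lemma conj_mem_exteriorDomain {ρ₀ : ℝ} {z : ℂ} :
    conj z ∈ exteriorDomain ρ₀ ↔ z ∈ exteriorDomain ρ₀ := by
  simp [exteriorDomain]

/-! ### The Wronskian and the symmetries of the Lax pair -/

/-- `Φ` solves the Lax pair at the spectral parameter `k` along every local branch of `lam`. -/
def IsLaxSolution (ρ₀ : ℝ) (f : ℂ → ℂ) (k : ℂ) (Φ : ℂ → ℂ → Matrix (Fin 2) (Fin 2) ℂ) : Prop :=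
  ∀ (Ω : Set ℂ) (ℓ : ℂ → ℂ), IsOpen Ω → Ω ⊆ exteriorDomain ρ₀ → ContinuousOn ℓ Ω →
    (∀ z ∈ Ω, IsLambda k z (ℓ z)) → ∀ z ∈ Ω, ∀ i j : Fin 2,
      DifferentiableAt ℝ (fun w => Φ w (ℓ w) i j) z ∧
      dz (fun w => Φ w (ℓ w) i j) z = (laxU f z (ℓ z) * Φ z (ℓ z)) i j ∧
      dzbar (fun w => Φ w (ℓ w) i j) z = (laxV f z (ℓ z) * Φ z (ℓ z)) i j

section Lax

lemma mul_entry (M N : Matrix (Fin 2) (Fin 2) ℂ) (i j : Fin 2) :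
    (M * N) i j = M i 0 * N 0 j + M i 1 * N 1 j := by
  rw [Matrix.mul_apply, Fin.sum_univ_two]

variable {ρ₀ : ℝ} {f : ℂ → ℂ}

lemma IsErnstPotential.differentiableAt (hf : IsErnstPotential ρ₀ f) {z : ℂ}
    (hz : z ∈ exteriorDomain ρ₀) : DifferentiableAt ℝ f z :=
  (hf.contDiffOn.contDiffAt ((isOpen_exteriorDomain ρ₀).mem_nhds hz)).differentiableAt (by norm_num)

lemma IsErnstPotential.add_conj_ne_zero (hf : IsErnstPotential ρ₀ f) {z : ℂ}
    (hz : z ∈ exteriorDomain ρ₀ ∪ rotationAxis) : f z + conj (f z) ≠ 0 := by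
  intro h
  have h1 := congrArg Complex.re h
  have h2 := hf.re_pos z hz
  simp at h1
  linarith

/-- The antisymmetric matrix of the symplectic form on `ℂ²`. -/
def sympl : Matrix (Fin 2) (Fin 2) ℂ := !![0, 1; -1, 0]

/-- The Pauli matrix `σ₃`. -/
def pauli3 : Matrix (Fin 2) (Fin 2) ℂ := !![1, 0; 0, -1]

lemma laxA_add_laxB (hf : IsErnstPotential ρ₀ f) {z : ℂ} (hz : z ∈ exteriorDomain ρ₀) :
    (laxA f z + laxB f z) * (f z + conj (f z)) = dz (fun w => f w + conj (f w)) z := by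
  have hd := hf.differentiableAt hz
  have h0 := hf.add_conj_ne_zero (Or.inl hz)
  rw [dz_add hd (differentiableAt_conj hd), laxA, laxB]
  field_simp

lemma conj_laxA_add_laxB (hf : IsErnstPotential ρ₀ f) {z : ℂ} (hz : z ∈ exteriorDomain ρ₀) :
    (conj (laxA f z) + conj (laxB f z)) * (f z + conj (f z))
      = dzbar (fun w => f w + conj (f w)) z := by
  have hd := hf.differentiableAt hz
  have h := congrArg conj (laxA_add_laxB hf hz)
  have hs : DifferentiableAt ℝ (fun w => f w + conj (f w)) z := hd.add (differentiableAt_conj hd)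
  rw [← dzbar_conj hs] at h
  simp only [map_mul, map_add, Complex.conj_conj, add_comm (conj (f _))] at h
  exact h

/-- The symplectic form of two solutions of the Lax pair is `f + f̄` times a constant. -/
theorem IsLaxSolution.wronskian_const (hf : IsErnstPotential ρ₀ f) {k : ℂ}
    {Φ Ψ : ℂ → ℂ → Matrix (Fin 2) (Fin 2) ℂ} (hΦ : IsLaxSolution ρ₀ f k Φ)
    (hΨ : IsLaxSolution ρ₀ f k Ψ) {Ω : Set ℂ} {ℓ : ℂ → ℂ} (ho : IsOpen Ω)
    (hc : IsPreconnected Ω) (hΩ : Ω ⊆ exteriorDomain ρ₀) (hℓ : ContinuousOn ℓ Ω)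
    (hl : ∀ z ∈ Ω, IsLambda k z (ℓ z)) :
    ∃ C : Matrix (Fin 2) (Fin 2) ℂ, ∀ z ∈ Ω,
      (Φ z (ℓ z)).transpose * sympl * Ψ z (ℓ z) = (f z + conj (f z)) • C := by
  -- For a 2×2 matrix `N` and the symplectic `J`, `Nᵀ J + J N = tr N • J`. So each entry of the
  -- product satisfies the same first-order equations as `f + f̄`, and the quotient has zero
  -- derivative.
  have key : ∀ i j : Fin 2, ∃ c : ℂ, ∀ z ∈ Ω,
      ((Φ z (ℓ z)).transpose * sympl * Ψ z (ℓ z)) i j = (f z + conj (f z)) * c := by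
    intro i j
    have entry : ∀ z, ((Φ z (ℓ z)).transpose * sympl * Ψ z (ℓ z)) i j
        = Φ z (ℓ z) 0 i * Ψ z (ℓ z) 1 j - Φ z (ℓ z) 1 i * Ψ z (ℓ z) 0 j := by
      intro z
      simp [mul_entry, sympl]
      ring
    set W : ℂ → ℂ := fun z => ((Φ z (ℓ z)).transpose * sympl * Ψ z (ℓ z)) i j with hW
    have hWd : ∀ z ∈ Ω, DifferentiableAt ℝ W z ∧
        dz W z = (laxA f z + laxB f z) * W z ∧
        dzbar W z = (conj (laxA f z) + conj (laxB f z)) * W z := by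
      intro z hz
      have a0 := hΦ Ω ℓ ho hΩ hℓ hl z hz 0 i
      have a1 := hΦ Ω ℓ ho hΩ hℓ hl z hz 1 i
      have b0 := hΨ Ω ℓ ho hΩ hℓ hl z hz 0 j
      have b1 := hΨ Ω ℓ ho hΩ hℓ hl z hz 1 j
      have hl0 := (hl z hz).1
      rw [hW]
      simp only [entry]
      have m1 : DifferentiableAt ℝ (fun z => Φ z (ℓ z) 0 i * Ψ z (ℓ z) 1 j) z := a0.1.mul b1.1
      have m2 : DifferentiableAt ℝ (fun z => Φ z (ℓ z) 1 i * Ψ z (ℓ z) 0 j) z := a1.1.mul b0.1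
      refine ⟨m1.sub m2, ?_, ?_⟩
      · rw [dz_sub m1 m2, dz_mul a0.1 b1.1, dz_mul a1.1 b0.1,
          a0.2.1, a1.2.1, b0.2.1, b1.2.1]
        simp [mul_entry, laxU]
        ring
      · rw [dzbar_sub m1 m2, dzbar_mul a0.1 b1.1, dzbar_mul a1.1 b0.1,
          a0.2.2, a1.2.2, b0.2.2, b1.2.2]
        simp [mul_entry, laxV]
        ring
    have hs : ∀ z ∈ Ω, DifferentiableAt ℝ (fun w => f w + conj (f w)) z := fun z hz =>
      (hf.differentiableAt (hΩ hz)).add (differentiableAt_conj (hf.differentiableAt (hΩ hz)))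
    have hs0 : ∀ z ∈ Ω, f z + conj (f z) ≠ 0 := fun z hz => hf.add_conj_ne_zero (Or.inl (hΩ hz))
    set q : ℂ → ℂ := fun z => W z / (f z + conj (f z)) with hq
    have hqd : ∀ z ∈ Ω, DifferentiableAt ℝ q z := fun z hz => by
      have := (hWd z hz).1.mul ((hs z hz).inv (hs0 z hz))
      simp only [hq, div_eq_mul_inv]
      exact this
    have hqW : ∀ z ∈ Ω, W =ᶠ[𝓝 z] fun w => q w * (f w + conj (f w)) := fun z hz => by
      filter_upwards [ho.mem_nhds hz] with w hw
      rw [hq]; field_simp [hs0 w hw]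
    obtain ⟨c, hcq⟩ := ho.exists_is_const_of_fderiv_eq_zero hc
      (fun z hz => (hqd z hz).differentiableWithinAt) (fun z hz => by
        have e := (hqW z hz).fderiv_eq (𝕜 := ℝ)
        have e1 : dz W z = dz (fun w => q w * (f w + conj (f w))) z := by
          simp only [dz, dRho, dZeta, e]
        have e2 : dzbar W z = dzbar (fun w => q w * (f w + conj (f w))) z := by
          simp only [dzbar, dRho, dZeta, e]
        have hW' := (hqW z hz).self_of_nhds
        rw [dz_mul (hqd z hz) (hs z hz), (hWd z hz).2.1, ← laxA_add_laxB hf (hΩ hz), hW'] at e1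
        rw [dzbar_mul (hqd z hz) (hs z hz), (hWd z hz).2.2, ← conj_laxA_add_laxB hf (hΩ hz),
          hW'] at e2
        have e3 : dz q z * (f z + conj (f z)) = 0 := by linear_combination -e1
        have e4 : dzbar q z * (f z + conj (f z)) = 0 := by linear_combination -e2
        exact fderiv_eq_zero_of_dz ((mul_eq_zero.1 e3).resolve_right (hs0 z hz))
          ((mul_eq_zero.1 e4).resolve_right (hs0 z hz)))
    refine ⟨c, fun z hz => ?_⟩
    rw [← hcq z hz]
    have := (hqW z hz).self_of_nhds
    simp only [hW] at this
    rw [this]; ring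
  choose c hcc using key
  exact ⟨Matrix.of c, fun z hz => by ext i j; simpa using hcc i j z hz⟩

/-- The Lax pair is invariant under the exchange of the sheets. -/
theorem IsLaxSolution.pauli3_neg {k : ℂ} {Φ : ℂ → ℂ → Matrix (Fin 2) (Fin 2) ℂ}
    (hΦ : IsLaxSolution ρ₀ f k Φ) :
    IsLaxSolution ρ₀ f k (fun z l => pauli3 * Φ z (-l)) := by
  intro Ω ℓ ho hΩ hℓ hl z hz i j
  -- The symmetry behind this is `σ₃ U(lam) σ₃ = U(-lam)`, and likewise for `V`.
  have h := fun i => hΦ Ω (fun w => -ℓ w) ho hΩ hℓ.neg (fun w hw => (hl w hw).neg) z hz i j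
  have e0 : (fun w => (pauli3 * Φ w (-ℓ w)) 0 j) = fun w => Φ w (-ℓ w) 0 j := by
    ext w; simp [pauli3, mul_entry]
  have e1 : (fun w => (pauli3 * Φ w (-ℓ w)) 1 j) = fun w => (-1) * Φ w (-ℓ w) 1 j := by
    ext w; simp [pauli3, mul_entry]
  have c1 : dz (fun _ : ℂ => (-1 : ℂ)) z = 0 := by simp [dz, dRho, dZeta]
  have c2 : dzbar (fun _ : ℂ => (-1 : ℂ)) z = 0 := by simp [dzbar, dRho, dZeta]
  fin_cases i
  · simp only [Fin.zero_eta, e0]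
    refine ⟨(h 0).1, (h 0).2.1.trans ?_, (h 0).2.2.trans ?_⟩
    · simp only [mul_entry]; simp [laxU, pauli3]
    · simp only [mul_entry]; simp [laxV, pauli3]
  · simp only [Fin.mk_one, e1]
    have hc : DifferentiableAt ℝ (fun _ : ℂ => (-1 : ℂ)) z := differentiableAt_const _
    refine ⟨hc.mul (h 1).1, ?_, ?_⟩
    · rw [dz_mul hc (h 1).1, c1, (h 1).2.1]
      simp only [mul_entry]; simp [laxU, pauli3]; ring
    · rw [dzbar_mul hc (h 1).1, c2, (h 1).2.2]
      simp only [mul_entry]; simp [laxV, pauli3]; ring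

lemma IsLambda.conj_conj {k z l : ℂ} (h : IsLambda (-conj k) z l) :
    IsLambda k (conj z) (conj l) := by
  refine ⟨by simpa using h.1, ?_⟩
  have := congrArg conj h.2
  simp at this
  rw [Complex.conj_conj]
  linear_combination -this

/-- Conjugating both the argument and the value exchanges `∂_z` and `∂_z̄` twice, so each
coefficient is carried to itself. -/
lemma laxA_eq_conj (hsymm : IsEquatoriallySymmetric ρ₀ f) (hf : IsErnstPotential ρ₀ f) {z : ℂ}
    (hz : z ∈ exteriorDomain ρ₀) :
    laxA f z = conj (laxA f (conj z)) ∧ laxB f z = conj (laxB f (conj z)) := by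
  have hz' : conj z ∈ exteriorDomain ρ₀ := conj_mem_exteriorDomain.2 hz
  have hd := hf.differentiableAt hz'
  have e : f =ᶠ[𝓝 z] fun w => conj (f (conj w)) := by
    filter_upwards [(isOpen_exteriorDomain ρ₀).mem_nhds hz] with w hw using hsymm w hw
  have e' : (fun w => conj (f w)) =ᶠ[𝓝 z] fun w => f (conj w) := by
    filter_upwards [(isOpen_exteriorDomain ρ₀).mem_nhds hz] with w hw
    rw [hsymm w hw, Complex.conj_conj]
  have h1 : dz f z = conj (dz f (conj z)) := by
    have : dz f z = dz (fun w => conj (f (conj w))) z := by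
      simp only [dz, dRho, dZeta, e.fderiv_eq]
    rw [this, dz_conj (differentiableAt_comp_conj hd), dzbar_comp_conj hd]
  have h2 : dz (fun w => conj (f w)) z = conj (dz (fun w => conj (f w)) (conj z)) := by
    have : dz (fun w => conj (f w)) z = dz (fun w => f (conj w)) z := by
      simp only [dz, dRho, dZeta, e'.fderiv_eq]
    rw [this, dz_comp_conj hd, dz_conj hd, Complex.conj_conj]
  have h3 := hsymm z hz
  constructor
  · rw [laxA, laxA, h1, h3]; simp
  · rw [laxB, laxB, h2, h3]; simp

/-- Reflection of solutions of the Lax pair in the equatorial plane. -/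
theorem IsLaxSolution.reflect (hf : IsErnstPotential ρ₀ f) (hsymm : IsEquatoriallySymmetric ρ₀ f)
    {k : ℂ} {Φ : ℂ → ℂ → Matrix (Fin 2) (Fin 2) ℂ} (hΦ : IsLaxSolution ρ₀ f k Φ) :
    IsLaxSolution ρ₀ f (-conj k) (fun z l => (Φ (conj z) (conj l)).map conj) := by
  intro Ω ℓ ho hΩ hℓ hl z hz i j
  set Ω' : Set ℂ := {w | conj w ∈ Ω} with hΩ'
  have ho' : IsOpen Ω' := ho.preimage Complex.continuous_conj
  have hz' : conj z ∈ Ω' := by simpa [hΩ'] using hz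
  have h := hΦ Ω' (fun w => conj (ℓ (conj w))) ho'
    (fun w hw => conj_mem_exteriorDomain.1 (hΩ hw))
    (Complex.continuous_conj.comp_continuousOn
      (hℓ.comp Complex.continuous_conj.continuousOn (fun w hw => hw)))
    (fun w hw => by simpa using (hl _ hw).conj_conj) (conj z) hz' i j
  have e : (fun w => (Φ (conj w) (conj (ℓ w))).map conj i j)
      = fun w => conj ((fun v => Φ v (conj (ℓ (conj v))) i j) (conj w)) := by
    ext w; simp
  obtain ⟨hA, hB⟩ := laxA_eq_conj hsymm hf (hΩ hz)
  beta_reduce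
  rw [e]
  have hd := differentiableAt_comp_conj h.1
  refine ⟨differentiableAt_conj hd, ?_, ?_⟩
  · rw [dz_conj hd, dzbar_comp_conj h.1, h.2.1]
    simp only [Complex.conj_conj]
    fin_cases i <;> simp [laxU, mul_entry, ← hA, ← hB]
  · rw [dzbar_conj hd, dz_comp_conj h.1, h.2.2]
    simp only [Complex.conj_conj]
    fin_cases i <;> simp [laxV, mul_entry, hA, hB]

end Lax

end Ernst

/-! ### Equality of the Wronskian constants on the two sheets -/

namespace Ernst

/-- A connected part of the exterior domain which avoids the cut of `branch k`, and contains a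
neighbourhood of the upper end of the axis and of the equatorial plane outside the disk. -/
def upperRegion (ρ₀ : ℝ) (k : ℂ) : Set ℂ :=
  {z | |k.im| < z.re ∧ (z.im ≠ 0 ∨ ρ₀ < z.re)} ∪ {z | 0 < z.re ∧ max k.re 0 < z.im}

variable {ρ₀ : ℝ} {f : ℂ → ℂ} {k : ℂ}

lemma convex_re_gt (c : ℝ) : Convex ℝ {z : ℂ | c < z.re} := convex_halfSpace_re_gt c
lemma convex_im_gt (c : ℝ) : Convex ℝ {z : ℂ | c < z.im} := convex_halfSpace_im_gt c

lemma isOpen_re_gt (c : ℝ) : IsOpen {z : ℂ | c < z.re} :=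
  isOpen_lt continuous_const Complex.continuous_re
lemma isOpen_im_gt (c : ℝ) : IsOpen {z : ℂ | c < z.im} :=
  isOpen_lt continuous_const Complex.continuous_im
lemma isOpen_re_lt (c : ℝ) : IsOpen {z : ℂ | z.re < c} :=
  isOpen_lt Complex.continuous_re continuous_const
lemma isOpen_im_lt (c : ℝ) : IsOpen {z : ℂ | z.im < c} :=
  isOpen_lt Complex.continuous_im continuous_const

lemma isOpen_upperRegion (ρ₀ : ℝ) (k : ℂ) : IsOpen (upperRegion ρ₀ k) := by
  have h : IsOpen {z : ℂ | z.im ≠ 0} := isOpen_ne_fun Complex.continuous_im continuous_const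
  exact ((isOpen_re_gt _).inter (h.union (isOpen_re_gt _))).union
    ((isOpen_re_gt _).inter (isOpen_im_gt _))

lemma upperRegion_subset (ρ₀ : ℝ) (k : ℂ) : upperRegion ρ₀ k ⊆ exteriorDomain ρ₀ := by
  rintro z (⟨h1, h2⟩ | ⟨h1, h2⟩)
  · refine ⟨(abs_nonneg _).trans_lt h1, fun h => ?_⟩
    rcases h2 with h2 | h2
    · exact h2 h.1
    · exact absurd h.2 (not_le.2 h2)
  · exact ⟨h1, fun h => by
      have := (le_max_right k.re 0).trans_lt h2
      exact this.ne' h.1⟩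

lemma upperRegion_cut {z : ℂ} (hz : z ∈ upperRegion ρ₀ k) :
    (k.re < z.im ∨ z.re ≠ |k.im|) ∧ 0 < z.re := by
  rcases hz with ⟨h1, _⟩ | ⟨h1, h2⟩
  · exact ⟨Or.inr h1.ne', (abs_nonneg _).trans_lt h1⟩
  · exact ⟨Or.inl ((le_max_left _ _).trans_lt h2), h1⟩

/-- The region is covered by three convex pieces, each meeting the half-plane to the right of both
the disk and the branch point. -/
lemma isPreconnected_upperRegion (ρ₀ : ℝ) (k : ℂ) : IsPreconnected (upperRegion ρ₀ k) := by
  set c := max |k.im| ρ₀ with hc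
  have c1 : |k.im| ≤ c := le_max_left _ _
  have c2 : ρ₀ ≤ c := le_max_right _ _
  have c0 : 0 ≤ c := (abs_nonneg _).trans c1
  have e : upperRegion ρ₀ k = ({z : ℂ | c < z.re} ∪ ({z : ℂ | |k.im| < z.re} ∩ {z | 0 < z.im})) ∪
      (({z : ℂ | c < z.re} ∪ ({z : ℂ | |k.im| < z.re} ∩ {z | z.im < 0})) ∪
      ({z : ℂ | c < z.re} ∪ ({z : ℂ | 0 < z.re} ∩ {z | max k.re 0 < z.im}))) := by
    ext z
    simp only [upperRegion, Set.mem_union, Set.mem_ofPred_eq, Set.mem_inter_iff]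
    have h1 : c < z.re ↔ |k.im| < z.re ∧ ρ₀ < z.re := max_lt_iff
    rw [h1, ne_iff_lt_or_gt]
    tauto
  have key : ∀ S : Set ℂ, Convex ℝ S → (∃ z ∈ S, c < z.re) →
      IsPreconnected ({z : ℂ | c < z.re} ∪ S) := by
    rintro S hS ⟨z, hz, hz'⟩
    exact IsPreconnected.union z hz' hz (convex_re_gt c).isPreconnected hS.isPreconnected
  have hp : ((c + 1 : ℝ) : ℂ) ∈ {z : ℂ | c < z.re} := by simp
  have hm := abs_nonneg k.re
  have hm' : max k.re 0 ≤ |k.re| := max_le (le_abs_self _) hm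
  rw [e]
  refine IsPreconnected.union _ (Or.inl hp) (Or.inl (Or.inl hp)) ?_
    (IsPreconnected.union _ (Or.inl hp) (Or.inl hp) ?_ ?_)
  · exact key _ ((convex_re_gt _).inter (convex_im_gt _)) ⟨⟨c + 1, 1⟩, by simp; linarith⟩
  · exact key _ ((convex_re_gt _).inter (convex_halfSpace_im_lt _))
      ⟨⟨c + 1, -1⟩, by simp; linarith⟩
  · exact key _ ((convex_re_gt _).inter (convex_im_gt _))
      ⟨⟨c + 1, |k.re| + 1⟩, by
        simp only [Set.mem_inter_iff, Set.mem_ofPred_eq]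
        exact ⟨⟨by linarith, by linarith⟩, by linarith⟩⟩

/-- The branch point of `lam` in the right half-plane. -/
def branchPoint (k : ℂ) : ℂ := ⟨|k.im|, k.re⟩

lemma branchPoint_mem (hre : k.re ≠ 0) (him : k.im ≠ 0) : branchPoint k ∈ exteriorDomain ρ₀ :=
  ⟨abs_pos.2 him, fun h => hre h.1⟩

/-- Taking for `S` the upper or the lower half-plane bounded by the horizontal line through `c`,
this is a disk slit along a vertical radius. -/
lemma isPreconnected_ball_cut (r : ℝ) (c : ℂ) {S : Set ℂ} (hS : Convex ℝ S)
    (h1 : ∃ z ∈ Metric.ball c r ∩ S, c.re < z.re) (h2 : ∃ z ∈ Metric.ball c r ∩ S, z.re < c.re) :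
    IsPreconnected (Metric.ball c r ∩ (S ∪ {z | c.re < z.re} ∪ {z | z.re < c.re})) := by
  obtain ⟨z1, h1, h1'⟩ := h1
  obtain ⟨z2, h2, h2'⟩ := h2
  have hb : Convex ℝ (Metric.ball c r) := convex_ball c r
  rw [Set.inter_union_distrib_left, Set.inter_union_distrib_left]
  refine IsPreconnected.union z2 (Or.inl h2) ⟨h2.1, h2'⟩
    (IsPreconnected.union z1 h1 ⟨h1.1, h1'⟩ ?_ ?_ ) ?_
  · exact (hb.inter hS).isPreconnected
  · exact (hb.inter (convex_re_gt _)).isPreconnected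
  · exact (hb.inter (convex_halfSpace_re_lt _)).isPreconnected

lemma mem_ball_of_offset {r x y : ℝ} (hr : 0 < r) (hx : |x| ≤ r / 4) (hy : |y| ≤ r / 4) (c : ℂ) :
    (⟨c.re + x, c.im + y⟩ : ℂ) ∈ Metric.ball c r := by
  rw [mem_ball_iff_norm]
  have := Complex.norm_le_abs_re_add_abs_im ((⟨c.re + x, c.im + y⟩ : ℂ) - c)
  simp at this
  linarith

/-- On the region `upperRegion ρ₀ k`, the symplectic form of two solutions of the Lax pair is
`f + f̄` times a constant which is the same on both sheets. -/
theorem IsLaxSolution.wronskian_sheets (hf : IsErnstPotential ρ₀ f) (hre : k.re ≠ 0)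
    (him : k.im ≠ 0) {Φ Ψ : ℂ → ℂ → Matrix (Fin 2) (Fin 2) ℂ} (hΦ : IsLaxSolution ρ₀ f k Φ)
    (hΨ : IsLaxSolution ρ₀ f k Ψ) :
    ∃ C : Matrix (Fin 2) (Fin 2) ℂ, ∀ z ∈ upperRegion ρ₀ k,
      (Φ z (branch k z)).transpose * sympl * Ψ z (branch k z) = (f z + conj (f z)) • C ∧
      (Φ z (-branch k z)).transpose * sympl * Ψ z (-branch k z) = (f z + conj (f z)) • C := by
  have cancel : ∀ z ∈ exteriorDomain ρ₀, ∀ C C' : Matrix (Fin 2) (Fin 2) ℂ,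
      (f z + conj (f z)) • C = (f z + conj (f z)) • C' → C = C' := fun z hz C C' h =>
    smul_right_injective _ (hf.add_conj_ne_zero (Or.inl hz)) h
  set c := branchPoint k with hc
  have hcre : c.re = |k.im| := rfl
  have hcim : c.im = k.re := rfl
  -- The conditions on `k` keep the branch point off the cut `ζ = 0` and off the axis, so a whole
  -- disk around it lies in the domain and a loop around it is possible.
  obtain ⟨r, hr, hrD⟩ := Metric.isOpen_iff.1 (isOpen_exteriorDomain ρ₀) c (branchPoint_mem hre him)
  set Ω₁ : Set ℂ := Metric.ball c r ∩ ({z | c.im < z.im} ∪ {z | c.re < z.re} ∪ {z | z.re < c.re})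
  set Ω₂ : Set ℂ := Metric.ball c r ∩ ({z | z.im < c.im} ∪ {z | c.re < z.re} ∪ {z | z.re < c.re})
  have habs : ∀ t : ℝ, (t = r / 4 ∨ t = -(r / 4) ∨ t = 0) → |t| ≤ r / 4 := by
    rintro t (rfl | rfl | rfl)
    · rw [abs_of_pos (by linarith)]
    · rw [abs_neg, abs_of_pos (by linarith)]
    · simp; linarith
  have hp₁ : IsPreconnected Ω₁ := isPreconnected_ball_cut r c (convex_im_gt _)
    ⟨_, ⟨mem_ball_of_offset hr (habs (r / 4) (by simp)) (habs (r / 4) (by simp)) c, by simpa⟩,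
      by simpa⟩
    ⟨_, ⟨mem_ball_of_offset hr (habs (-(r / 4)) (by simp)) (habs (r / 4) (by simp)) c, by simpa⟩,
      by simpa⟩
  have hp₂ : IsPreconnected Ω₂ := isPreconnected_ball_cut r c (convex_halfSpace_im_lt _)
    ⟨_, ⟨mem_ball_of_offset hr (habs (r / 4) (by simp)) (habs (-(r / 4)) (by simp)) c, by simpa⟩,
      by simpa⟩
    ⟨_, ⟨mem_ball_of_offset hr (habs (-(r / 4)) (by simp)) (habs (-(r / 4)) (by simp)) c,
      by simpa⟩, by simpa⟩
  have ho₁ : IsOpen Ω₁ := Metric.isOpen_ball.inter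
    (((isOpen_im_gt _).union (isOpen_re_gt _)).union (isOpen_re_lt _))
  have ho₂ : IsOpen Ω₂ := Metric.isOpen_ball.inter
    (((isOpen_im_lt _).union (isOpen_re_gt _)).union (isOpen_re_lt _))
  have hcut₁ : ∀ z ∈ Ω₁, (k.re < z.im ∨ z.re ≠ |k.im|) ∧ 0 ≤ z.re := by
    rintro z ⟨hz, hz'⟩
    refine ⟨?_, (hrD hz).1.le⟩
    rcases hz' with (h | h) | h
    · exact Or.inl h
    · exact Or.inr (ne_of_gt h)
    · exact Or.inr (ne_of_lt h)
  have hcut₂ : ∀ z ∈ Ω₂, (z.im < k.re ∨ z.re ≠ |k.im|) ∧ 0 ≤ z.re := by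
    rintro z ⟨hz, hz'⟩
    refine ⟨?_, (hrD hz).1.le⟩
    rcases hz' with (h | h) | h
    · exact Or.inl h
    · exact Or.inr (ne_of_gt h)
    · exact Or.inr (ne_of_lt h)
  have hb₁ : ContinuousOn (branch k) Ω₁ := fun z hz =>
    (continuousAt_branch (hcut₁ z hz).1 (hcut₁ z hz).2).continuousWithinAt
  have hb₂ : ContinuousOn (branchUp k) Ω₂ := fun z hz =>
    (continuousAt_branchUp (hcut₂ z hz).1 (hcut₂ z hz).2).continuousWithinAt
  have hl₁ : ∀ z ∈ Ω₁, IsLambda k z (branch k z) := fun z hz =>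
    isLambda_branch ((hcut₁ z hz).1.imp ne_of_gt id) (hcut₁ z hz).2
  have hl₂ : ∀ z ∈ Ω₂, IsLambda k z (branchUp k z) := fun z hz =>
    isLambda_branchUp ((hcut₂ z hz).1.imp ne_of_lt id) (hcut₂ z hz).2
  obtain ⟨C₁, hC₁⟩ := hΦ.wronskian_const hf hΨ ho₁ hp₁ (fun z hz => hrD hz.1) hb₁ hl₁
  obtain ⟨C₁', hC₁'⟩ := hΦ.wronskian_const hf hΨ ho₁ hp₁ (ℓ := fun z => -branch k z)
    (fun z hz => hrD hz.1) hb₁.neg (fun z hz => (hl₁ z hz).neg)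
  obtain ⟨C₂, hC₂⟩ := hΦ.wronskian_const hf hΨ ho₂ hp₂ (fun z hz => hrD hz.1) hb₂ hl₂
  obtain ⟨C, hC⟩ := hΦ.wronskian_const hf hΨ (isOpen_upperRegion ρ₀ k)
    (isPreconnected_upperRegion ρ₀ k) (upperRegion_subset ρ₀ k)
    (fun z hz => (continuousAt_branch (upperRegion_cut hz).1
      (upperRegion_cut hz).2.le).continuousWithinAt)
    (fun z hz => isLambda_branch ((upperRegion_cut hz).1.imp ne_of_gt id) (upperRegion_cut hz).2.le)
  obtain ⟨C', hC'⟩ := hΦ.wronskian_const hf hΨ (isOpen_upperRegion ρ₀ k)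
    (isPreconnected_upperRegion ρ₀ k) (upperRegion_subset ρ₀ k) (ℓ := fun z => -branch k z)
    (fun z hz => (continuousAt_branch (upperRegion_cut hz).1
      (upperRegion_cut hz).2.le).neg.continuousWithinAt)
    (fun z hz => (isLambda_branch ((upperRegion_cut hz).1.imp ne_of_gt id)
      (upperRegion_cut hz).2.le).neg)
  have hpB := mem_ball_of_offset hr (habs (r / 4) (by simp)) (habs 0 (by simp)) c
  have hqB := mem_ball_of_offset hr (habs (-(r / 4)) (by simp)) (habs 0 (by simp)) c
  set p : ℂ := ⟨c.re + r / 4, c.im + 0⟩ with hp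
  set q : ℂ := ⟨c.re + -(r / 4), c.im + 0⟩ with hq
  have hpr : |k.im| < p.re := by rw [← hcre]; simpa [hp]
  have hqr : q.re < |k.im| := by rw [← hcre]; simpa [hq]
  have hpX : p ∈ upperRegion ρ₀ k := Or.inl ⟨hpr, Or.inl (by simpa [hp, hcim])⟩
  have hp1 : p ∈ Ω₁ := ⟨hpB, Or.inl (Or.inr hpr)⟩
  have hp2 : p ∈ Ω₂ := ⟨hpB, Or.inl (Or.inr hpr)⟩
  have hq1 : q ∈ Ω₁ := ⟨hqB, Or.inr hqr⟩
  have hq2 : q ∈ Ω₂ := ⟨hqB, Or.inr hqr⟩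
  -- One turn around the branch point: from `branch` to `branchUp` on the left, where they agree,
  -- then from `branchUp` to `-branch` on the right.
  have e1 : C₁ = C₂ := by
    refine cancel q (hrD hqB) _ _ ?_
    rw [← hC₁ q hq1, ← hC₂ q hq2, branchUp_eq_branch hqr (hcut₁ q hq1).2]
  have e2 : C₁' = C₂ := by
    refine cancel p (hrD hpB) _ _ ?_
    rw [← hC₁' p hp1, ← hC₂ p hp2, branchUp_eq_neg_branch hpr]
  have e3 : C₁ = C := cancel p (hrD hpB) _ _ (by rw [← hC₁ p hp1, ← hC p hpX])
  have e4 : C₁' = C' := cancel p (hrD hpB) _ _ (by rw [← hC₁' p hp1, ← hC' p hpX])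
  refine ⟨C, fun z hz => ⟨hC z hz, ?_⟩⟩
  rw [← e3, e1, ← e2, e4]
  exact hC' z hz

end Ernst

/-! ### Limits on the axis and exchange of the sheets -/

namespace Ernst

section Axis

variable {ρ₀ : ℝ} {f : ℂ → ℂ} {k : ℂ}

/-- The matrix `[[f̄, 1], [f, -1]]`. -/
def axisFrame (f : ℂ → ℂ) (z : ℂ) : Matrix (Fin 2) (Fin 2) ℂ := !![conj (f z), 1; f z, -1]

lemma axis_mem_closure {t : ℝ} (h : max k.re 0 < t) :
    Complex.I * t ∈ closure (upperRegion ρ₀ k) := by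
  have h1 : Tendsto (fun x : ℝ => (x : ℂ) + Complex.I * t) (𝓝[>] 0) (𝓝 (Complex.I * t)) := by
    have : Tendsto (fun x : ℝ => (x : ℂ) + Complex.I * t) (𝓝 0) (𝓝 (((0 : ℝ) : ℂ) + Complex.I * t)) :=
      (Continuous.tendsto (by fun_prop) _)
    simp only [Complex.ofReal_zero, zero_add] at this
    exact this.mono_left nhdsWithin_le_nhds
  refine mem_closure_of_tendsto h1 ?_
  filter_upwards [self_mem_nhdsWithin] with x hx
  right
  have hx' : 0 < x := hx
  constructor
  · simpa using hx'
  · simpa using h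

lemma axis_mem_rotationAxis {t : ℝ} (h : t ≠ 0) : Complex.I * t ∈ rotationAxis := by
  simpa [rotationAxis] using h

lemma tendsto_branch_axis {t : ℝ} (h : k.re < t) :
    Tendsto (branch k) (𝓝 (Complex.I * t)) (𝓝 1) := by
  have := continuousAt_branch (k := k) (z := Complex.I * t) (Or.inl (by simpa using h)) (by simp)
  simpa only [ContinuousAt, branch_axis h] using this

lemma IsErnstPotential.tendsto_axis (hf : IsErnstPotential ρ₀ f) {z : ℂ} (hz : z ∈ rotationAxis) :
    Tendsto f (𝓝[exteriorDomain ρ₀] z) (𝓝 (f z)) :=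
  (hf.continuousOn z (Or.inr hz)).mono_left (nhdsWithin_mono _ Set.subset_union_left)

lemma upperRegion_isLambda {z : ℂ} (hz : z ∈ upperRegion ρ₀ k) : IsLambda k z (branch k z) :=
  isLambda_branch ((upperRegion_cut hz).1.imp ne_of_gt id) (upperRegion_cut hz).2.le

lemma IsEigenfunction.tendsto_axis {Φ : ℂ → ℂ → Matrix (Fin 2) (Fin 2) ℂ}
    (hΦ : IsEigenfunction ρ₀ f k Φ) {t : ℝ} (h : max k.re 0 < t) :
    Tendsto (fun z => Φ z (branch k z)) (𝓝[upperRegion ρ₀ k] (Complex.I * t))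
      (𝓝 (Φ (Complex.I * t) 1)) ∧
    Tendsto (fun z => Φ z (-branch k z)) (𝓝[upperRegion ρ₀ k] (Complex.I * t))
      (𝓝 (Φ (Complex.I * t) (-1))) := by
  have hb : Tendsto (branch k) (𝓝[upperRegion ρ₀ k] (Complex.I * t)) (𝓝 1) :=
    (tendsto_branch_axis ((le_max_left _ _).trans_lt h)).mono_left nhdsWithin_le_nhds
  have hid : Tendsto (fun z : ℂ => z) (𝓝[upperRegion ρ₀ k] (Complex.I * t))
      (𝓝 (Complex.I * t)) := nhdsWithin_le_nhds
  have hax : Complex.I * t ∈ rotationAxis :=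
    axis_mem_rotationAxis ((le_max_right _ _).trans_lt h).ne'
  constructor
  · refine (hΦ.continuousOn (Complex.I * t, 1) (Or.inr ⟨hax, Or.inl rfl⟩)).tendsto.comp
      (f := fun z => (z, branch k z)) ?_
    refine tendsto_nhdsWithin_iff.2 ⟨hid.prodMk_nhds hb, ?_⟩
    filter_upwards [self_mem_nhdsWithin] with z hz
    exact Or.inl ⟨upperRegion_subset _ _ hz, upperRegion_isLambda hz⟩
  · refine (hΦ.continuousOn (Complex.I * t, -1) (Or.inr ⟨hax, Or.inr rfl⟩)).tendsto.comp
      (f := fun z => (z, -branch k z)) ?_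
    refine tendsto_nhdsWithin_iff.2 ⟨hid.prodMk_nhds hb.neg, ?_⟩
    filter_upwards [self_mem_nhdsWithin] with z hz
    exact Or.inl ⟨upperRegion_subset _ _ hz, (upperRegion_isLambda hz).neg⟩

lemma IsErnstPotential.norm_sub_one_le (hf : IsErnstPotential ρ₀ f) {ε : ℝ} (hε : 0 < ε) :
    ∃ R, 0 < R ∧ ∀ z ∈ exteriorDomain ρ₀, R ≤ ‖z‖ → ‖f z - 1‖ ≤ ε := by
  have h := hf.flat (Metric.closedBall_mem_nhds 1 hε)
  rw [mem_map, mem_inf_principal] at h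
  obtain ⟨R, -, hR⟩ := (Filter.hasBasis_cobounded_norm (E := ℂ)).mem_iff.1 h
  refine ⟨max R 1, by positivity, fun z hz hz' => ?_⟩
  simpa [dist_eq_norm] using hR ((le_max_left _ _).trans hz' : R ≤ ‖z‖) hz

/-- Flatness concerns the open domain only; continuity up to the axis carries the bound over. -/
lemma IsErnstPotential.tendsto_one_axis (hf : IsErnstPotential ρ₀ f) :
    Tendsto (fun t : ℝ => f (Complex.I * t)) atTop (𝓝 1) := by
  rw [Metric.tendsto_atTop]
  intro ε hε
  obtain ⟨R, hR, h⟩ := hf.norm_sub_one_le (half_pos hε)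
  refine ⟨R + 1, fun t ht => ?_⟩
  have ht0 : 0 < t := by linarith
  have hcl : Complex.I * t ∈ closure (upperRegion ρ₀ 0) := axis_mem_closure (by simpa using ht0)
  have hne : (𝓝[exteriorDomain ρ₀] (Complex.I * t)).NeBot :=
    mem_closure_iff_nhdsWithin_neBot.1 (closure_mono (upperRegion_subset _ _) hcl)
  have h1 := ((hf.tendsto_axis (axis_mem_rotationAxis ht0.ne')).sub_const 1).norm
  have h2 : ‖f (Complex.I * t) - 1‖ ≤ ε / 2 := by
    refine le_of_tendsto h1 ?_
    have h3 : ∀ᶠ z : ℂ in 𝓝 (Complex.I * t), R < ‖z‖ := by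
      refine (continuous_norm.tendsto (Complex.I * (t : ℂ))).eventually_const_lt ?_
      simp [abs_of_pos ht0]; linarith
    filter_upwards [self_mem_nhdsWithin, mem_nhdsWithin_of_mem_nhds h3] with z hz hz'
    exact h z hz hz'.le
  rw [dist_eq_norm]
  linarith

/-- Limits along the axis of identities on `upperRegion ρ₀ k`. -/
lemma axis_identity (hf : IsErnstPotential ρ₀ f) {S C : Matrix (Fin 2) (Fin 2) ℂ}
    {Φ Ψ : ℂ → Matrix (Fin 2) (Fin 2) ℂ} {Φ₀ Ψ₀ : Matrix (Fin 2) (Fin 2) ℂ}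
    {t : ℝ} (ht : max k.re 0 < t)
    (h : ∀ z ∈ upperRegion ρ₀ k, (Φ z).transpose * S * Ψ z = (f z + conj (f z)) • C)
    (hΦ : Tendsto Φ (𝓝[upperRegion ρ₀ k] (Complex.I * t)) (𝓝 Φ₀))
    (hΨ : Tendsto Ψ (𝓝[upperRegion ρ₀ k] (Complex.I * t)) (𝓝 Ψ₀)) :
    Φ₀.transpose * S * Ψ₀ = (f (Complex.I * t) + conj (f (Complex.I * t))) • C := by
  have hne : (𝓝[upperRegion ρ₀ k] (Complex.I * t)).NeBot :=
    mem_closure_iff_nhdsWithin_neBot.1 (axis_mem_closure ht)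
  have hft := (hf.tendsto_axis (axis_mem_rotationAxis ((le_max_right _ _).trans_lt ht).ne')).mono_left
    (nhdsWithin_mono _ (upperRegion_subset ρ₀ k))
  have h1 : Tendsto (fun z => (Φ z).transpose * S * Ψ z) (𝓝[upperRegion ρ₀ k] (Complex.I * t))
      (𝓝 (Φ₀.transpose * S * Ψ₀)) := by
    have hc : Continuous fun N : Matrix (Fin 2) (Fin 2) ℂ => N.transpose * S := by fun_prop
    have h2 : Tendsto (fun z => (Φ z).transpose * S) (𝓝[upperRegion ρ₀ k] (Complex.I * t))
      (𝓝 (Φ₀.transpose * S)) := (hc.tendsto Φ₀).comp hΦ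
    exact h2.mul hΨ
  have h2 : Tendsto (fun z => (f z + conj (f z)) • C) (𝓝[upperRegion ρ₀ k] (Complex.I * t))
      (𝓝 ((f (Complex.I * t) + conj (f (Complex.I * t))) • C)) :=
    ((by fun_prop : Continuous fun c : ℂ => (c + conj c) • C).tendsto _).comp hft
  refine tendsto_nhds_unique_of_eventuallyEq h1 h2 ?_
  filter_upwards [self_mem_nhdsWithin] with z hz using h z hz

lemma sympl_two (Φ : Matrix (Fin 2) (Fin 2) ℂ) : Φ.transpose * sympl * Φ = Φ.det • sympl := by
  ext i j
  fin_cases i <;> fin_cases j <;>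
    simp [mul_entry, sympl, Matrix.det_fin_two] <;> ring

/-- Exchange of the sheets: `Φ(z, k⁻) = σ₃ Φ(z, k⁺) σ₁`. -/
theorem IsEigenfunction.sheet_exchange (hf : IsErnstPotential ρ₀ f) (hre : k.re ≠ 0)
    (him : k.im ≠ 0) {Φ : ℂ → ℂ → Matrix (Fin 2) (Fin 2) ℂ} (hΦ : IsEigenfunction ρ₀ f k Φ)
    {F G : ℂ → ℂ} (hA : ∀ t : ℝ, 0 < t → Φ (Complex.I * t) 1 =
      axisFrame f (Complex.I * t) * spectralMatrix F G k) (hF : F k ≠ 0) {z : ℂ}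
    (hz : z ∈ upperRegion ρ₀ k) :
    Φ z (-branch k z) = pauli3 * Φ z (branch k z) * pauli1 := by
  have hsol : IsLaxSolution ρ₀ f k Φ := hΦ.lax
  obtain ⟨D, hD⟩ := hsol.wronskian_sheets hf hre him hsol
  obtain ⟨M, hM⟩ := hsol.wronskian_sheets hf hre him hsol.pauli3_neg
  simp only [neg_neg] at hM
  have hax : ∀ t : ℝ, max k.re 0 < t → f (Complex.I * t) + conj (f (Complex.I * t)) ≠ 0 :=
    fun t ht => hf.add_conj_ne_zero
      (Or.inr (axis_mem_rotationAxis ((le_max_right _ _).trans_lt ht).ne'))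
  -- The constant is read off on the axis, where `Φ` is explicit. It gives the determinant of `Φ` on
  -- both sheets.
  have hD' : D = -F k • sympl := by
    set t := max k.re 0 + 1
    have ht : max k.re 0 < t := by simp [t]
    have h1 := axis_identity hf ht (fun z hz => (hD z hz).1) (hΦ.tendsto_axis ht).1
      (hΦ.tendsto_axis ht).1
    rw [hA t ((le_max_right _ _).trans_lt ht), sympl_two] at h1
    have h2 : (axisFrame f (Complex.I * t) * spectralMatrix F G k).det
        = (f (Complex.I * t) + conj (f (Complex.I * t))) * -F k := by
      rw [Matrix.det_mul]; simp [axisFrame, spectralMatrix, Matrix.det_fin_two]; ring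
    rw [h2, mul_smul] at h1
    exact (smul_right_injective _ (hax t ht) h1).symm
  -- On the lower sheet only the first column is normalised, and only at `i∞`, so this column of `M`
  -- is found as a limit along the axis.
  have hM0 : ∀ i, M i 0 = if i = 0 then -F k else 0 := by
    have h1 : ∀ t : ℝ, max k.re 0 < t → ∀ i,
        (((axisFrame f (Complex.I * t) * spectralMatrix F G k).transpose * sympl * pauli3).mulVec
          ((Φ (Complex.I * t) (-1)).col 0)) i
          = (f (Complex.I * t) + conj (f (Complex.I * t))) * M i 0 := by
      intro t ht i
      have h2 := axis_identity hf (Φ := fun z => Φ z (branch k z))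
        (Ψ := fun z => pauli3 * Φ z (-branch k z)) ht (fun z hz => (hM z hz).1)
        (hΦ.tendsto_axis ht).1
        (((by fun_prop : Continuous fun N : Matrix (Fin 2) (Fin 2) ℂ => pauli3 * N).tendsto _).comp
          (hΦ.tendsto_axis ht).2)
      rw [hA t ((le_max_right _ _).trans_lt ht)] at h2
      have h3 := congrFun (congrFun h2 i) 0
      rw [← Matrix.mul_assoc, Matrix.smul_apply, smul_eq_mul] at h3
      rw [← h3]
      rfl
    have hf1 := hf.tendsto_one_axis
    have hfc : Tendsto (fun t : ℝ => conj (f (Complex.I * t))) atTop (𝓝 1) := by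
      simpa only [map_one, Function.comp_def] using (Complex.continuous_conj.tendsto _).comp hf1
    have hP : Tendsto (fun t : ℝ => axisFrame f (Complex.I * t)) atTop
        (𝓝 !![1, 1; 1, -1]) := by
      refine tendsto_pi_nhds.2 fun i => tendsto_pi_nhds.2 fun j => ?_
      fin_cases i <;> fin_cases j
      · simpa [axisFrame] using hfc
      · simp [axisFrame]
      · simpa [axisFrame] using hf1
      · simp [axisFrame]
    intro i
    have hc : Continuous fun p : Matrix (Fin 2) (Fin 2) ℂ × (Fin 2 → ℂ) =>
        (((p.1 * spectralMatrix F G k).transpose * sympl * pauli3).mulVec p.2) i := by fun_prop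
    have h4 := (hc.tendsto (!![1, 1; 1, -1], ![1, 1])).comp (hP.prodMk_nhds hΦ.lower)
    have h5 := (hf1.add hfc).mul_const (M i 0)
    have h6 := tendsto_nhds_unique_of_eventuallyEq h4 h5 (by
      filter_upwards [eventually_gt_atTop (max k.re 0)] with t ht using h1 t ht i)
    fin_cases i
    · simp [spectralMatrix, sympl, pauli3, Matrix.mulVec, dotProduct, mul_entry] at h6
      simp only [Fin.zero_eta, if_true]
      linear_combination -h6 / 2
    · simp [spectralMatrix, sympl, pauli3, Matrix.mulVec, dotProduct, mul_entry] at h6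
      simpa using h6
  have hs := hf.add_conj_ne_zero (Or.inl (upperRegion_subset _ _ hz))
  obtain ⟨hM1, hM2⟩ := hM z hz
  obtain ⟨hD1, hD2⟩ := hD z hz
  rw [hD'] at hD1 hD2
  set s := f z + conj (f z)
  set X := Φ z (branch k z)
  set Y := Φ z (-branch k z)
  have hdX : X.det = s * -F k := by
    have := congrFun (congrFun hD1 0) 1
    rw [sympl_two] at this
    simpa [sympl] using this
  have hdY : Y.det = s * -F k := by
    have := congrFun (congrFun hD2 0) 1
    rw [sympl_two] at this
    simpa [sympl] using this
  -- Since `sympl * pauli3` is symmetric, transposition exchanges the relations on the two sheets.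
  -- As these share the constant `M`, it is symmetric.
  have hM01 : M 0 1 = 0 := by
    have e1 := congrFun (congrFun hM1 0) 1
    have e2 := congrFun (congrFun hM2 1) 0
    simp only [mul_entry] at e1 e2
    simp [sympl, pauli3] at e1 e2
    have e3 := hM0 1
    simp only [one_ne_zero, if_false] at e3
    rw [e3] at e2
    have : s * M 0 1 = 0 := by linear_combination -e1 + e2
    exact (mul_eq_zero.1 this).resolve_left hs
  -- The last entry comes from comparing determinants, and this requires `F k ≠ 0`.
  have hM11 : M 1 1 = F k := by
    have e1 := congrArg Matrix.det hM1
    rw [Matrix.det_mul, Matrix.det_mul, Matrix.det_mul, Matrix.det_transpose, hdX, hdY,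
      Matrix.det_smul, Matrix.det_fin_two M, hM01, hM0 0] at e1
    simp [sympl, pauli3, Matrix.det_fin_two] at e1
    have : s ^ 2 * F k * (M 1 1 - F k) = 0 := by linear_combination -e1
    have h0 : s ^ 2 * F k ≠ 0 := mul_ne_zero (pow_ne_zero _ hs) hF
    exact sub_eq_zero.1 ((mul_eq_zero.1 this).resolve_left h0)
  have hMeq : M = -F k • pauli3 := by
    ext i j
    fin_cases i <;> fin_cases j <;> simp [pauli3, hM01, hM11, hM0]
  have hunit : IsUnit (X.transpose * sympl * pauli3) := by
    rw [Matrix.isUnit_iff_isUnit_det, Matrix.det_mul, Matrix.det_mul, Matrix.det_transpose, hdX]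
    simp [sympl, pauli3, Matrix.det_fin_two, hs, hF]
  refine hunit.mul_right_injective ?_
  have e1 : X.transpose * sympl * pauli3 * Y = s • (-F k • pauli3) := by
    rw [Matrix.mul_assoc _ pauli3, hM1, hMeq]
  have e2 : pauli3 * pauli3 = 1 := by
    ext i j; fin_cases i <;> fin_cases j <;> simp [pauli3, mul_entry]
  have e3 : sympl * pauli1 = pauli3 := by
    ext i j; fin_cases i <;> fin_cases j <;> simp [pauli3, sympl, pauli1, mul_entry]
  calc X.transpose * sympl * pauli3 * Y = s • (-F k • pauli3) := e1
    _ = X.transpose * sympl * (pauli3 * pauli3) * X * pauli1 := by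
      rw [e2, Matrix.mul_one, hD1, Matrix.smul_mul, Matrix.smul_mul, e3]
    _ = _ := by simp only [Matrix.mul_assoc]

end Axis

end Ernst

/-! ### Caccioppoli inequality for the Ernst equation -/

namespace Ernst

open MeasureTheory

section Energy

variable {ρ₀ : ℝ} {f : ℂ → ℂ}

lemma contDiff_mk {n : WithTop ℕ∞} : ContDiff ℝ n fun p : ℝ × ℝ => (⟨p.1, p.2⟩ : ℂ) := by
  have : (fun p : ℝ × ℝ => (⟨p.1, p.2⟩ : ℂ)) = Complex.equivRealProdCLM.symm := by
    funext p; apply Complex.ext <;> simp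
  rw [this]
  exact Complex.equivRealProdCLM.symm.contDiff

lemma hasDerivAt_mk_left (x y : ℝ) : HasDerivAt (fun t : ℝ => (⟨t, y⟩ : ℂ)) 1 x := by
  have h : (fun t : ℝ => (⟨t, y⟩ : ℂ)) = fun t : ℝ => (t : ℂ) + (y : ℂ) * Complex.I := by
    funext t; apply Complex.ext <;> simp
  rw [h]
  exact (Complex.ofRealCLM.hasDerivAt (x := x)).add_const _

lemma hasDerivAt_mk_right (x y : ℝ) : HasDerivAt (fun t : ℝ => (⟨x, t⟩ : ℂ)) Complex.I y := by
  have h : (fun t : ℝ => (⟨x, t⟩ : ℂ)) = fun t : ℝ => (x : ℂ) + (t : ℂ) * Complex.I := by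
    funext t; apply Complex.ext <;> simp
  rw [h]
  have := ((Complex.ofRealCLM.hasDerivAt (x := y)).mul_const Complex.I).const_add (x : ℂ)
  simpa using this

lemma hasDerivAt_horizontal {g : ℂ → ℂ} {x y : ℝ} (hg : DifferentiableAt ℝ g ⟨x, y⟩) :
    HasDerivAt (fun t : ℝ => g ⟨t, y⟩) (dRho g ⟨x, y⟩) x :=
  HasFDerivAt.comp_hasDerivAt (f := fun t : ℝ => (⟨t, y⟩ : ℂ)) x hg.hasFDerivAt
    (hasDerivAt_mk_left x y)

lemma hasDerivAt_vertical {g : ℂ → ℂ} {x y : ℝ} (hg : DifferentiableAt ℝ g ⟨x, y⟩) :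
    HasDerivAt (fun t : ℝ => g ⟨x, t⟩) (dZeta g ⟨x, y⟩) y :=
  HasFDerivAt.comp_hasDerivAt (f := fun t : ℝ => (⟨x, t⟩ : ℂ)) y hg.hasFDerivAt
    (hasDerivAt_mk_right x y)

lemma IsErnstPotential.contDiffOn_dRho (hf : IsErnstPotential ρ₀ f) :
    ContDiffOn ℝ 1 (dRho f) (exteriorDomain ρ₀) :=
  (hf.contDiffOn.fderiv_of_isOpen (isOpen_exteriorDomain ρ₀) (by norm_num)).clm_apply
    contDiffOn_const

lemma IsErnstPotential.contDiffOn_dZeta (hf : IsErnstPotential ρ₀ f) :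
    ContDiffOn ℝ 1 (dZeta f) (exteriorDomain ρ₀) :=
  (hf.contDiffOn.fderiv_of_isOpen (isOpen_exteriorDomain ρ₀) (by norm_num)).clm_apply
    contDiffOn_const

/-- `|f_ρ|² + |f_ζ|²`. -/
noncomputable def gradSq (f : ℂ → ℂ) (z : ℂ) : ℝ := ‖dRho f z‖ ^ 2 + ‖dZeta f z‖ ^ 2

lemma gradSq_nonneg (f : ℂ → ℂ) (z : ℂ) : 0 ≤ gradSq f z := by unfold gradSq; positivity

lemma IsErnstPotential.continuousOn_gradSq (hf : IsErnstPotential ρ₀ f) :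
    ContinuousOn (gradSq f) (exteriorDomain ρ₀) :=
  (hf.contDiffOn_dRho.continuousOn.norm.pow 2).add (hf.contDiffOn_dZeta.continuousOn.norm.pow 2)

/-- Here `P, Q` stand for the norms of the partial derivatives of `f`, `η` for the cutoff, `X` for
the nonlinear term and `A, B` for the gradient of the cutoff. A quarter of the energy absorbs `X`;
another quarter absorbs the cutoff terms after completing squares. -/
lemma divergence_lower_bound {x η P Q X Y₁ Y₂ A B L ε : ℝ} (hx : 0 ≤ x) (hη : 0 ≤ η)
    (hL : 0 ≤ L)
    (hX : |X| ≤ (P ^ 2 + Q ^ 2) / 4) (h1 : |Y₁| ≤ ε * P) (h2 : |Y₂| ≤ ε * Q)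
    (hA : |A| ≤ L) (hB : |B| ≤ L) :
    x * η ^ 2 * (P ^ 2 + Q ^ 2) / 2 - 8 * x * ε ^ 2 * L ^ 2 ≤
      x * η ^ 2 * (P ^ 2 + Q ^ 2) + x * η ^ 2 * X + 2 * x * η * (A * Y₁ + B * Y₂) := by
  have b1 : |A * Y₁| ≤ L * (ε * P) := by rw [abs_mul]; gcongr
  have b2 : |B * Y₂| ≤ L * (ε * Q) := by rw [abs_mul]; gcongr
  have c1 := neg_le_of_abs_le b1
  have c2 := neg_le_of_abs_le b2
  have c3 := neg_le_of_abs_le hX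
  have key : η ^ 2 * (P ^ 2 + Q ^ 2) / 2 - 8 * ε ^ 2 * L ^ 2 ≤
      η ^ 2 * (P ^ 2 + Q ^ 2) + η ^ 2 * X + 2 * η * (A * Y₁ + B * Y₂) := by
    have d1 := mul_le_mul_of_nonneg_left c1 hη
    have d2 := mul_le_mul_of_nonneg_left c2 hη
    have d3 := mul_le_mul_of_nonneg_left c3 (sq_nonneg η)
    nlinarith [sq_nonneg (η * P / 2 - 2 * L * ε), sq_nonneg (η * Q / 2 - 2 * L * ε)]
  have := mul_le_mul_of_nonneg_left key hx
  linarith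

/-- Energy estimate on a rectangle for a solution of the Ernst equation which is close to `1`. -/
theorem IsErnstPotential.energy_estimate (hf : IsErnstPotential ρ₀ f) {a b c d L ε κ : ℝ}
    (ha : 0 < a) (hab : a ≤ b) (hcd : c ≤ d)
    (hD : ∀ x ∈ Set.Icc a b, ∀ y ∈ Set.Icc c d, (⟨x, y⟩ : ℂ) ∈ exteriorDomain ρ₀)
    {α β : ℝ → ℝ} (hα : ContDiff ℝ 1 α) (hβ : ContDiff ℝ 1 β)
    (hα0 : ∀ x ∈ Set.Icc a b, 0 ≤ α x ∧ α x ≤ 1 ∧ |deriv α x| ≤ L)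
    (hβ0 : ∀ y ∈ Set.Icc c d, 0 ≤ β y ∧ β y ≤ 1 ∧ |deriv β y| ≤ L)
    (hαb : α b = 0) (hβc : β c = 0) (hβd : β d = 0) (hε0 : 0 ≤ ε) (hε : ε ≤ 1 / 5)
    (hfε : ∀ x ∈ Set.Icc a b, ∀ y ∈ Set.Icc c d, ‖f ⟨x, y⟩ - 1‖ ≤ ε)
    (hκ : ∀ y ∈ Set.Icc c d, α a * ‖dRho f ⟨a, y⟩‖ ≤ κ) :
    ∫ p in Set.Icc a b ×ˢ Set.Icc c d, p.1 * (α p.1 * β p.2) ^ 2 * gradSq f ⟨p.1, p.2⟩ ≤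
      16 * ε ^ 2 * L ^ 2 * (b * (b - a) * (d - c)) + 2 * a * ε * κ * (d - c) := by
  have hL : 0 ≤ L := (abs_nonneg _).trans (hα0 a ⟨le_rfl, hab⟩).2.2
  set U : Set (ℝ × ℝ) := (fun p : ℝ × ℝ => (⟨p.1, p.2⟩ : ℂ)) ⁻¹' exteriorDomain ρ₀ with hU
  have hUo : IsOpen U := (isOpen_exteriorDomain ρ₀).preimage (contDiff_mk (n := 0)).continuous
  have hRU : Set.Icc (a, c) (b, d) ⊆ U := by
    rintro ⟨x, y⟩ ⟨⟨h1, h2⟩, h3, h4⟩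
    exact hD x ⟨h1, h3⟩ y ⟨h2, h4⟩
  have hmaps : Set.MapsTo (fun p : ℝ × ℝ => (⟨p.1, p.2⟩ : ℂ)) U (exteriorDomain ρ₀) :=
    fun p hp => hp
  have hg : ContDiffOn ℝ 1 (fun p : ℝ × ℝ => conj (f ⟨p.1, p.2⟩ - 1)) U :=
    Complex.conjCLE.contDiff.comp_contDiffOn
      (((hf.contDiffOn.of_le (by norm_num)).comp contDiff_mk.contDiffOn hmaps).sub contDiffOn_const)
  have hre : ∀ h : ℂ → ℂ, ContDiffOn ℝ 1 h (exteriorDomain ρ₀) →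
      ContDiffOn ℝ 1 (fun p : ℝ × ℝ => (conj (f ⟨p.1, p.2⟩ - 1) * h ⟨p.1, p.2⟩).re) U :=
    fun h hh => Complex.reCLM.contDiff.comp_contDiffOn
      (hg.mul (hh.comp contDiff_mk.contDiffOn hmaps))
  have hw : ContDiff ℝ 1 (fun p : ℝ × ℝ => p.1 * (α p.1 * β p.2) ^ 2) :=
    contDiff_fst.mul (((hα.comp contDiff_fst).mul (hβ.comp contDiff_snd)).pow 2)
  -- The vector field `ρ η² Re (conj (f - 1) ∇f)` with `η = α β`. The weight `ρ` is that of the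
  -- axisymmetric Laplacian, and the field vanishes on every side of the rectangle except `ρ = a`.
  set F₁ : ℝ × ℝ → ℝ := fun p => p.1 * (α p.1 * β p.2) ^ 2 *
    (conj (f ⟨p.1, p.2⟩ - 1) * dRho f ⟨p.1, p.2⟩).re with hF₁
  set F₂ : ℝ × ℝ → ℝ := fun p => p.1 * (α p.1 * β p.2) ^ 2 *
    (conj (f ⟨p.1, p.2⟩ - 1) * dZeta f ⟨p.1, p.2⟩).re with hF₂
  have hc₁ : ContDiffOn ℝ 1 F₁ U := hw.contDiffOn.mul (hre _ hf.contDiffOn_dRho)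
  have hc₂ : ContDiffOn ℝ 1 F₂ U := hw.contDiffOn.mul (hre _ hf.contDiffOn_dZeta)
  have hd₁ : ∀ p ∈ U, HasFDerivAt F₁ (fderiv ℝ F₁ p) p := fun p hp =>
    ((hc₁.contDiffAt (hUo.mem_nhds hp)).differentiableAt (by norm_num)).hasFDerivAt
  have hd₂ : ∀ p ∈ U, HasFDerivAt F₂ (fderiv ℝ F₂ p) p := fun p hp =>
    ((hc₂.contDiffAt (hUo.mem_nhds hp)).differentiableAt (by norm_num)).hasFDerivAt
  have hdiv_cont : ContinuousOn (fun p => fderiv ℝ F₁ p (1, 0) + fderiv ℝ F₂ p (0, 1)) U :=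
    ((hc₁.continuousOn_fderiv_of_isOpen hUo le_rfl).clm_apply continuousOn_const).add
      ((hc₂.continuousOn_fderiv_of_isOpen hUo le_rfl).clm_apply continuousOn_const)
  have hle : ((a, c) : ℝ × ℝ) ≤ (b, d) := ⟨hab, hcd⟩
  have hint := (hdiv_cont.mono hRU).integrableOn_compact (μ := volume) isCompact_Icc
  have hIoo : Set.Ioo a b ×ˢ Set.Ioo c d ⊆ U := fun p hp =>
    hD p.1 (Set.Ioo_subset_Icc_self hp.1) p.2 (Set.Ioo_subset_Icc_self hp.2)
  have hdivthm := integral_divergence_prod_Icc_of_hasFDerivAt_of_le F₁ F₂ (fderiv ℝ F₁)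
    (fderiv ℝ F₂) (a, c) (b, d) hle (hc₁.continuousOn.mono hRU) (hc₂.continuousOn.mono hRU)
    (fun p hp => hd₁ p (hIoo hp)) (fun p hp => hd₂ p (hIoo hp)) hint
  have hbd : ∫ y in c..d, F₁ (a, y) ≥ -(a * ε * κ * (d - c)) := by
    have h1 : ‖∫ y in c..d, F₁ (a, y)‖ ≤ a * ε * κ * |d - c| := by
      refine intervalIntegral.norm_integral_le_of_norm_le_const fun y hy => ?_
      rw [Set.uIoc_of_le hcd] at hy
      have hy' := Set.Ioc_subset_Icc_self hy
      have ha' : a ∈ Set.Icc a b := ⟨le_rfl, hab⟩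
      obtain ⟨p1, p2, -⟩ := hα0 a ha'
      obtain ⟨q1, q2, -⟩ := hβ0 y hy'
      have r1 : |(conj (f ⟨a, y⟩ - 1) * dRho f ⟨a, y⟩).re| ≤ ε * ‖dRho f ⟨a, y⟩‖ := by
        refine (Complex.abs_re_le_norm _).trans ?_
        rw [norm_mul, Complex.norm_conj]
        exact mul_le_mul_of_nonneg_right (hfε a ha' y hy') (norm_nonneg _)
      -- One factor `α a` is enough, as `κ` bounds `α a` times the radial derivative.
      have r2 : (α a * β y) ^ 2 ≤ α a := by
        have : α a * β y ≤ 1 := mul_le_one₀ p2 q1 q2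
        have h3 : α a * β y ≤ α a := mul_le_of_le_one_right p1 q2
        have h4 : 0 ≤ α a * β y := mul_nonneg p1 q1
        nlinarith
      rw [hF₁, Real.norm_eq_abs, abs_mul, abs_of_nonneg (mul_nonneg ha.le (sq_nonneg _))]
      calc a * (α a * β y) ^ 2 * |(conj (f ⟨a, y⟩ - 1) * dRho f ⟨a, y⟩).re|
          ≤ a * α a * (ε * ‖dRho f ⟨a, y⟩‖) := by gcongr
        _ = a * ε * (α a * ‖dRho f ⟨a, y⟩‖) := by ring
        _ ≤ a * ε * κ := mul_le_mul_of_nonneg_left (hκ y hy') (mul_nonneg ha.le hε0)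
    rw [abs_of_nonneg (by linarith : (0:ℝ) ≤ d - c)] at h1
    exact neg_le_of_abs_le h1
  have hz1 : ∀ x, F₂ (x, d) = 0 := fun x => by simp [hF₂, hβd]
  have hz2 : ∀ x, F₂ (x, c) = 0 := fun x => by simp [hF₂, hβc]
  have hz3 : ∀ y, F₁ (b, y) = 0 := fun y => by simp [hF₁, hαb]
  simp only [hz1, hz2, hz3, intervalIntegral.integral_zero, sub_zero, zero_add, zero_sub]
    at hdivthm
  rw [Set.Icc_prod_Icc]
  set E : ℝ × ℝ → ℝ := fun p => p.1 * (α p.1 * β p.2) ^ 2 * gradSq f ⟨p.1, p.2⟩ with hE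
  have hEc : ContinuousOn E U := hw.continuous.continuousOn.mul
    (hf.continuousOn_gradSq.comp (contDiff_mk (n := 0)).continuous.continuousOn hmaps)
  have hEi := (hEc.mono hRU).integrableOn_compact (μ := volume) isCompact_Icc
  have hci : IntegrableOn (fun _ : ℝ × ℝ => 8 * b * ε ^ 2 * L ^ 2) (Set.Icc (a, c) (b, d)) :=
    continuousOn_const.integrableOn_compact isCompact_Icc
  have hpt : ∀ p ∈ Set.Icc (a, c) (b, d), E p / 2 - 8 * b * ε ^ 2 * L ^ 2 ≤
      fderiv ℝ F₁ p (1, 0) + fderiv ℝ F₂ p (0, 1) := by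
    intro p hp
    have hpU := hRU hp
    obtain ⟨x, y⟩ := p
    obtain ⟨⟨hx1, hy1⟩, hx2, hy2⟩ := hp
    have hx : x ∈ Set.Icc a b := ⟨hx1, hx2⟩
    have hy : y ∈ Set.Icc c d := ⟨hy1, hy2⟩
    have hzD : (⟨x, y⟩ : ℂ) ∈ exteriorDomain ρ₀ := hD x hx y hy
    have hx0 : 0 < x := ha.trans_le hx1
    have hnb := (isOpen_exteriorDomain ρ₀).mem_nhds hzD
    have hfd := hf.differentiableAt hzD
    have hrd := (hf.contDiffOn_dRho.contDiffAt hnb).differentiableAt (by norm_num)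
    have hsd := (hf.contDiffOn_dZeta.contDiffAt hnb).differentiableAt (by norm_num)
    have e1 : fderiv ℝ F₁ (x, y) (1, 0) =
        (1 * (α x * β y) ^ 2 + x * (2 * (α x * β y) * (deriv α x * β y))) *
          (conj (f ⟨x, y⟩ - 1) * dRho f ⟨x, y⟩).re + x * (α x * β y) ^ 2 *
          (conj (dRho f ⟨x, y⟩) * dRho f ⟨x, y⟩
            + conj (f ⟨x, y⟩ - 1) * dRho (dRho f) ⟨x, y⟩).re := by
      have l1 : HasDerivAt (fun t : ℝ => F₁ (t, y)) (fderiv ℝ F₁ (x, y) (1, 0)) x :=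
        HasFDerivAt.comp_hasDerivAt (f := fun t : ℝ => (t, y)) x (hd₁ _ hpU)
          ((hasDerivAt_id x).prodMk (hasDerivAt_const x y))
      have m1 : HasDerivAt (fun t : ℝ => conj (f ⟨t, y⟩ - 1)) (conj (dRho f ⟨x, y⟩)) x :=
        Complex.conjCLE.hasFDerivAt.comp_hasDerivAt x ((hasDerivAt_horizontal hfd).sub_const 1)
      have m2 := Complex.reCLM.hasFDerivAt.comp_hasDerivAt x (m1.mul (hasDerivAt_horizontal hrd))
      have m3 : HasDerivAt (fun t : ℝ => t * (α t * β y) ^ 2)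
          (1 * (α x * β y) ^ 2 + x * (2 * (α x * β y) * (deriv α x * β y))) x := by
        have n1 := (((hα.differentiable (by norm_num)) x).hasDerivAt.mul_const (β y)).pow 2
        have n2 : HasDerivAt (fun t : ℝ => t * (α t * β y) ^ 2) _ x := (hasDerivAt_id x).mul n1
        simpa using n2
      exact l1.unique (m3.mul m2)
    have e2 : fderiv ℝ F₂ (x, y) (0, 1) =
        (x * (2 * (α x * β y) * (α x * deriv β y))) *
          (conj (f ⟨x, y⟩ - 1) * dZeta f ⟨x, y⟩).re + x * (α x * β y) ^ 2 *
          (conj (dZeta f ⟨x, y⟩) * dZeta f ⟨x, y⟩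
            + conj (f ⟨x, y⟩ - 1) * dZeta (dZeta f) ⟨x, y⟩).re := by
      have l1 : HasDerivAt (fun t : ℝ => F₂ (x, t)) (fderiv ℝ F₂ (x, y) (0, 1)) y :=
        HasFDerivAt.comp_hasDerivAt (f := fun t : ℝ => (x, t)) y (hd₂ _ hpU)
          ((hasDerivAt_const y x).prodMk (hasDerivAt_id y))
      have m1 : HasDerivAt (fun t : ℝ => conj (f ⟨x, t⟩ - 1)) (conj (dZeta f ⟨x, y⟩)) y :=
        Complex.conjCLE.hasFDerivAt.comp_hasDerivAt y ((hasDerivAt_vertical hfd).sub_const 1)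
      have m2 := Complex.reCLM.hasFDerivAt.comp_hasDerivAt y (m1.mul (hasDerivAt_vertical hsd))
      have m3 : HasDerivAt (fun t : ℝ => x * (α x * β t) ^ 2)
          (x * (2 * (α x * β y) * (α x * deriv β y))) y := by
        have n1 := (((hβ.differentiable (by norm_num)) y).hasDerivAt.const_mul (α x)).pow 2
        have n2 := n1.const_mul x
        simpa using n2
      exact l1.unique (m3.mul m2)
    set g := f ⟨x, y⟩ - 1 with hgdef
    have hgε : ‖g‖ ≤ ε := hfε x hx y hy
    set Δ : ℂ := dRho (dRho f) ⟨x, y⟩ + dZeta (dZeta f) ⟨x, y⟩ + 1 / (x : ℂ) * dRho f ⟨x, y⟩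
      with hΔ
    have hre1 : 1 - ε ≤ (f ⟨x, y⟩).re := by
      have h1 := (Complex.abs_re_le_norm g).trans hgε
      have h2 := neg_le_of_abs_le h1
      simp [hgdef] at h2
      linarith
    have hernst : ((f ⟨x, y⟩).re : ℂ) * Δ = dRho f ⟨x, y⟩ ^ 2 + dZeta f ⟨x, y⟩ ^ 2 := by
      have := hf.ernst _ hzD
      rw [Complex.add_conj] at this
      rw [← this, hΔ]
      push_cast
      ring
    have hΔn : ‖Δ‖ * (1 - ε) ≤ ‖dRho f ⟨x, y⟩‖ ^ 2 + ‖dZeta f ⟨x, y⟩‖ ^ 2 := by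
      have h1 := congrArg norm hernst
      rw [norm_mul, Complex.norm_real, Real.norm_of_nonneg (by linarith)] at h1
      calc ‖Δ‖ * (1 - ε) ≤ ‖Δ‖ * (f ⟨x, y⟩).re :=
            mul_le_mul_of_nonneg_left hre1 (norm_nonneg _)
        _ = ‖dRho f ⟨x, y⟩ ^ 2 + dZeta f ⟨x, y⟩ ^ 2‖ := by rw [mul_comm, h1]
        _ ≤ ‖dRho f ⟨x, y⟩ ^ 2‖ + ‖dZeta f ⟨x, y⟩ ^ 2‖ := norm_add_le _ _
        _ = _ := by rw [norm_pow, norm_pow]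
    -- The Ernst equation bounds the Laplacian quadratically by the gradient, and `ε / (1 - ε) ≤
    -- 1/4` holds for `ε ≤ 1/5`.
    have hX : |(conj g * Δ).re| ≤ (‖dRho f ⟨x, y⟩‖ ^ 2 + ‖dZeta f ⟨x, y⟩‖ ^ 2) / 4 := by
      have h1 := Complex.abs_re_le_norm (conj g * Δ)
      rw [norm_mul, Complex.norm_conj] at h1
      have h2 : ‖g‖ * ‖Δ‖ ≤ ε * ‖Δ‖ := mul_le_mul_of_nonneg_right hgε (norm_nonneg _)
      have h3 : 0 ≤ ‖Δ‖ := norm_nonneg _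
      nlinarith
    have hY : ∀ v : ℂ, |(conj g * v).re| ≤ ε * ‖v‖ := fun v => by
      refine (Complex.abs_re_le_norm _).trans ?_
      rw [norm_mul, Complex.norm_conj]
      exact mul_le_mul_of_nonneg_right hgε (norm_nonneg _)
    obtain ⟨p1, p2, p3⟩ := hα0 x hx
    obtain ⟨q1, q2, q3⟩ := hβ0 y hy
    have hA : |deriv α x * β y| ≤ L := by
      rw [abs_mul, abs_of_nonneg q1]
      exact (mul_le_of_le_one_right (abs_nonneg _) q2).trans p3
    have hB : |α x * deriv β y| ≤ L := by
      rw [abs_mul, abs_of_nonneg p1]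
      exact (mul_le_of_le_one_left (abs_nonneg _) p2).trans q3
    have key := divergence_lower_bound hx0.le (mul_nonneg p1 q1) hL hX (hY (dRho f ⟨x, y⟩)) (hY (dZeta f ⟨x, y⟩)) hA hB
    have hbx : 8 * x * ε ^ 2 * L ^ 2 ≤ 8 * b * ε ^ 2 * L ^ 2 := by gcongr
    have hN : ∀ v : ℂ, (conj v * v).re = ‖v‖ ^ 2 := fun v => by
      rw [mul_comm, Complex.mul_conj, Complex.ofReal_re, Complex.normSq_eq_norm_sq]
    have hΔre : x * (conj g * Δ).re = x * (conj g * dRho (dRho f) ⟨x, y⟩).re +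
        x * (conj g * dZeta (dZeta f) ⟨x, y⟩).re + (conj g * dRho f ⟨x, y⟩).re := by
      have h1 : (x : ℂ) * (conj g * Δ) = (x : ℂ) * (conj g * dRho (dRho f) ⟨x, y⟩) +
          (x : ℂ) * (conj g * dZeta (dZeta f) ⟨x, y⟩) + conj g * dRho f ⟨x, y⟩ := by
        have : (x : ℂ) ≠ 0 := by exact_mod_cast hx0.ne'
        rw [hΔ]; field_simp
      have h2 := congrArg Complex.re h1
      simpa only [Complex.re_ofReal_mul, Complex.add_re] using h2
    rw [e1, e2, Complex.add_re, Complex.add_re, hN, hN]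
    have hEe : E (x, y) = x * (α x * β y) ^ 2 * (‖dRho f ⟨x, y⟩‖ ^ 2 + ‖dZeta f ⟨x, y⟩‖ ^ 2) := rfl
    rw [hEe]
    have h5 : x * (α x * β y) ^ 2 * (conj g * Δ).re = (α x * β y) ^ 2 * (x * (conj g * Δ).re) := by
      ring
    rw [h5, hΔre] at key
    linarith
  have hmono : ∫ p in Set.Icc (a, c) (b, d), (E p / 2 - 8 * b * ε ^ 2 * L ^ 2) ≤ _ :=
    setIntegral_mono_on ((hEi.div_const 2).sub hci) hint measurableSet_Icc hpt
  rw [integral_sub (hEi.div_const 2) hci, integral_div, hdivthm, setIntegral_const] at hmono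
  have hvol : (volume : Measure (ℝ × ℝ)).real (Set.Icc (a, c) (b, d)) = (b - a) * (d - c) := by
    rw [← Set.Icc_prod_Icc, Measure.volume_eq_prod, measureReal_prod_prod, Real.volume_real_Icc_of_le hab,
      Real.volume_real_Icc_of_le hcd]
  rw [hvol, smul_eq_mul] at hmono
  linarith

end Energy

end Ernst

/-! ### Paths with small gradient -/

namespace Ernst

open MeasureTheory

/-- A slice on which the integral of a nonnegative function is at most average. -/
lemma exists_slice_le {H : ℝ × ℝ → ℝ} {a b c d a' b' c' d' K : ℝ}
    (hH : ContinuousOn H (Set.Icc a b ×ˢ Set.Icc c d))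
    (hH0 : ∀ p ∈ Set.Icc a b ×ˢ Set.Icc c d, 0 ≤ H p)
    (hK : ∫ p in Set.Icc a b ×ˢ Set.Icc c d, H p ≤ K)
    (ha : a ≤ a') (hab : a' < b') (hb : b' ≤ b) (hc : c ≤ c') (hd : d' ≤ d) :
    ∃ x ∈ Set.Icc a' b', (b' - a') * ∫ y in Set.Icc c' d', H (x, y) ≤ K := by
  have hsub : Set.Icc a' b' ×ˢ Set.Icc c' d' ⊆ Set.Icc a b ×ˢ Set.Icc c d :=
    Set.prod_mono (Set.Icc_subset_Icc ha hb) (Set.Icc_subset_Icc hc hd)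
  have hi : IntegrableOn H (Set.Icc a b ×ˢ Set.Icc c d) :=
    hH.integrableOn_compact (isCompact_Icc.prod isCompact_Icc)
  have hi' : IntegrableOn H (Set.Icc a' b' ×ˢ Set.Icc c' d') := hi.mono_set hsub
  have h1 : ∫ p in Set.Icc a' b' ×ˢ Set.Icc c' d', H p ≤ K := by
    refine (setIntegral_mono_set hi ?_ hsub.eventuallyLE).trans hK
    filter_upwards [ae_restrict_mem (measurableSet_Icc.prod measurableSet_Icc)] with p hp
    exact hH0 p hp
  rw [Measure.volume_eq_prod] at h1 hi'
  rw [setIntegral_prod _ hi'] at h1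
  have hφ : IntegrableOn (fun x => ∫ y in Set.Icc c' d', H (x, y)) (Set.Icc a' b') := by
    rw [IntegrableOn, ← Measure.prod_restrict] at hi'
    exact hi'.integral_prod_left
  have hvol : (volume : Measure ℝ) (Set.Icc a' b') ≠ 0 := by
    rw [Real.volume_Icc]; simpa using hab
  obtain ⟨x, hx, hle⟩ := exists_le_setAverage hvol (by rw [Real.volume_Icc]; simp) hφ
  refine ⟨x, hx, ?_⟩
  rw [setAverage_eq, Real.volume_real_Icc_of_le hab.le, smul_eq_mul] at hle
  have hpos : 0 < b' - a' := sub_pos.2 hab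
  have := mul_le_mul_of_nonneg_left hle hpos.le
  rw [← mul_assoc, mul_inv_cancel₀ hpos.ne', one_mul] at this
  exact this.trans h1

lemma exists_slice_le_swap {H : ℝ × ℝ → ℝ} {a b c d a' b' c' d' K : ℝ}
    (hH : ContinuousOn H (Set.Icc a b ×ˢ Set.Icc c d))
    (hH0 : ∀ p ∈ Set.Icc a b ×ˢ Set.Icc c d, 0 ≤ H p)
    (hK : ∫ p in Set.Icc a b ×ˢ Set.Icc c d, H p ≤ K)
    (ha : a ≤ a') (hb : b' ≤ b) (hc : c ≤ c') (hcd : c' < d') (hd : d' ≤ d) :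
    ∃ y ∈ Set.Icc c' d', (d' - c') * ∫ x in Set.Icc a' b', H (x, y) ≤ K := by
  have hmaps : Set.MapsTo Prod.swap (Set.Icc c d ×ˢ Set.Icc a b) (Set.Icc a b ×ˢ Set.Icc c d) :=
    fun p hp => ⟨hp.2, hp.1⟩
  refine exists_slice_le (H := fun p => H p.swap) (hH.comp continuous_swap.continuousOn hmaps)
    (fun p hp => hH0 _ (hmaps hp)) ?_ hc hcd hd ha hb
  rw [Measure.volume_eq_prod] at hK ⊢
  rw [setIntegral_prod_swap]
  exact hK

section Path

variable {ρ₀ : ℝ} {f : ℂ → ℂ}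

/-- `f` is within `ε` of `1` at distance at least `R / 2`, and its gradient is of size `ε` on the
vertical segment from `x` to `x + 2 i R` and on the horizontal one from `δ + i y` to
`2 R + i y`. -/
structure IsGoodPath (ρ₀ : ℝ) (f : ℂ → ℂ) (ε R δ x y : ℝ) : Prop where
  near_one : ∀ z ∈ exteriorDomain ρ₀, R / 2 ≤ ‖z‖ → ‖f z - 1‖ ≤ ε
  hx : x ∈ Set.Icc R (2 * R)
  hy : y ∈ Set.Icc R (2 * R)
  vertical : ∫ t in Set.Icc 0 (2 * R), gradSq f ⟨x, t⟩ ≤ 60000 * ε ^ 2 / R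
  horizontal : ∫ t in Set.Icc δ (2 * R), t * gradSq f ⟨t, y⟩ ≤ 60000 * ε ^ 2

/-- Properties near the axis which hold in the limit hold uniformly on compact parts of it. -/
lemma eventually_near_axis {P : ℂ → Prop} {c d : ℝ}
    (h : ∀ y ∈ Set.Icc c d, ∀ᶠ z in 𝓝 (Complex.I * (y : ℂ)), 0 < z.re → P z) :
    ∃ δ₀, 0 < δ₀ ∧ ∀ δ, 0 < δ → δ < δ₀ → ∀ y ∈ Set.Icc c d, P ⟨δ, y⟩ := by
  have h1 : ∀ᶠ x in 𝓝 (0 : ℝ), ∀ y ∈ Set.Icc c d, 0 < x → P ⟨x, y⟩ := by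
    refine isCompact_Icc.eventually_forall_of_forall_eventually
      (P := fun x y => 0 < x → P ⟨x, y⟩) fun y hy => ?_
    have hc : Tendsto (fun p : ℝ × ℝ => (⟨p.1, p.2⟩ : ℂ)) (𝓝 (0, y)) (𝓝 (Complex.I * y)) := by
      have := (contDiff_mk (n := 0)).continuous.tendsto ((0, y) : ℝ × ℝ)
      have e : (⟨((0, y) : ℝ × ℝ).1, ((0, y) : ℝ × ℝ).2⟩ : ℂ) = Complex.I * y := by
        apply Complex.ext <;> simp
      rwa [e] at this
    exact hc.eventually (h y hy)
  obtain ⟨δ₀, hδ₀, h2⟩ := Metric.eventually_nhds_iff.1 h1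
  refine ⟨δ₀, hδ₀, fun δ hδ hδ' y hy => h2 ?_ y hy hδ⟩
  simpa [abs_of_pos hδ] using hδ'

lemma norm_ge_of_re {x y r : ℝ} (h : r ≤ x) : r ≤ ‖(⟨x, y⟩ : ℂ)‖ :=
  h.trans ((le_abs_self _).trans (Complex.abs_re_le_norm ⟨x, y⟩))

lemma norm_ge_of_im {x y r : ℝ} (h : r ≤ y) : r ≤ ‖(⟨x, y⟩ : ℂ)‖ :=
  h.trans ((le_abs_self _).trans (Complex.abs_im_le_norm ⟨x, y⟩))

lemma hasDerivAt_bump (p q C t : ℝ) :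
    HasDerivAt (fun t : ℝ => (t - p) * (q - t) / C) ((p + q - 2 * t) / C) t := by
  have h := (((hasDerivAt_id t).sub_const p).mul ((hasDerivAt_id t).const_sub q)).div_const C
  convert! h using 1
  simp; ring

lemma contDiff_bump (p q C : ℝ) : ContDiff ℝ 1 (fun t : ℝ => (t - p) * (q - t) / C) := by
  fun_prop

lemma IsErnstPotential.continuousOn_weighted (hf : IsErnstPotential ρ₀ f) {a b c d : ℝ}
    (hD : ∀ x ∈ Set.Icc a b, ∀ y ∈ Set.Icc c d, (⟨x, y⟩ : ℂ) ∈ exteriorDomain ρ₀) {α β : ℝ → ℝ}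
    (hα : ContDiff ℝ 1 α) (hβ : ContDiff ℝ 1 β) :
    ContinuousOn (fun p : ℝ × ℝ => p.1 * (α p.1 * β p.2) ^ 2 * gradSq f ⟨p.1, p.2⟩)
      (Set.Icc a b ×ˢ Set.Icc c d) := by
  have h1 : Continuous fun p : ℝ × ℝ => p.1 * (α p.1 * β p.2) ^ 2 :=
    continuous_fst.mul (((hα.continuous.comp continuous_fst).mul
      (hβ.continuous.comp continuous_snd)).pow 2)
  exact h1.continuousOn.mul (hf.continuousOn_gradSq.comp
    (contDiff_mk (n := 0)).continuous.continuousOn fun p hp => hD _ hp.1 _ hp.2)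

/-- The rectangle lies to the right of the disk and the cutoff vanishes on its whole boundary, so `κ
= 0`. Both bumps are at least `1/2` where the slice is chosen, whence the factor `R / 16`. The
constant `60000` is a round bound covering `16 * 1920` here and `36 * 1445` in `exists_horizontal`.
-/
lemma IsErnstPotential.exists_vertical (hf : IsErnstPotential ρ₀ f) {ε R : ℝ} (hR : 0 < R)
    (hRρ : 2 * |ρ₀| < R) (hε0 : 0 ≤ ε) (hε : ε ≤ 1 / 5)
    (hn : ∀ z ∈ exteriorDomain ρ₀, R / 2 ≤ ‖z‖ → ‖f z - 1‖ ≤ ε) :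
    ∃ x ∈ Set.Icc R (2 * R),
      ∫ t in Set.Icc 0 (2 * R), gradSq f ⟨x, t⟩ ≤ 60000 * ε ^ 2 / R := by
  have hD : ∀ x ∈ Set.Icc (R / 2) (3 * R), ∀ y ∈ Set.Icc (-R) (3 * R),
      (⟨x, y⟩ : ℂ) ∈ exteriorDomain ρ₀ := fun x hx y _ => by
    have h1 := hx.1
    refine ⟨by show 0 < x; linarith, fun h => ?_⟩
    have h2 : x ≤ ρ₀ := h.2
    have := le_abs_self ρ₀
    linarith
  set α : ℝ → ℝ := fun t => (t - R / 2) * (3 * R - t) / (2 * R ^ 2) with hα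
  set β : ℝ → ℝ := fun t => (t - -R) * (3 * R - t) / (4 * R ^ 2) with hβ
  have hα1 : ContDiff ℝ 1 α := contDiff_bump _ _ _
  have hβ1 : ContDiff ℝ 1 β := contDiff_bump _ _ _
  have hE := hf.energy_estimate (a := R / 2) (b := 3 * R) (c := -R) (d := 3 * R) (L := 2 / R)
    (ε := ε) (κ := 0) (by linarith) (by linarith) (by linarith) hD hα1 hβ1
    (fun x hx => by
      obtain ⟨h1, h2⟩ := hx
      refine ⟨?_, ?_, ?_⟩
      · exact div_nonneg (mul_nonneg (by linarith) (by linarith)) (by positivity)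
      · rw [hα, div_le_one (by positivity)]
        nlinarith [sq_nonneg (x - 7 / 4 * R)]
      · rw [(hasDerivAt_bump _ _ _ x).deriv, abs_div, abs_of_pos (by positivity : 0 < 2 * R ^ 2),
          div_le_div_iff₀ (by positivity) hR]
        have : |R / 2 + 3 * R - 2 * x| ≤ 4 * R := abs_le.2 ⟨by linarith, by linarith⟩
        nlinarith)
    (fun x hx => by
      obtain ⟨h1, h2⟩ := hx
      refine ⟨?_, ?_, ?_⟩
      · exact div_nonneg (mul_nonneg (by linarith) (by linarith)) (by positivity)
      · rw [hβ, div_le_one (by positivity)]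
        nlinarith [sq_nonneg (x - R)]
      · rw [(hasDerivAt_bump _ _ _ x).deriv, abs_div, abs_of_pos (by positivity : 0 < 4 * R ^ 2),
          div_le_div_iff₀ (by positivity) hR]
        have : |-R + 3 * R - 2 * x| ≤ 8 * R := abs_le.2 ⟨by linarith, by linarith⟩
        nlinarith)
    (by simp [hα]) (by simp [hβ]) (by simp [hβ]) hε0 hε
    (fun x hx y hy => hn _ (hD x hx y hy) (norm_ge_of_re hx.1))
    (fun y _ => by simp [hα])
  have hEb : 16 * ε ^ 2 * (2 / R) ^ 2 * (3 * R * (3 * R - R / 2) * (3 * R - -R)) +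
      2 * (R / 2) * ε * 0 * (3 * R - -R) = 1920 * ε ^ 2 * R := by
    field_simp; ring
  rw [hEb] at hE
  obtain ⟨x, hx, hle⟩ := exists_slice_le (a' := R) (b' := 2 * R) (c' := 0) (d' := 2 * R)
    (hf.continuousOn_weighted hD hα1 hβ1)
    (fun p hp => mul_nonneg (mul_nonneg (by have := hp.1.1; linarith) (sq_nonneg _))
      (gradSq_nonneg _ _)) hE (by linarith) (by linarith) (by linarith) (by linarith) (by linarith)
  refine ⟨x, hx, ?_⟩
  have hx' : x ∈ Set.Icc (R / 2) (3 * R) := ⟨by linarith [hx.1], by linarith [hx.2]⟩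
  have hcg : ContinuousOn (fun t : ℝ => gradSq f ⟨x, t⟩) (Set.Icc 0 (2 * R)) :=
    hf.continuousOn_gradSq.comp
      (fun t _ => (hasDerivAt_mk_right x t).continuousAt.continuousWithinAt)
      (fun t ht => hD x hx' t ⟨by linarith [ht.1], by linarith [ht.2]⟩)
  have hcw : ContinuousOn (fun t : ℝ => x * (α x * β t) ^ 2 * gradSq f ⟨x, t⟩)
      (Set.Icc 0 (2 * R)) :=
    (Continuous.continuousOn (by
      have := hβ1.continuous
      fun_prop)).mul hcg
  have hmono : ∫ t in Set.Icc 0 (2 * R), R / 16 * gradSq f ⟨x, t⟩ ≤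
      ∫ t in Set.Icc 0 (2 * R), x * (α x * β t) ^ 2 * gradSq f ⟨x, t⟩ := by
    refine setIntegral_mono_on ((hcg.integrableOn_compact isCompact_Icc).const_mul _)
      (hcw.integrableOn_compact isCompact_Icc) measurableSet_Icc fun t ht => ?_
    refine mul_le_mul_of_nonneg_right ?_ (gradSq_nonneg _ _)
    have h1 : 1 / 2 ≤ α x := by
      rw [hα, div_le_div_iff₀ (by norm_num) (by positivity)]
      nlinarith [mul_nonneg (sub_nonneg.2 hx.1) (sub_nonneg.2 hx.2)]
    have h2 : 1 / 2 ≤ β t := by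
      rw [hβ, div_le_div_iff₀ (by norm_num) (by positivity)]
      nlinarith [mul_nonneg (sub_nonneg.2 ht.1) (sub_nonneg.2 ht.2)]
    have h3 : 1 / 4 ≤ α x * β t := by nlinarith
    have h4 : 1 / 16 ≤ (α x * β t) ^ 2 := by nlinarith
    have := hx.1
    nlinarith
  rw [integral_const_mul] at hmono
  have h5 : (2 * R - R) * ∫ t in Set.Icc 0 (2 * R), R / 16 * gradSq f ⟨x, t⟩ ≤
      1920 * ε ^ 2 * R := by
    refine le_trans ?_ hle
    rw [integral_const_mul]
    exact mul_le_mul_of_nonneg_left hmono (by linarith)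
  rw [integral_const_mul] at h5
  rw [le_div_iff₀ hR]
  have h6 : R * (R * ∫ t in Set.Icc 0 (2 * R), gradSq f ⟨x, t⟩) ≤ R * (16 * 1920 * ε ^ 2) := by
    linarith
  have h7 := le_of_mul_le_mul_left h6 hR
  nlinarith [sq_nonneg ε]

/-- The rectangle reaches down to `ρ = δ`, where the cutoff `α` does not vanish. The boundary term
there is `O(δ ε R)` because the radial derivative is bounded, and `δ ≤ ε` makes it `O(ε² R)`, like
the main term. -/
lemma IsErnstPotential.exists_horizontal (hf : IsErnstPotential ρ₀ f) {ε R δ : ℝ} (hR : 0 < R)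
    (hε0 : 0 ≤ ε) (hε : ε ≤ 1 / 5) (hδ : 0 < δ) (hδε : δ ≤ ε) (hδR : δ ≤ R)
    (hn : ∀ z ∈ exteriorDomain ρ₀, R / 2 ≤ ‖z‖ → ‖f z - 1‖ ≤ ε)
    (hκ : ∀ y ∈ Set.Icc (R / 2) (3 * R), ‖dRho f ⟨δ, y⟩‖ ≤ 1) :
    ∃ y ∈ Set.Icc R (2 * R),
      ∫ t in Set.Icc δ (2 * R), t * gradSq f ⟨t, y⟩ ≤ 60000 * ε ^ 2 := by
  have hD : ∀ x ∈ Set.Icc δ (3 * R), ∀ y ∈ Set.Icc (R / 2) (3 * R),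
      (⟨x, y⟩ : ℂ) ∈ exteriorDomain ρ₀ := fun x hx y hy => by
    have h1 := hx.1
    have h2 := hy.1
    refine ⟨by show 0 < x; linarith, fun h => ?_⟩
    have h3 : y = 0 := h.1
    linarith
  set α : ℝ → ℝ := fun t => (3 * R - t) / (3 * R) with hα
  set β : ℝ → ℝ := fun t => (t - R / 2) * (3 * R - t) / (2 * R ^ 2) with hβ
  have hα1 : ContDiff ℝ 1 α := by rw [hα]; fun_prop
  have hβ1 : ContDiff ℝ 1 β := contDiff_bump _ _ _
  have hαd : ∀ t, deriv α t = -1 / (3 * R) := fun t =>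
    (((hasDerivAt_id t).const_sub (3 * R)).div_const (3 * R)).deriv
  have hE := hf.energy_estimate (a := δ) (b := 3 * R) (c := R / 2) (d := 3 * R) (L := 2 / R)
    (ε := ε) (κ := 1) hδ (by linarith) (by linarith) hD hα1 hβ1
    (fun x hx => by
      obtain ⟨h1, h2⟩ := hx
      refine ⟨?_, ?_, ?_⟩
      · exact div_nonneg (by linarith) (by positivity)
      · rw [hα, div_le_one (by positivity)]
        linarith
      · rw [hαd, abs_div, abs_of_pos (by positivity : 0 < 3 * R), abs_neg, abs_one,
          div_le_div_iff₀ (by positivity) hR]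
        linarith)
    (fun x hx => by
      obtain ⟨h1, h2⟩ := hx
      refine ⟨?_, ?_, ?_⟩
      · exact div_nonneg (mul_nonneg (by linarith) (by linarith)) (by positivity)
      · rw [hβ, div_le_one (by positivity)]
        nlinarith [sq_nonneg (x - 7 / 4 * R)]
      · rw [(hasDerivAt_bump _ _ _ x).deriv, abs_div, abs_of_pos (by positivity : 0 < 2 * R ^ 2),
          div_le_div_iff₀ (by positivity) hR]
        have : |R / 2 + 3 * R - 2 * x| ≤ 4 * R := abs_le.2 ⟨by linarith, by linarith⟩
        nlinarith)
    (by simp [hα]) (by simp [hβ]) (by simp [hβ]) hε0 hε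
    (fun x hx y hy => hn _ (hD x hx y hy) (norm_ge_of_im hy.1))
    (fun y hy => by
      have h1 : α δ ≤ 1 := by
        rw [hα, div_le_one (by positivity)]; linarith
      exact mul_le_one₀ h1 (norm_nonneg _) (hκ y hy))
  have hEb : 16 * ε ^ 2 * (2 / R) ^ 2 * (3 * R * (3 * R - δ) * (3 * R - R / 2)) +
      2 * δ * ε * 1 * (3 * R - R / 2) ≤ 1445 * ε ^ 2 * R := by
    have e1 : 16 * ε ^ 2 * (2 / R) ^ 2 * (3 * R * (3 * R - δ) * (3 * R - R / 2)) =
        480 * ε ^ 2 * (3 * R - δ) := by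
      field_simp; ring
    rw [e1]
    have h1 : δ * ε ≤ ε * ε := mul_le_mul_of_nonneg_right hδε hε0
    have h2 := mul_le_mul_of_nonneg_right h1 hR.le
    have h3 : 0 ≤ ε ^ 2 * δ := by positivity
    nlinarith
  obtain ⟨y, hy, hle⟩ := exists_slice_le_swap (a' := δ) (b' := 2 * R) (c' := R) (d' := 2 * R)
    (hf.continuousOn_weighted hD hα1 hβ1)
    (fun p hp => mul_nonneg (mul_nonneg (by have := hp.1.1; linarith) (sq_nonneg _))
      (gradSq_nonneg _ _)) (hE.trans hEb) (by linarith) (by linarith) (by linarith) (by linarith)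
    (by linarith)
  refine ⟨y, hy, ?_⟩
  have hy' : y ∈ Set.Icc (R / 2) (3 * R) := ⟨by linarith [hy.1], by linarith [hy.2]⟩
  have hcg : ContinuousOn (fun t : ℝ => gradSq f ⟨t, y⟩) (Set.Icc δ (2 * R)) :=
    hf.continuousOn_gradSq.comp
      (fun t _ => (hasDerivAt_mk_left t y).continuousAt.continuousWithinAt)
      (fun t ht => hD t ⟨ht.1, by linarith [ht.2]⟩ y hy')
  have hcw : ContinuousOn (fun t : ℝ => t * (α t * β y) ^ 2 * gradSq f ⟨t, y⟩)
      (Set.Icc δ (2 * R)) :=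
    (Continuous.continuousOn (by
      have := hα1.continuous
      fun_prop)).mul hcg
  have hcl : ContinuousOn (fun t : ℝ => t * gradSq f ⟨t, y⟩) (Set.Icc δ (2 * R)) :=
    continuousOn_id.mul hcg
  have hmono : ∫ t in Set.Icc δ (2 * R), 1 / 36 * (t * gradSq f ⟨t, y⟩) ≤
      ∫ t in Set.Icc δ (2 * R), t * (α t * β y) ^ 2 * gradSq f ⟨t, y⟩ := by
    refine setIntegral_mono_on ((hcl.integrableOn_compact isCompact_Icc).const_mul _)
      (hcw.integrableOn_compact isCompact_Icc) measurableSet_Icc fun t ht => ?_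
    rw [← mul_assoc]
    refine mul_le_mul_of_nonneg_right ?_ (gradSq_nonneg _ _)
    have h1 : 1 / 3 ≤ α t := by
      rw [hα, div_le_div_iff₀ (by norm_num) (by positivity)]
      linarith [ht.2]
    have h2 : 1 / 2 ≤ β y := by
      rw [hβ, div_le_div_iff₀ (by norm_num) (by positivity)]
      nlinarith [mul_nonneg (sub_nonneg.2 hy.1) (sub_nonneg.2 hy.2)]
    have h3 : 1 / 6 ≤ α t * β y := by nlinarith
    have h4 : 1 / 36 ≤ (α t * β y) ^ 2 := by nlinarith
    have := ht.1
    nlinarith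
  rw [integral_const_mul] at hmono
  have h5 := mul_le_mul_of_nonneg_left hmono hR.le
  have h6 : R * ∫ t in Set.Icc δ (2 * R), t * gradSq f ⟨t, y⟩ ≤ R * (36 * 1445 * ε ^ 2) := by
    have e : 2 * R - R = R := by ring
    rw [e] at hle
    linarith
  have h7 := le_of_mul_le_mul_left h6 hR
  nlinarith [sq_nonneg ε]

/-- Good paths exist arbitrarily far out. -/
theorem IsErnstPotential.exists_goodPath (hf : IsErnstPotential ρ₀ f) {ε : ℝ} (hε0 : 0 < ε)
    (hε : ε ≤ 1 / 5) (R₀ : ℝ) :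
    ∃ R, R₀ ≤ R ∧ 0 < R ∧ ∃ x δ₀, 0 < δ₀ ∧ ∀ δ, 0 < δ → δ < δ₀ → ∃ y, IsGoodPath ρ₀ f ε R δ x y := by
  obtain ⟨R₁, hR₁, hn⟩ := hf.norm_sub_one_le hε0
  set R := max R₀ 0 + 2 * R₁ + 2 * |ρ₀| + 1 with hRdef
  have m1 := le_max_left R₀ 0
  have m2 := le_max_right R₀ 0
  have m3 := abs_nonneg ρ₀
  have hR : 0 < R := by linarith
  have hn' : ∀ z ∈ exteriorDomain ρ₀, R / 2 ≤ ‖z‖ → ‖f z - 1‖ ≤ ε := fun z hz h =>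
    hn z hz (by linarith)
  obtain ⟨x, hx, hv⟩ := hf.exists_vertical hR (by linarith) hε0.le hε hn'
  -- The regularity `f_ρ(+0, ζ) = 0`, uniform on a compact part of the axis, controls the inner
  -- boundary term. The abscissa `x` is fixed before `δ`; only `y` depends on `δ`.
  obtain ⟨δ₁, hδ₁, hδ₁'⟩ := eventually_near_axis (P := fun z => ‖dRho f z‖ ≤ 1) (c := R / 2)
    (d := 3 * R) fun y hy => by
      have hy0 : 0 < y := by linarith [hy.1]
      have h := (hf.dRho_axis _ (axis_mem_rotationAxis hy0.ne')).norm
      rw [norm_zero] at h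
      have h1 := eventually_nhdsWithin_iff.1 (h.eventually_le_const one_pos)
      have h2 : ∀ᶠ z : ℂ in 𝓝 (Complex.I * y), 0 < z.im :=
        (Complex.continuous_im.tendsto _).eventually_const_lt (by simpa using hy0)
      filter_upwards [h1, h2] with z hz hz' hz0
      exact hz ⟨hz0, fun h => hz'.ne' h.1⟩
  refine ⟨R, by linarith, hR, x, min δ₁ (min ε R), by positivity, fun δ hδ hδ' => ?_⟩
  have d1 := hδ'.trans_le (min_le_left _ _)
  have d2 := hδ'.trans_le ((min_le_right _ _).trans (min_le_left _ _))
  have d3 := hδ'.trans_le ((min_le_right _ _).trans (min_le_right _ _))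
  obtain ⟨y, hy, hh⟩ := hf.exists_horizontal hR hε0.le hε hδ d2.le d3.le hn' (hδ₁' δ hδ d1)
  exact ⟨y, hn', hx, hy, hv, hh⟩

end Path

end Ernst

/-! ### Grönwall estimate and the transport equations -/

namespace Ernst

open MeasureTheory

/-- Variation of a solution of a linear differential inequality with small integrated
coefficient. -/
theorem norm_sub_le_of_norm_deriv_le_mul {E : Type*} [NormedAddCommGroup E] [NormedSpace ℝ E]
    {y y' : ℝ → E} {c : ℝ → ℝ} {a b C : ℝ} (hab : a ≤ b) (hc : ContinuousOn c (Set.Icc a b))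
    (hc0 : ∀ t ∈ Set.Icc a b, 0 ≤ c t) (hy : ∀ t ∈ Set.Icc a b, HasDerivAt y (y' t) t)
    (hb : ∀ t ∈ Set.Icc a b, ‖y' t‖ ≤ c t * ‖y t‖) (hC : ∫ t in Set.Icc a b, c t ≤ C)
    (hC1 : C ≤ 1) : ‖y b - y a‖ ≤ 2 * C * ‖y a‖ := by
  -- A continuous extension to the line makes the primitive differentiable everywhere, endpoints
  -- included.
  set e : ℝ → ℝ := Set.IccExtend hab ((Set.Icc a b).domRestrict c) with he
  have hec : Continuous e := Continuous.Icc_extend' (continuousOn_iff_continuous_domRestrict.1 hc)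
  have hee : ∀ t ∈ Set.Icc a b, e t = c t := fun t ht => by
    rw [he, Set.IccExtend_of_mem hab _ ht]; rfl
  set S : ℝ → ℝ := fun x => ∫ t in a..x, e t with hS
  have hSd : ∀ x, HasDerivAt S (e x) x := fun x => (hec.integral_hasStrictDerivAt a x).hasDerivAt
  have hSb : S b = ∫ t in Set.Icc a b, c t := by
    rw [hS]
    simp only
    rw [intervalIntegral.integral_of_le hab, ← integral_Icc_eq_integral_Ioc]
    exact setIntegral_congr_fun measurableSet_Icc hee
  have hS0 : 0 ≤ S b := by
    rw [hSb]; exact setIntegral_nonneg measurableSet_Icc hc0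
  have hSa : S a = 0 := intervalIntegral.integral_same
  -- The `η` supplies the strict inequality needed by the comparison principle; it tends to `0`
  -- afterwards.
  have key : ∀ η : ℝ, 0 < η →
      ‖y b - y a‖ ≤ (‖y a‖ + η) * Real.exp (S b + η * (b - a)) - ‖y a‖ := by
    intro η hη
    set B : ℝ → ℝ := fun x => (‖y a‖ + η) * Real.exp (S x + η * (x - a)) - ‖y a‖ with hB
    refine image_norm_le_of_norm_deriv_right_lt_deriv_boundary (f := fun t => y t - y a) (f' := y')
      (B := B) (B' := fun x => (‖y a‖ + η) * (Real.exp (S x + η * (x - a)) * (e x + η)))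
      (a := a) (b := b)
      (fun t ht => ((hy t ht).sub_const (y a)).continuousAt.continuousWithinAt)
      (fun t ht => ((hy t (Set.Ico_subset_Icc_self ht)).sub_const (y a)).hasDerivWithinAt)
      ?_ ?_ ?_ ⟨hab, le_rfl⟩
    · simp [hB, hSa, hη.le]
    · intro x
      have h1 : HasDerivAt (fun x => S x + η * (x - a)) (e x + η) x := by
        have : HasDerivAt (fun x => S x + η * (x - a)) (e x + η * 1) x :=
          (hSd x).add (((hasDerivAt_id x).sub_const a).const_mul η)
        simpa using this
      exact (h1.exp.const_mul (‖y a‖ + η)).sub_const ‖y a‖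
    · intro x hx hxB
      have hx' := Set.Ico_subset_Icc_self hx
      have h1 := hb x hx'
      have h2 : ‖y x‖ ≤ B x + ‖y a‖ := by
        rw [← hxB]
        have := norm_add_le (y x - y a) (y a)
        simpa using this
      have h3 : B x + ‖y a‖ = (‖y a‖ + η) * Real.exp (S x + η * (x - a)) := by simp [hB]
      have h4 : 0 < B x + ‖y a‖ := by rw [h3]; positivity
      have h5 : c x * ‖y x‖ ≤ c x * (B x + ‖y a‖) := mul_le_mul_of_nonneg_left h2 (hc0 x hx')
      have h6 : 0 < η * (B x + ‖y a‖) := mul_pos hη h4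
      rw [hee x hx', ← mul_assoc, ← h3]
      linarith
  have hlim : Tendsto (fun η : ℝ => (‖y a‖ + η) * Real.exp (S b + η * (b - a)) - ‖y a‖) (𝓝[>] 0)
      (𝓝 ((‖y a‖ + 0) * Real.exp (S b + 0 * (b - a)) - ‖y a‖)) :=
    ((by fun_prop : Continuous fun η : ℝ =>
      (‖y a‖ + η) * Real.exp (S b + η * (b - a)) - ‖y a‖).tendsto 0).mono_left nhdsWithin_le_nhds
  have h1 : ‖y b - y a‖ ≤ (‖y a‖ + 0) * Real.exp (S b + 0 * (b - a)) - ‖y a‖ := by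
    refine ge_of_tendsto hlim ?_
    filter_upwards [self_mem_nhdsWithin] with η hη using key η hη
  rw [add_zero, zero_mul, add_zero] at h1
  have hSC : S b ≤ C := hSb ▸ hC
  have h2 := Real.abs_exp_sub_one_le (x := S b) (by rw [abs_of_nonneg hS0]; linarith)
  rw [abs_of_nonneg hS0] at h2
  have h3 := (le_abs_self _).trans h2
  have h4 := mul_le_mul_of_nonneg_left (h3.trans (by linarith : 2 * S b ≤ 2 * C))
    (norm_nonneg (y a))
  linarith

section Transport

variable {ρ₀ : ℝ} {f : ℂ → ℂ} {k : ℂ} {Φ : ℂ → ℂ → Matrix (Fin 2) (Fin 2) ℂ}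

/-- `|f_ρ| + |f_ζ|`. -/
noncomputable def gradNorm (f : ℂ → ℂ) (z : ℂ) : ℝ := ‖dRho f z‖ + ‖dZeta f z‖

lemma gradNorm_nonneg (f : ℂ → ℂ) (z : ℂ) : 0 ≤ gradNorm f z := by unfold gradNorm; positivity

lemma gradNorm_sq_le (f : ℂ → ℂ) (z : ℂ) : gradNorm f z ^ 2 ≤ 2 * gradSq f z := by
  unfold gradNorm gradSq
  nlinarith [sq_nonneg (‖dRho f z‖ - ‖dZeta f z‖)]

lemma IsErnstPotential.continuousOn_gradNorm (hf : IsErnstPotential ρ₀ f) :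
    ContinuousOn (gradNorm f) (exteriorDomain ρ₀) :=
  hf.contDiffOn_dRho.continuousOn.norm.add hf.contDiffOn_dZeta.continuousOn.norm

lemma norm_dz_le (g : ℂ → ℂ) (z : ℂ) : ‖dz g z‖ ≤ gradNorm g z / 2 := by
  unfold dz gradNorm
  rw [norm_div, Complex.norm_ofNat]
  have := norm_sub_le (dRho g z) (Complex.I * dZeta g z)
  rw [norm_mul, Complex.norm_I, one_mul] at this
  linarith

lemma norm_dzbar_le (g : ℂ → ℂ) (z : ℂ) : ‖dzbar g z‖ ≤ gradNorm g z / 2 := by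
  unfold dzbar gradNorm
  rw [norm_div, Complex.norm_ofNat]
  have := norm_add_le (dRho g z) (Complex.I * dZeta g z)
  rw [norm_mul, Complex.norm_I, one_mul] at this
  linarith

lemma one_le_norm_add_conj {w : ℂ} (h : ‖w - 1‖ ≤ 1 / 5) : 1 ≤ ‖w + conj w‖ := by
  have h1 := (Complex.abs_re_le_norm (w - 1)).trans h
  have h2 := neg_le_of_abs_le h1
  rw [Complex.sub_re, Complex.one_re] at h2
  rw [Complex.add_conj, Complex.norm_real, Real.norm_eq_abs]
  exact le_trans (by linarith) (le_abs_self _)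

lemma IsErnstPotential.norm_lax_le (hf : IsErnstPotential ρ₀ f) {z : ℂ}
    (hz : z ∈ exteriorDomain ρ₀) (h : ‖f z - 1‖ ≤ 1 / 5) :
    ‖laxA f z‖ ≤ gradNorm f z / 2 ∧ ‖laxB f z‖ ≤ gradNorm f z / 2 := by
  have hs := one_le_norm_add_conj h
  constructor
  · rw [laxA, norm_div]
    exact (div_le_self (norm_nonneg _) hs).trans (norm_dz_le f z)
  · rw [laxB, norm_div, dz_conj (hf.differentiableAt hz), Complex.norm_conj]
    exact (div_le_self (norm_nonneg _) hs).trans (norm_dzbar_le f z)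

lemma IsErnstPotential.dz_eq (hf : IsErnstPotential ρ₀ f) {z : ℂ} (hz : z ∈ exteriorDomain ρ₀) :
    dz f z = (f z + conj (f z)) * laxA f z ∧
      dzbar f z = (f z + conj (f z)) * conj (laxB f z) := by
  have hs := hf.add_conj_ne_zero (Or.inl hz)
  constructor
  · rw [laxA]; field_simp
  · rw [laxB, dz_conj (hf.differentiableAt hz)]
    simp only [map_div₀, map_add, Complex.conj_conj]
    rw [add_comm (conj (f z))]
    field_simp

/-- Derivatives along `branch k` of the columns of a solution of the Lax pair. -/
lemma IsLaxSolution.deriv_branch (hΦ : IsLaxSolution ρ₀ f k Φ) {z : ℂ} (hz : z ∈ upperRegion ρ₀ k)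
    (j : Fin 2) :
    let a := laxA f z; let b := laxB f z; let l := branch k z
    let u := Φ z l 0 j; let v := Φ z l 1 j
    (DifferentiableAt ℝ (fun w => Φ w (branch k w) 0 j) z ∧
      dz (fun w => Φ w (branch k w) 0 j) z = b * (u + l * v) ∧
      dzbar (fun w => Φ w (branch k w) 0 j) z = conj a * (u + l⁻¹ * v)) ∧
    (DifferentiableAt ℝ (fun w => Φ w (branch k w) 1 j) z ∧
      dz (fun w => Φ w (branch k w) 1 j) z = a * (l * u + v) ∧
      dzbar (fun w => Φ w (branch k w) 1 j) z = conj b * (l⁻¹ * u + v)) := by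
  have h := fun i => hΦ (upperRegion ρ₀ k) (branch k) (isOpen_upperRegion ρ₀ k)
    (upperRegion_subset ρ₀ k) (fun z hz => (continuousAt_branch (upperRegion_cut hz).1
      (upperRegion_cut hz).2.le).continuousWithinAt) (fun z hz => upperRegion_isLambda hz) z hz i j
  refine ⟨⟨(h 0).1, (h 0).2.1.trans ?_, (h 0).2.2.trans ?_⟩,
    (h 1).1, (h 1).2.1.trans ?_, (h 1).2.2.trans ?_⟩ <;>
  · rw [mul_entry]; simp [laxU, laxV]; ring

/-- The `j`-th column of the solution along `branch k`. -/
noncomputable def column (k : ℂ) (Φ : ℂ → ℂ → Matrix (Fin 2) (Fin 2) ℂ) (j : Fin 2) (z : ℂ) : ℂ × ℂ :=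
  (Φ z (branch k z) 0 j, Φ z (branch k z) 1 j)

/-- The `j`-th column of the solution along `branch k`, in the frame `[[f̄, 1], [f, -1]]`. -/
noncomputable def gaugedColumn (f : ℂ → ℂ) (k : ℂ) (Φ : ℂ → ℂ → Matrix (Fin 2) (Fin 2) ℂ)
    (j : Fin 2) (z : ℂ) : ℂ × ℂ :=
  ((Φ z (branch k z) 0 j + Φ z (branch k z) 1 j) / (f z + conj (f z)),
    (f z * Φ z (branch k z) 0 j - conj (f z) * Φ z (branch k z) 1 j) / (f z + conj (f z)))

lemma IsErnstPotential.column_eq (hf : IsErnstPotential ρ₀ f) {z : ℂ} (hz : z ∈ exteriorDomain ρ₀)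
    (j : Fin 2) :
    column k Φ j z = (conj (f z) * (gaugedColumn f k Φ j z).1 + (gaugedColumn f k Φ j z).2,
      f z * (gaugedColumn f k Φ j z).1 - (gaugedColumn f k Φ j z).2) := by
  have hs := hf.add_conj_ne_zero (Or.inl hz)
  ext <;> simp only [column, gaugedColumn] <;> field_simp <;> ring

lemma norm_add_mul_le {a b c d : ℂ} {A C : ℝ} (ha : ‖a‖ ≤ A) (hb : ‖b‖ ≤ A) (hc : ‖c‖ ≤ C)
    (hd : ‖d‖ ≤ C) : ‖a * c + b * d‖ ≤ 2 * (A * C) := by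
  have h1 : ‖a * c‖ ≤ A * C := by
    rw [norm_mul]; exact mul_le_mul ha hc (norm_nonneg _) ((norm_nonneg _).trans ha)
  have h2 : ‖b * d‖ ≤ A * C := by
    rw [norm_mul]; exact mul_le_mul hb hd (norm_nonneg _) ((norm_nonneg _).trans hb)
  linarith [norm_add_le (a * c) (b * d)]

/-- Variation of constants: the frame solves the system for `l = 1`, so in it only the multiples of
`l - 1` and `l⁻¹ - 1` survive. Here `g, h` are `f, f̄` along a line and `a', b'` the conjugates of
`a, b`. -/
lemma hasDerivAt_gauge {U V g h : ℝ → ℂ} {x : ℝ} {a b a' b' l : ℂ} (hs : g x + h x ≠ 0)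
    (hl : l ≠ 0)
    (hU : HasDerivAt U (b * (U x + l * V x) + a' * (U x + l⁻¹ * V x)) x)
    (hV : HasDerivAt V (a * (l * U x + V x) + b' * (l⁻¹ * U x + V x)) x)
    (hg : HasDerivAt g ((g x + h x) * a + (g x + h x) * b') x)
    (hh : HasDerivAt h ((g x + h x) * b + (g x + h x) * a') x) :
    HasDerivAt (fun t => ((U t + V t) / (g t + h t), (g t * U t - h t * V t) / (g t + h t)))
      (((a * (l - 1) + b' * (l⁻¹ - 1)) * U x + (b * (l - 1) + a' * (l⁻¹ - 1)) * V x) / (g x + h x),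
        (-h x * ((a * (l - 1) + b' * (l⁻¹ - 1)) * U x)
          + g x * ((b * (l - 1) + a' * (l⁻¹ - 1)) * V x)) / (g x + h x)) x := by
  have hsd : HasDerivAt (fun t => g t + h t) _ x := hg.add hh
  have hUV : HasDerivAt (fun t => U t + V t) _ x := hU.add hV
  have hgU : HasDerivAt (fun t => g t * U t) _ x := hg.mul hU
  have hhV : HasDerivAt (fun t => h t * V t) _ x := hh.mul hV
  have hd : HasDerivAt (fun t => g t * U t - h t * V t) _ x := hgU.sub hhV
  have e0 : HasDerivAt (fun t => (U t + V t) / (g t + h t)) _ x := hUV.div hsd hs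
  have e1 : HasDerivAt (fun t => (g t * U t - h t * V t) / (g t + h t)) _ x := hd.div hsd hs
  convert e0.prodMk e1 using 1
  generalize U x = u, V x = v, g x = p, h x = q at *
  refine Prod.ext ?_ ?_ <;> simp only <;> field_simp <;> ring

/-- The factor `x / R` comes from `lam - 1` and `lam⁻¹ - 1`, bounded by `4 x / R` and `8 x / R`. It
matches the weight in the energy, which does not control the unweighted gradient up to the axis. -/
lemma IsLaxSolution.gauged_deriv (hf : IsErnstPotential ρ₀ f) (hΦ : IsLaxSolution ρ₀ f k Φ)
    (hk : k ≠ 0) {R x y : ℝ} (hR : 0 < R) (hkR : 5 * ‖k‖ ≤ R) (hx : 0 < x) (hy : R ≤ y)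
    (hz : (⟨x, y⟩ : ℂ) ∈ upperRegion ρ₀ k) (hfz : ‖f ⟨x, y⟩ - 1‖ ≤ 1 / 5) (j : Fin 2) :
    ∃ Y', HasDerivAt (fun t : ℝ => gaugedColumn f k Φ j ⟨t, y⟩) Y' x ∧
      ‖Y'‖ ≤ 60 * (x / R) * gradNorm f ⟨x, y⟩ * ‖gaugedColumn f k Φ j ⟨x, y⟩‖ := by
  have hzD := upperRegion_subset _ _ hz
  have hs0 := hf.add_conj_ne_zero (Or.inl hzD)
  have hs1 := one_le_norm_add_conj hfz
  obtain ⟨⟨u0, u1, u2⟩, v0, v1, v2⟩ := hΦ.deriv_branch hz j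
  obtain ⟨na, nb⟩ := hf.norm_lax_le hzD hfz
  obtain ⟨fz, fzb⟩ := hf.dz_eq hzD
  have hcol := hf.column_eq (k := k) (Φ := Φ) hzD j
  have hl := upperRegion_isLambda hz
  have hky : k.re < y := by
    have := (le_abs_self _).trans (Complex.abs_re_le_norm k)
    have := norm_nonneg k
    linarith
  have hl1 : ‖branch k ⟨x, y⟩ - 1‖ ≤ 4 * (x / R) := by
    have h1 := norm_branch_sub_one_le (k := k) (z := ⟨x, y⟩) hky hx.le
    have h2 := (le_abs_self _).trans (Complex.abs_re_le_norm k)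
    have h3 : R / 2 ≤ y - k.re := by have := norm_nonneg k; linarith
    have h4 := (mul_le_mul_of_nonneg_left h3 (norm_nonneg (branch k ⟨x, y⟩ - 1))).trans h1
    simp only at h4
    rw [← mul_div_assoc, le_div_iff₀ hR]
    linarith
  have hl2 : ‖(branch k ⟨x, y⟩)⁻¹ - 1‖ ≤ 8 * (x / R) := by
    have h1 := (norm_lambda_bounds hl hk (hkR.trans (norm_ge_of_im hy))).2
    have h2 : (branch k ⟨x, y⟩)⁻¹ - 1 = -((branch k ⟨x, y⟩)⁻¹ * (branch k ⟨x, y⟩ - 1)) := by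
      have := hl.1
      field_simp; ring
    rw [h2, norm_neg, norm_mul]
    have := mul_le_mul h1 hl1 (norm_nonneg _) (by norm_num)
    linarith
  have hd0 := hasDerivAt_horizontal u0
  have hd1 := hasDerivAt_horizontal v0
  have hdf := hasDerivAt_horizontal (hf.differentiableAt hzD)
  have hdc := hasDerivAt_horizontal (differentiableAt_conj (hf.differentiableAt hzD))
  rw [dRho_eq, u1, u2] at hd0
  rw [dRho_eq, v1, v2] at hd1
  rw [dRho_conj (hf.differentiableAt hzD)] at hdc
  rw [dRho_eq, fz, fzb] at hdf hdc
  set z : ℂ := ⟨x, y⟩ with hzdef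
  set a := laxA f z
  set b := laxB f z
  set l := branch k z
  set N := gradNorm f z
  set u := Φ z l 0 j
  set v := Φ z l 1 j
  set p := a * (l - 1) + conj b * (l⁻¹ - 1) with hp
  set q := b * (l - 1) + conj a * (l⁻¹ - 1) with hq
  set Y := gaugedColumn f k Φ j z
  have hN : 0 ≤ N := gradNorm_nonneg f z
  have hxR : 0 ≤ x / R := by positivity
  have hl1' : ‖l - 1‖ ≤ 8 * (x / R) := by linarith
  have hpn : ‖p‖ ≤ 8 * (x / R) * N := by
    have := norm_add_mul_le na ((Complex.norm_conj b).trans_le nb) hl1' hl2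
    linarith
  have hqn : ‖q‖ ≤ 8 * (x / R) * N := by
    have := norm_add_mul_le nb ((Complex.norm_conj a).trans_le na) hl1' hl2
    linarith
  have hfn : ‖f z‖ ≤ 6 / 5 := by
    have := norm_add_le (f z - 1) 1
    rw [sub_add_cancel, norm_one] at this
    linarith
  have hu : u = conj (f z) * Y.1 + Y.2 := congrArg Prod.fst hcol
  have hv : v = f z * Y.1 - Y.2 := congrArg Prod.snd hcol
  have hY1 : ‖Y.1‖ ≤ ‖Y‖ := norm_fst_le Y
  have hY2 : ‖Y.2‖ ≤ ‖Y‖ := norm_snd_le Y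
  have hY0 : 0 ≤ ‖Y‖ := norm_nonneg Y
  have hun : ‖u‖ ≤ 11 / 5 * ‖Y‖ := by
    rw [hu]
    refine (norm_add_le _ _).trans ?_
    rw [norm_mul, Complex.norm_conj]
    have := mul_le_mul hfn hY1 (norm_nonneg _) (by norm_num)
    linarith
  have hvn : ‖v‖ ≤ 11 / 5 * ‖Y‖ := by
    rw [hv]
    refine (norm_sub_le _ _).trans ?_
    rw [norm_mul]
    have := mul_le_mul hfn hY1 (norm_nonneg _) (by norm_num)
    linarith
  refine ⟨((p * u + q * v) / (f z + conj (f z)),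
    ((-conj (f z)) * (p * u) + f z * (q * v)) / (f z + conj (f z))), ?_, ?_⟩
  · rw [hp, hq]
    refine hasDerivAt_gauge hs0 hl.1 hd0 hd1 hdf ?_
    convert hdc using 1
    simp only [map_add, map_mul, Complex.conj_conj]
    ring
  · have hpu : ‖p * u‖ ≤ 8 * (x / R) * N * (11 / 5 * ‖Y‖) := by
      rw [norm_mul]; exact mul_le_mul hpn hun (norm_nonneg _) (by positivity)
    have hqv : ‖q * v‖ ≤ 8 * (x / R) * N * (11 / 5 * ‖Y‖) := by
      rw [norm_mul]; exact mul_le_mul hqn hvn (norm_nonneg _) (by positivity)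
    have hpos : 0 ≤ (x / R) * N * ‖Y‖ := by positivity
    refine norm_prod_le_iff.2 ⟨?_, ?_⟩
    · rw [norm_div]
      refine (div_le_self (norm_nonneg _) hs1).trans ((norm_add_le _ _).trans ?_)
      linarith
    · rw [norm_div]
      refine (div_le_self (norm_nonneg _) hs1).trans ?_
      have := norm_add_mul_le (a := -conj (f z)) (b := f z) (A := 6 / 5)
        (by rwa [norm_neg, Complex.norm_conj]) hfn hpu hqv
      linarith

/-- Away from the axis no gauge is needed: `lam` and its inverse are bounded by `2`, and the
coefficients by half the gradient norm. -/
lemma IsLaxSolution.column_deriv (hf : IsErnstPotential ρ₀ f) (hΦ : IsLaxSolution ρ₀ f k Φ)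
    (hk : k ≠ 0) {x y : ℝ} (hkx : 5 * ‖k‖ ≤ x)
    (hz : (⟨x, y⟩ : ℂ) ∈ upperRegion ρ₀ k) (hfz : ‖f ⟨x, y⟩ - 1‖ ≤ 1 / 5) (j : Fin 2) :
    ∃ Y', HasDerivAt (fun t : ℝ => column k Φ j ⟨x, t⟩) Y' y ∧
      ‖Y'‖ ≤ 3 * gradNorm f ⟨x, y⟩ * ‖column k Φ j ⟨x, y⟩‖ := by
  have hzD := upperRegion_subset _ _ hz
  obtain ⟨⟨u0, u1, u2⟩, v0, v1, v2⟩ := hΦ.deriv_branch hz j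
  obtain ⟨na, nb⟩ := hf.norm_lax_le hzD hfz
  obtain ⟨l1, l2⟩ := norm_lambda_bounds (upperRegion_isLambda hz) hk (hkx.trans (norm_ge_of_re le_rfl))
  have hd0 := hasDerivAt_vertical u0
  have hd1 := hasDerivAt_vertical v0
  rw [dZeta_eq, u1, u2] at hd0
  rw [dZeta_eq, v1, v2] at hd1
  refine ⟨_, hd0.prodMk hd1, ?_⟩
  set z : ℂ := ⟨x, y⟩
  set a := laxA f z
  set b := laxB f z
  set l := branch k z
  set N := gradNorm f z
  have hu : ‖Φ z l 0 j‖ ≤ ‖column k Φ j z‖ := norm_fst_le (column k Φ j z)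
  have hv : ‖Φ z l 1 j‖ ≤ ‖column k Φ j z‖ := norm_snd_le (column k Φ j z)
  set u := Φ z l 0 j
  set v := Φ z l 1 j
  set Y := column k Φ j z
  have key : ∀ m s t : ℂ, ‖m‖ ≤ 2 → ‖s‖ ≤ ‖Y‖ → ‖t‖ ≤ ‖Y‖ → ‖s + m * t‖ ≤ 3 * ‖Y‖ := by
    intro m s t hm hs ht
    refine (norm_add_le _ _).trans ?_
    rw [norm_mul]
    have := mul_le_mul hm ht (norm_nonneg _) (by norm_num)
    linarith
  have fin : ∀ c d s t : ℂ, ‖c‖ ≤ N / 2 → ‖d‖ ≤ N / 2 → ‖s‖ ≤ 3 * ‖Y‖ → ‖t‖ ≤ 3 * ‖Y‖ →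
      ‖Complex.I * (c * s - d * t)‖ ≤ 3 * N * ‖Y‖ := by
    intro c d s t hc hd hs ht
    rw [norm_mul, Complex.norm_I, one_mul, sub_eq_add_neg, ← neg_mul]
    have := norm_add_mul_le hc ((norm_neg d).trans_le hd) hs ht
    linarith
  refine norm_prod_le_iff.2 ⟨?_, ?_⟩
  · exact fin _ _ _ _ nb ((Complex.norm_conj a).trans_le na) (key _ _ _ l1 hu hv)
      (key _ _ _ l2 hu hv)
  · refine fin _ _ _ _ na ((Complex.norm_conj b).trans_le nb) ?_ ?_
    · rw [add_comm]; exact key _ _ _ l1 hv hu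
    · rw [add_comm]; exact key _ _ _ l2 hv hu

end Transport

end Ernst

/-! ### Asymptotics in the equatorial plane -/

namespace Ernst

open MeasureTheory

section Asymptotics

variable {ρ₀ : ℝ} {f : ℂ → ℂ} {k : ℂ} {Φ : ℂ → ℂ → Matrix (Fin 2) (Fin 2) ℂ}

/-- Young's inequality, in place of Cauchy–Schwarz for the integrals. With `r = ε / R` both terms
integrate to `O(ε)` over segments of length `O(R)`. -/
lemma gradNorm_le {z : ℂ} {r : ℝ} (hr : 0 < r) (f : ℂ → ℂ) :
    gradNorm f z ≤ gradSq f z / (2 * r) + r := by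
  have h1 := gradNorm_sq_le f z
  rw [div_add' _ _ _ (by positivity), le_div_iff₀ (by positivity)]
  nlinarith [sq_nonneg (gradNorm f z - 2 * r)]

lemma IsGoodPath.integral_vertical (hf : IsErnstPotential ρ₀ f) {ε R δ x y : ℝ}
    (hg : IsGoodPath ρ₀ f ε R δ x y) (hε : 0 < ε) (hR : 0 < R) (hRρ : ρ₀ < R) :
    ContinuousOn (fun t : ℝ => 3 * gradNorm f ⟨x, t⟩) (Set.Icc 0 y) ∧
      ∫ t in Set.Icc 0 y, 3 * gradNorm f ⟨x, t⟩ ≤ 2000000 * ε := by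
  have hx := hg.hx
  have hy := hg.hy
  have hD : ∀ t ∈ Set.Icc 0 (2 * R), (⟨x, t⟩ : ℂ) ∈ exteriorDomain ρ₀ := fun t _ =>
    ⟨hR.trans_le hx.1, fun h => absurd h.2 (not_le.2 (hRρ.trans_le hx.1))⟩
  have hline : ContinuousOn (fun t : ℝ => (⟨x, t⟩ : ℂ)) (Set.Icc 0 (2 * R)) := fun t _ =>
    (hasDerivAt_mk_right x t).continuousAt.continuousWithinAt
  have hcN : ContinuousOn (fun t : ℝ => 3 * gradNorm f ⟨x, t⟩) (Set.Icc 0 (2 * R)) :=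
    continuousOn_const.mul (hf.continuousOn_gradNorm.comp hline hD)
  have hcS : ContinuousOn (fun t : ℝ => gradSq f ⟨x, t⟩) (Set.Icc 0 (2 * R)) :=
    hf.continuousOn_gradSq.comp hline hD
  have hsub : Set.Icc 0 y ⊆ Set.Icc 0 (2 * R) := Set.Icc_subset_Icc_right hy.2
  have iS := hcS.integrableOn_compact (μ := volume) isCompact_Icc
  have iN := hcN.integrableOn_compact (μ := volume) isCompact_Icc
  have ic : IntegrableOn (fun _ : ℝ => 3 * (ε / R)) (Set.Icc 0 (2 * R)) :=
    continuousOn_const.integrableOn_compact isCompact_Icc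
  refine ⟨hcN.mono hsub, ?_⟩
  calc ∫ t in Set.Icc 0 y, 3 * gradNorm f ⟨x, t⟩
      ≤ ∫ t in Set.Icc 0 (2 * R), 3 * gradNorm f ⟨x, t⟩ := by
        refine setIntegral_mono_set iN (Eventually.of_forall fun t => ?_) hsub.eventuallyLE
        exact mul_nonneg (by norm_num) (gradNorm_nonneg _ _)
    _ ≤ ∫ t in Set.Icc 0 (2 * R), (3 * R / (2 * ε) * gradSq f ⟨x, t⟩ + 3 * (ε / R)) := by
        refine setIntegral_mono_on iN ((iS.const_mul _).add ic) measurableSet_Icc fun t _ => ?_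
        have h := gradNorm_le (z := ⟨x, t⟩) (div_pos hε hR) f
        have e : gradSq f ⟨x, t⟩ / (2 * (ε / R)) = R / (2 * ε) * gradSq f ⟨x, t⟩ := by field_simp
        rw [e] at h
        have e2 : 3 * R / (2 * ε) = 3 * (R / (2 * ε)) := by ring
        rw [e2]
        linarith
    _ = 3 * R / (2 * ε) * (∫ t in Set.Icc 0 (2 * R), gradSq f ⟨x, t⟩) + 6 * ε := by
        rw [integral_add (iS.const_mul _) ic, integral_const_mul, setIntegral_const,
          Real.volume_real_Icc_of_le (by linarith), smul_eq_mul]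
        field_simp
        ring
    _ ≤ 3 * R / (2 * ε) * (60000 * ε ^ 2 / R) + 6 * ε := by
        have := mul_le_mul_of_nonneg_left hg.vertical (by positivity : 0 ≤ 3 * R / (2 * ε))
        linarith
    _ ≤ 2000000 * ε := by
        have e : 3 * R / (2 * ε) * (60000 * ε ^ 2 / R) = 90000 * ε := by field_simp; norm_num
        rw [e]; linarith

lemma IsGoodPath.integral_horizontal (hf : IsErnstPotential ρ₀ f) {ε R δ x y : ℝ}
    (hg : IsGoodPath ρ₀ f ε R δ x y) (hε : 0 < ε) (hR : 0 < R) (hδ : 0 < δ) (hδR : δ ≤ R) :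
    ContinuousOn (fun t : ℝ => 60 * (t / R) * gradNorm f ⟨t, y⟩) (Set.Icc δ x) ∧
      ∫ t in Set.Icc δ x, 60 * (t / R) * gradNorm f ⟨t, y⟩ ≤ 2000000 * ε := by
  have hx := hg.hx
  have hy := hg.hy
  have hD : ∀ t ∈ Set.Icc δ (2 * R), (⟨t, y⟩ : ℂ) ∈ exteriorDomain ρ₀ := fun t ht =>
    ⟨hδ.trans_le ht.1, fun h => (hR.trans_le hy.1).ne' h.1⟩
  have hline : ContinuousOn (fun t : ℝ => (⟨t, y⟩ : ℂ)) (Set.Icc δ (2 * R)) := fun t _ =>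
    (hasDerivAt_mk_left t y).continuousAt.continuousWithinAt
  have hcN : ContinuousOn (fun t : ℝ => 60 * (t / R) * gradNorm f ⟨t, y⟩) (Set.Icc δ (2 * R)) :=
    (by fun_prop : ContinuousOn (fun t : ℝ => 60 * (t / R)) _).mul
      (hf.continuousOn_gradNorm.comp hline hD)
  have hcS : ContinuousOn (fun t : ℝ => t * gradSq f ⟨t, y⟩) (Set.Icc δ (2 * R)) :=
    continuousOn_id.mul (hf.continuousOn_gradSq.comp hline hD)
  have hsub : Set.Icc δ x ⊆ Set.Icc δ (2 * R) := Set.Icc_subset_Icc_right hx.2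
  have iS := hcS.integrableOn_compact (μ := volume) isCompact_Icc
  have iN := hcN.integrableOn_compact (μ := volume) isCompact_Icc
  have ic : IntegrableOn (fun _ : ℝ => 120 * (ε / R)) (Set.Icc δ (2 * R)) :=
    continuousOn_const.integrableOn_compact isCompact_Icc
  refine ⟨hcN.mono hsub, ?_⟩
  calc ∫ t in Set.Icc δ x, 60 * (t / R) * gradNorm f ⟨t, y⟩
      ≤ ∫ t in Set.Icc δ (2 * R), 60 * (t / R) * gradNorm f ⟨t, y⟩ := by
        refine setIntegral_mono_set iN ?_ hsub.eventuallyLE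
        filter_upwards [ae_restrict_mem measurableSet_Icc] with t ht
        have : 0 ≤ t := hδ.le.trans ht.1
        exact mul_nonneg (by positivity) (gradNorm_nonneg _ _)
    _ ≤ ∫ t in Set.Icc δ (2 * R), (30 / ε * (t * gradSq f ⟨t, y⟩) + 120 * (ε / R)) := by
        refine setIntegral_mono_on iN ((iS.const_mul _).add ic) measurableSet_Icc fun t ht => ?_
        have ht0 : 0 ≤ t := hδ.le.trans ht.1
        have h := gradNorm_le (z := ⟨t, y⟩) (div_pos hε hR) f
        have h1 := mul_le_mul_of_nonneg_left h (by positivity : 0 ≤ 60 * (t / R))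
        refine h1.trans ?_
        have e : 60 * (t / R) * (gradSq f ⟨t, y⟩ / (2 * (ε / R)) + ε / R)
            = 30 / ε * (t * gradSq f ⟨t, y⟩) + 60 * (t / R) * (ε / R) := by field_simp; ring
        rw [e]
        have h2 : t / R ≤ 2 := by rw [div_le_iff₀ hR]; exact ht.2
        have h3 : 0 ≤ ε / R := by positivity
        nlinarith
    _ = 30 / ε * (∫ t in Set.Icc δ (2 * R), t * gradSq f ⟨t, y⟩)
          + (2 * R - δ) * (120 * (ε / R)) := by
        rw [integral_add (iS.const_mul _) ic, integral_const_mul, setIntegral_const,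
          Real.volume_real_Icc_of_le (by linarith), smul_eq_mul]
    _ ≤ 30 / ε * (60000 * ε ^ 2) + 2 * R * (120 * (ε / R)) := by
        have h1 := mul_le_mul_of_nonneg_left hg.horizontal (by positivity : 0 ≤ 30 / ε)
        have h2 : 0 ≤ δ * (120 * (ε / R)) := by positivity
        linarith
    _ ≤ 2000000 * ε := by
        have e : 30 / ε * (60000 * ε ^ 2) + 2 * R * (120 * (ε / R)) = 1800240 * ε := by
          field_simp; norm_num
        rw [e]; linarith

lemma upperRegion_of_im {x y : ℝ} (hx : 0 < x) (hy : ‖k‖ < y) :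
    (⟨x, y⟩ : ℂ) ∈ upperRegion ρ₀ k :=
  Or.inr ⟨hx, max_lt (((le_abs_self _).trans (Complex.abs_re_le_norm k)).trans_lt hy)
    ((norm_nonneg k).trans_lt hy)⟩

lemma upperRegion_of_re {x y : ℝ} (hx : ρ₀ < x) (hx' : ‖k‖ < x) :
    (⟨x, y⟩ : ℂ) ∈ upperRegion ρ₀ k :=
  Or.inl ⟨(Complex.abs_im_le_norm k).trans_lt hx', Or.inr hx⟩

/-- Transport of a solution of the Lax pair from the axis to the equatorial plane. -/
theorem IsLaxSolution.transport (hf : IsErnstPotential ρ₀ f) (hΦ : IsLaxSolution ρ₀ f k Φ)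
    (hk : k ≠ 0) {ε R δ x y : ℝ} (hg : IsGoodPath ρ₀ f ε R δ x y) (hε : 0 < ε)
    (hε1 : ε ≤ 1 / 100000000) (hR : 0 < R) (hRρ : ρ₀ < R) (hkR : 5 * ‖k‖ ≤ R) (hδ : 0 < δ)
    (hδR : δ ≤ R) (j : Fin 2) {A : ℂ × ℂ} (hA : ‖gaugedColumn f k Φ j ⟨δ, y⟩ - A‖ ≤ ε) :
    ‖column k Φ j x - (A.1 + A.2, A.1 - A.2)‖ ≤ 100000000 * (‖A‖ + 1) * ε := by
  have hx := hg.hx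
  have hy := hg.hy
  have hk0 : 0 < ‖k‖ := norm_pos_iff.2 hk
  have hnear : ∀ z ∈ upperRegion ρ₀ k, R / 2 ≤ ‖z‖ → ‖f z - 1‖ ≤ 1 / 5 := fun z hz hz' =>
    (hg.near_one z (upperRegion_subset _ _ hz) hz').trans (by linarith)
  have hA0 := norm_nonneg A
  set m := ‖A‖ + 1 with hm
  obtain ⟨hc1, hi1⟩ := hg.integral_horizontal hf hε hR hδ hδR
  obtain ⟨hc2, hi2⟩ := hg.integral_vertical hf hε hR hRρ
  -- horizontal segment
  have hz1 : ∀ t ∈ Set.Icc δ x, (⟨t, y⟩ : ℂ) ∈ upperRegion ρ₀ k := fun t ht =>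
    upperRegion_of_im (hδ.trans_le ht.1) (by linarith [hy.1])
  have hder1 : ∀ t : ℝ, ∃ Y', t ∈ Set.Icc δ x →
      HasDerivAt (fun t : ℝ => gaugedColumn f k Φ j ⟨t, y⟩) Y' t ∧
      ‖Y'‖ ≤ 60 * (t / R) * gradNorm f ⟨t, y⟩ * ‖gaugedColumn f k Φ j ⟨t, y⟩‖ := fun t => by
    by_cases ht : t ∈ Set.Icc δ x
    · obtain ⟨Y', h⟩ := hΦ.gauged_deriv hf hk hR hkR (hδ.trans_le ht.1) hy.1 (hz1 t ht)
        (hnear _ (hz1 t ht) (norm_ge_of_im (by linarith [hy.1]))) j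
      exact ⟨Y', fun _ => h⟩
    · exact ⟨0, fun h => absurd h ht⟩
  choose Y' hY' using hder1
  have h1 := norm_sub_le_of_norm_deriv_le_mul (hδR.trans hx.1) hc1
    (fun t ht => mul_nonneg (by have := hδ.le.trans ht.1; positivity) (gradNorm_nonneg _ _))
    (fun t ht => (hY' t ht).1) (fun t ht => (hY' t ht).2) hi1 (by linarith)
  have h2 : ‖gaugedColumn f k Φ j ⟨δ, y⟩‖ ≤ m := by
    have := norm_add_le (gaugedColumn f k Φ j ⟨δ, y⟩ - A) A
    rw [sub_add_cancel] at this
    linarith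
  set Y := gaugedColumn f k Φ j ⟨x, y⟩ with hYdef
  have hYA : ‖Y - A‖ ≤ 5000000 * m * ε := by
    have e : Y - A = (Y - gaugedColumn f k Φ j ⟨δ, y⟩) + (gaugedColumn f k Φ j ⟨δ, y⟩ - A) := by
      abel
    rw [e]
    refine (norm_add_le _ _).trans ?_
    have h3 : 2 * (2000000 * ε) * ‖gaugedColumn f k Φ j ⟨δ, y⟩‖ ≤ 2 * (2000000 * ε) * m :=
      mul_le_mul_of_nonneg_left h2 (by positivity)
    have h4 : ε ≤ m * ε := le_mul_of_one_le_left hε.le (by linarith)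
    linarith
  -- corner
  have hx' : x ∈ Set.Icc δ x := ⟨hδR.trans hx.1, le_rfl⟩
  have hcor := hf.column_eq (k := k) (Φ := Φ) (upperRegion_subset _ _ (hz1 x hx')) j
  have hf1 : ‖f ⟨x, y⟩ - 1‖ ≤ ε := hg.near_one _ (upperRegion_subset _ _ (hz1 x hx'))
    (norm_ge_of_im (by linarith [hy.1]))
  have hm1 : 5000000 * m * ε ≤ m := by
    have : 5000000 * ε ≤ 1 := by linarith
    have := mul_le_mul_of_nonneg_right this (by linarith : 0 ≤ m)
    linarith
  have hYm : ‖Y‖ ≤ 2 * m := by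
    have := norm_add_le (Y - A) A
    rw [sub_add_cancel] at this
    linarith
  have hY1 : ‖Y.1‖ ≤ 2 * m := (norm_fst_le Y).trans hYm
  have d1 : ‖Y.1 - A.1‖ ≤ 5000000 * m * ε := (norm_fst_le (Y - A)).trans hYA
  have d2 : ‖Y.2 - A.2‖ ≤ 5000000 * m * ε := (norm_snd_le (Y - A)).trans hYA
  have hcorner : ‖column k Φ j ⟨x, y⟩ - (A.1 + A.2, A.1 - A.2)‖ ≤ 11000000 * m * ε := by
    rw [hcor, ← hYdef, Prod.mk_sub_mk]
    have hb : ∀ w : ℂ, ‖w - 1‖ ≤ ε → ‖(w - 1) * Y.1‖ ≤ 2 * m * ε := fun w hw => by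
      rw [norm_mul, mul_comm]
      exact mul_le_mul hY1 hw (norm_nonneg _) (by linarith)
    have hmε : 0 ≤ m * ε := mul_nonneg (by linarith) hε.le
    refine norm_prod_le_iff.2 ⟨?_, ?_⟩
    · have e : conj (f ⟨x, y⟩) * Y.1 + Y.2 - (A.1 + A.2) =
          (conj (f ⟨x, y⟩) - 1) * Y.1 + (Y.1 - A.1) + (Y.2 - A.2) := by ring
      have h3 := hb (conj (f ⟨x, y⟩)) (by
        rw [← map_one (starRingEnd ℂ), ← map_sub, Complex.norm_conj]; exact hf1)
      simp only
      rw [e]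
      refine (norm_add₃_le).trans ?_
      linarith
    · have e : f ⟨x, y⟩ * Y.1 - Y.2 - (A.1 - A.2) =
          (f ⟨x, y⟩ - 1) * Y.1 + (Y.1 - A.1) + -(Y.2 - A.2) := by ring
      have h3 := hb (f ⟨x, y⟩) hf1
      simp only
      rw [e]
      refine (norm_add₃_le).trans ?_
      rw [norm_neg]
      linarith
  -- vertical segment
  have hxρ : ρ₀ < x := hRρ.trans_le hx.1
  have hz2 : ∀ t ∈ Set.Icc 0 y, (⟨x, t⟩ : ℂ) ∈ upperRegion ρ₀ k := fun t _ =>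
    upperRegion_of_re hxρ (by linarith [hx.1])
  have hder2 : ∀ t : ℝ, ∃ Y', t ∈ Set.Icc 0 y →
      HasDerivAt (fun t : ℝ => column k Φ j ⟨x, t⟩) Y' t ∧
      ‖Y'‖ ≤ 3 * gradNorm f ⟨x, t⟩ * ‖column k Φ j ⟨x, t⟩‖ := fun t => by
    by_cases ht : t ∈ Set.Icc 0 y
    · obtain ⟨Y', h⟩ := hΦ.column_deriv hf hk (hkR.trans hx.1) (hz2 t ht)
        (hnear _ (hz2 t ht) (norm_ge_of_re (by linarith [hx.1]))) j
      exact ⟨Y', fun _ => h⟩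
    · exact ⟨0, fun h => absurd h ht⟩
  choose Z' hZ' using hder2
  -- This estimate starts at the equatorial end, so its right side contains the unknown value there.
  -- That value is bounded in `h7` by absorption, since `ε` is small.
  have h5 := norm_sub_le_of_norm_deriv_le_mul (hR.le.trans hy.1) hc2
    (fun t _ => mul_nonneg (by norm_num) (gradNorm_nonneg _ _))
    (fun t ht => (hZ' t ht).1) (fun t ht => (hZ' t ht).2) hi2 (by linarith)
  have hx0 : (⟨x, 0⟩ : ℂ) = (x : ℂ) := rfl
  rw [hx0] at h5
  have hB : ‖((A.1 + A.2, A.1 - A.2) : ℂ × ℂ)‖ ≤ 2 * m := by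
    have a1 := norm_fst_le A
    have a2 := norm_snd_le A
    refine norm_prod_le_iff.2 ⟨(norm_add_le _ _).trans ?_, (norm_sub_le _ _).trans ?_⟩ <;> linarith
  have h6 : ‖column k Φ j ⟨x, y⟩‖ ≤ 5 * m := by
    have := norm_add_le (column k Φ j ⟨x, y⟩ - (A.1 + A.2, A.1 - A.2)) (A.1 + A.2, A.1 - A.2)
    rw [sub_add_cancel] at this
    linarith
  have h7 : ‖column k Φ j x‖ ≤ 10 * m := by
    have h8 := norm_sub_norm_le (column k Φ j x) (column k Φ j ⟨x, y⟩)
    rw [norm_sub_rev] at h8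
    have h9 : 2 * (2000000 * ε) * ‖column k Φ j x‖ ≤ 1 / 2 * ‖column k Φ j x‖ :=
      mul_le_mul_of_nonneg_right (by linarith) (norm_nonneg _)
    linarith
  have h8 : 2 * (2000000 * ε) * ‖column k Φ j x‖ ≤ 2 * (2000000 * ε) * (10 * m) :=
    mul_le_mul_of_nonneg_left h7 (by positivity)
  have e : column k Φ j x - (A.1 + A.2, A.1 - A.2) =
      -(column k Φ j ⟨x, y⟩ - column k Φ j x) +
        (column k Φ j ⟨x, y⟩ - (A.1 + A.2, A.1 - A.2)) := by abel
  rw [e]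
  refine (norm_add_le _ _).trans ?_
  rw [norm_neg]
  have hmε : 0 ≤ m * ε := mul_nonneg (by linarith) hε.le
  linarith

/-- Near the axis, the gauged columns are close to the columns of the spectral matrix. -/
lemma IsEigenfunction.gauged_near_axis (hf : IsErnstPotential ρ₀ f)
    (hΦ : IsEigenfunction ρ₀ f k Φ) {M : Matrix (Fin 2) (Fin 2) ℂ}
    (hA : ∀ t : ℝ, 0 < t → Φ (Complex.I * t) 1 = axisFrame f (Complex.I * t) * M)
    {ε R : ℝ} (hε : 0 < ε) (hR : ‖k‖ < R) (j : Fin 2) :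
    ∃ δ₀, 0 < δ₀ ∧ ∀ δ, 0 < δ → δ < δ₀ → ∀ y ∈ Set.Icc R (2 * R),
      ‖gaugedColumn f k Φ j ⟨δ, y⟩ - (M 0 j, M 1 j)‖ ≤ ε := by
  refine eventually_near_axis (P := fun z => ‖gaugedColumn f k Φ j z - (M 0 j, M 1 j)‖ ≤ ε)
    fun y hy => ?_
  have hky : ‖k‖ < y := hR.trans_le hy.1
  have hy0 : 0 < y := (norm_nonneg k).trans_lt hky
  have hmax : max k.re 0 < y :=
    max_lt (((le_abs_self _).trans (Complex.abs_re_le_norm k)).trans_lt hky) hy0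
  have hT := (hΦ.tendsto_axis hmax).1
  have hax := axis_mem_rotationAxis hy0.ne'
  have hs := hf.add_conj_ne_zero (Or.inr hax)
  have hTf := (hf.tendsto_axis hax).mono_left (nhdsWithin_mono _ (upperRegion_subset ρ₀ k))
  have hTc := (Complex.continuous_conj.tendsto _).comp hTf
  have hTe : ∀ i, Tendsto (fun z => Φ z (branch k z) i j)
      (𝓝[upperRegion ρ₀ k] (Complex.I * y)) (𝓝 (Φ (Complex.I * y) 1 i j)) := fun i =>
    tendsto_pi_nhds.1 (tendsto_pi_nhds.1 hT i) j
  -- The gauged column is the inverse of the axis frame applied to the column of `Φ`; on the axis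
  -- this leaves the column of `M`.
  have hlim : Tendsto (gaugedColumn f k Φ j) (𝓝[upperRegion ρ₀ k] (Complex.I * y))
      (𝓝 (M 0 j, M 1 j)) := by
    have h1 := ((hTe 0).add (hTe 1)).div (hTf.add hTc) hs
    have h2 := ((hTf.mul (hTe 0)).sub (hTc.mul (hTe 1))).div (hTf.add hTc) hs
    have h3 := h1.prodMk_nhds h2
    convert! h3 using 2
    rw [hA y hy0]
    simp only [mul_entry, axisFrame]
    simp
    constructor <;> field_simp <;> ring
  have h4 := (hlim.sub_const (M 0 j, M 1 j)).norm
  rw [sub_self, norm_zero] at h4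
  have h5 := eventually_nhdsWithin_iff.1 (h4.eventually_le_const hε)
  have h6 : ∀ᶠ z : ℂ in 𝓝 (Complex.I * y), ‖k‖ < z.im :=
    (Complex.continuous_im.tendsto _).eventually_const_lt (by simpa using hky)
  filter_upwards [h5, h6] with z hz hz' hz0
  exact hz (upperRegion_of_im hz0 hz')

end Asymptotics

end Ernst

/-! ### The global relation off the contour -/

namespace Ernst

section GlobalRelation

variable {ρ₀ : ℝ} {f : ℂ → ℂ}

lemma upperRegion_ofReal {k : ℂ} {x : ℝ} (hx : ρ₀ < x) (hx' : ‖k‖ < x) :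
    (x : ℂ) ∈ upperRegion ρ₀ k := upperRegion_of_re (y := 0) hx hx'

/-- The global relation between the eigenfunctions at `k` and `-k̄` in the equatorial plane. -/
lemma equator_relation (hf : IsErnstPotential ρ₀ f) (hsymm : IsEquatoriallySymmetric ρ₀ f) {k : ℂ}
    (hre : k.re ≠ 0) (him : k.im ≠ 0) {Φ Φ' : ℂ → ℂ → Matrix (Fin 2) (Fin 2) ℂ}
    (hΦ : IsEigenfunction ρ₀ f k Φ) (hΦ' : IsEigenfunction ρ₀ f (-conj k) Φ') {F G : ℂ → ℂ}
    (hA : ∀ t : ℝ, 0 < t → Φ (Complex.I * t) 1 =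
      axisFrame f (Complex.I * t) * spectralMatrix F G k)
    (hA' : ∀ t : ℝ, 0 < t → Φ' (Complex.I * t) 1 =
      axisFrame f (Complex.I * t) * spectralMatrix F G (-conj k))
    (hF : F k ≠ 0) (hF' : F (-conj k) ≠ 0) {x : ℝ} (hx : ρ₀ < x) (hx' : ‖k‖ < x) :
    (Φ' x (branch (-conj k) x)).transpose * sympl *
        (pauli3 * Φ x (branch k x) * pauli1).map conj =
      (pauli3 * Φ' x (branch (-conj k) x) * pauli1).transpose * sympl *
        (Φ x (branch k x)).map conj := by
  have hre' : (-conj k).re ≠ 0 := by simpa using hre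
  have him' : (-conj k).im ≠ 0 := by simpa using him
  have hn : ‖-conj k‖ < x := by rwa [norm_neg, Complex.norm_conj]
  have hz := upperRegion_ofReal (k := k) hx hx'
  have hz' := upperRegion_ofReal (k := -conj k) hx hn
  have hsol : IsLaxSolution ρ₀ f k Φ := hΦ.lax
  have hsol' : IsLaxSolution ρ₀ f (-conj k) Φ' := hΦ'.lax
  obtain ⟨C, hC⟩ := hsol'.wronskian_sheets hf hre' him' (hsol.reflect hf hsymm)
  obtain ⟨h1, h2⟩ := hC x hz'
  -- The upper sheet at `-k̄` is paired with the lower sheet at `k`. Equating the Wronskians on the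
  -- two sheets therefore relates all four values, and `sheet_exchange` removes the lower ones.
  have hc : conj (branch (-conj k) x) = -branch k x := by
    have h := conj_branch_ofReal (k := k) ((Complex.abs_im_le_norm k).trans_lt hx')
    rw [← neg_eq_iff_eq_neg] at h
    rw [← h, map_neg, Complex.conj_conj]
  rw [← h2] at h1
  simp only [map_neg, hc, neg_neg, Complex.conj_ofReal] at h1
  rw [hΦ.sheet_exchange hf hre him hA hF hz, hΦ'.sheet_exchange hf hre' him' hA' hF' hz'] at h1
  exact h1

/-- Far away in the equatorial plane, eigenfunctions approach `[[1, 1], [1, -1]] A(k)`,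
along a common sequence of points. -/
lemma exists_equator_approx (hf : IsErnstPotential ρ₀ f) {k k' : ℂ} (hk : k ≠ 0) (hk' : k' ≠ 0)
    {Φ Φ' : ℂ → ℂ → Matrix (Fin 2) (Fin 2) ℂ} (hΦ : IsEigenfunction ρ₀ f k Φ)
    (hΦ' : IsEigenfunction ρ₀ f k' Φ') {M M' : Matrix (Fin 2) (Fin 2) ℂ}
    (hA : ∀ t : ℝ, 0 < t → Φ (Complex.I * t) 1 = axisFrame f (Complex.I * t) * M)
    (hA' : ∀ t : ℝ, 0 < t → Φ' (Complex.I * t) 1 = axisFrame f (Complex.I * t) * M')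
    {ε : ℝ} (hε : 0 < ε) (hε1 : ε ≤ 1 / 100000000) :
    ∃ x : ℝ, ρ₀ < x ∧ ‖k‖ < x ∧ ∀ j,
      ‖column k Φ j x - (M 0 j + M 1 j, M 0 j - M 1 j)‖
        ≤ 100000000 * (‖(M 0 j, M 1 j)‖ + 1) * ε ∧
      ‖column k' Φ' j x - (M' 0 j + M' 1 j, M' 0 j - M' 1 j)‖
        ≤ 100000000 * (‖(M' 0 j, M' 1 j)‖ + 1) * ε := by
  have hn := norm_nonneg k
  have hn' := norm_nonneg k'
  have hρ := le_abs_self ρ₀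
  have hρ' := abs_nonneg ρ₀
  obtain ⟨R, hR₀, hR, x, δ₀, hδ₀, hpath⟩ :=
    hf.exists_goodPath hε (by linarith) (5 * ‖k‖ + 5 * ‖k'‖ + |ρ₀| + 1)
  have hax : ∀ j, ∃ δ₁, 0 < δ₁ ∧ ∀ δ, 0 < δ → δ < δ₁ → ∀ y ∈ Set.Icc R (2 * R),
      ‖gaugedColumn f k Φ j ⟨δ, y⟩ - (M 0 j, M 1 j)‖ ≤ ε ∧
      ‖gaugedColumn f k' Φ' j ⟨δ, y⟩ - (M' 0 j, M' 1 j)‖ ≤ ε := fun j => by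
    obtain ⟨d, hd, h⟩ := hΦ.gauged_near_axis hf hA hε (by linarith : ‖k‖ < R) j
    obtain ⟨d', hd', h'⟩ := hΦ'.gauged_near_axis hf hA' hε (by linarith : ‖k'‖ < R) j
    exact ⟨min d d', lt_min hd hd', fun δ hδ hδ' y hy =>
      ⟨h δ hδ (hδ'.trans_le (min_le_left _ _)) y hy, h' δ hδ (hδ'.trans_le (min_le_right _ _)) y hy⟩⟩
  obtain ⟨d0, hd0, h0⟩ := hax 0
  obtain ⟨d1, hd1, h1⟩ := hax 1
  set δ := min (min δ₀ R) (min d0 d1) / 2 with hδdef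
  have hmin : 0 < min (min δ₀ R) (min d0 d1) := lt_min (lt_min hδ₀ hR) (lt_min hd0 hd1)
  have hδ : 0 < δ := half_pos hmin
  have hδm : δ < min (min δ₀ R) (min d0 d1) := half_lt_self hmin
  have e1 : δ < δ₀ := hδm.trans_le ((min_le_left _ _).trans (min_le_left _ _))
  have e2 : δ < R := hδm.trans_le ((min_le_left _ _).trans (min_le_right _ _))
  have e3 : δ < d0 := hδm.trans_le ((min_le_right _ _).trans (min_le_left _ _))
  have e4 : δ < d1 := hδm.trans_le ((min_le_right _ _).trans (min_le_right _ _))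
  obtain ⟨y, hg⟩ := hpath δ hδ e1
  have hsol : IsLaxSolution ρ₀ f k Φ := hΦ.lax
  have hsol' : IsLaxSolution ρ₀ f k' Φ' := hΦ'.lax
  have hcl : ∀ j, ‖gaugedColumn f k Φ j ⟨δ, y⟩ - (M 0 j, M 1 j)‖ ≤ ε ∧
      ‖gaugedColumn f k' Φ' j ⟨δ, y⟩ - (M' 0 j, M' 1 j)‖ ≤ ε := fun j => by
    fin_cases j
    · exact h0 δ hδ e3 y hg.hy
    · exact h1 δ hδ e4 y hg.hy
  have hx := hg.hx.1
  refine ⟨x, by linarith, by linarith, fun j => ⟨?_, ?_⟩⟩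
  · exact hsol.transport hf hk hg hε hε1 hR (by linarith) (by linarith) hδ e2.le j (hcl j).1
  · exact hsol'.transport hf hk' hg hε hε1 hR (by linarith) (by linarith) hδ e2.le j (hcl j).2

lemma limit_relation {X X' : ℕ → Matrix (Fin 2) (Fin 2) ℂ} {L L' : Matrix (Fin 2) (Fin 2) ℂ}
    (hX : Tendsto X atTop (𝓝 L)) (hX' : Tendsto X' atTop (𝓝 L'))
    (h : ∀ n, (X' n).transpose * sympl * (pauli3 * X n * pauli1).map conj =
      (pauli3 * X' n * pauli1).transpose * sympl * (X n).map conj) :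
    L'.transpose * sympl * (pauli3 * L * pauli1).map conj =
      (pauli3 * L' * pauli1).transpose * sympl * L.map conj := by
  have hmap : Continuous fun N : Matrix (Fin 2) (Fin 2) ℂ => N.map (starRingEnd ℂ) :=
    continuous_id.matrix_map Complex.continuous_conj
  have hflip : Continuous fun N : Matrix (Fin 2) (Fin 2) ℂ => pauli3 * N * pauli1 := by fun_prop
  have htr : Continuous fun N : Matrix (Fin 2) (Fin 2) ℂ => N.transpose * sympl := by fun_prop
  have f1 := (hflip.tendsto L).comp hX
  have f2 := (hflip.tendsto L').comp hX'
  have l1 := (htr.tendsto L').comp hX'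
  have l2 := (hmap.tendsto (pauli3 * L * pauli1)).comp f1
  have l3 := (htr.tendsto (pauli3 * L' * pauli1)).comp f2
  have l4 := (hmap.tendsto L).comp hX
  exact tendsto_nhds_unique_of_eventuallyEq (l1.mul l2) (l3.mul l4) (Eventually.of_forall h)

/-- The global relation off the contour. -/
theorem global_relation (hf : IsErnstPotential ρ₀ f) (hsymm : IsEquatoriallySymmetric ρ₀ f)
    {F G : ℂ → ℂ} (hFG : IsSpectralPair ρ₀ f F G) {k : ℂ} (hre : k.re ≠ 0) (him : k.im ≠ 0)
    (hF : F k ≠ 0) (hF' : F (-conj k) ≠ 0) :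
    G (-conj k) = -conj (G k) ∧ F (-conj k) * conj (F k) = 1 - conj (G k) ^ 2 := by
  have hre' : (-conj k).re ≠ 0 := by simpa using hre
  obtain ⟨Φ, hΦ, hA⟩ := hFG k fun h => hre h.1
  obtain ⟨Φ', hΦ', hA'⟩ := hFG (-conj k) fun h => hre' h.1
  have hk : k ≠ 0 := by rintro rfl; simp at hre
  have hk' : -conj k ≠ 0 := by simpa using hk
  set M := spectralMatrix F G k with hM
  set M' := spectralMatrix F G (-conj k) with hM'
  have hseq : ∀ n : ℕ, 0 < (1 / 100000000 : ℝ) / (n + 1) ∧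
      (1 / 100000000 : ℝ) / (n + 1) ≤ 1 / 100000000 := fun n =>
    ⟨by positivity, div_le_self (by norm_num) (by linarith [n.cast_nonneg (α := ℝ)])⟩
  -- Both eigenfunctions are approximated at the same points `x n`, because the relation to be
  -- passed to the limit involves them at one point.
  choose x hx1 hx2 hx3 using fun n : ℕ =>
    exists_equator_approx hf hk hk' hΦ hΦ' hA hA' (hseq n).1 (hseq n).2
  set P : Matrix (Fin 2) (Fin 2) ℂ := !![1, 1; 1, -1] with hP
  have hε0 : Tendsto (fun n : ℕ => (1 / 100000000 : ℝ) / (n + 1)) atTop (𝓝 0) :=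
    tendsto_const_div_atTop_nhds_zero_nat (1 / 100000000 : ℝ) |>.comp (tendsto_add_atTop_nat 1)
      |>.congr fun n => by simp
  have hlim : ∀ (κ : ℂ) (Ψ : ℂ → ℂ → Matrix (Fin 2) (Fin 2) ℂ) (N : Matrix (Fin 2) (Fin 2) ℂ),
      (∀ n j, ‖column κ Ψ j (x n) - (N 0 j + N 1 j, N 0 j - N 1 j)‖ ≤
        100000000 * (‖(N 0 j, N 1 j)‖ + 1) * ((1 / 100000000 : ℝ) / (n + 1))) →
      Tendsto (fun n => Ψ (x n) (branch κ (x n))) atTop (𝓝 (P * N)) := by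
    intro κ Ψ N h
    have hcol : ∀ j, Tendsto (fun n => column κ Ψ j (x n)) atTop
        (𝓝 (N 0 j + N 1 j, N 0 j - N 1 j)) := fun j => by
      rw [tendsto_iff_norm_sub_tendsto_zero]
      have h0 := hε0.const_mul (100000000 * (‖(N 0 j, N 1 j)‖ + 1))
      rw [mul_zero] at h0
      exact squeeze_zero (fun n => norm_nonneg _) (fun n => h n j) h0
    refine tendsto_pi_nhds.2 fun i => tendsto_pi_nhds.2 fun j => ?_
    fin_cases i
    · have := (continuous_fst.tendsto _).comp (hcol j)
      simpa [column, Function.comp_def, mul_entry, hP] using this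
    · have := (continuous_snd.tendsto _).comp (hcol j)
      simpa [column, Function.comp_def, mul_entry, hP, sub_eq_add_neg] using this
  have hX := hlim k Φ M fun n j => (hx3 n j).1
  have hX' := hlim (-conj k) Φ' M' fun n j => (hx3 n j).2
  have key := limit_relation hX hX' fun n =>
    equator_relation hf hsymm hre him hΦ hΦ' hA hA' hF hF' (hx1 n) (hx2 n)
  have k00 := congrFun (congrFun key 0) 0
  have k01 := congrFun (congrFun key 0) 1
  simp [mul_entry, hP, hM, hM', spectralMatrix, sympl, pauli1, pauli3] at k00 k01
  have r1 : G (-conj k) = -conj (G k) := by linear_combination k00 / 2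
  refine ⟨r1, ?_⟩
  rw [r1] at k01
  linear_combination -k01 / 2

/-! ### Passage to the contour -/

lemma isUnit_det_limit {F G : ℂ → ℂ} {l : Filter ℂ} [l.NeBot] {A : Matrix (Fin 2) (Fin 2) ℂ}
    (h : Tendsto (spectralMatrix F G) l (𝓝 A)) (hA : IsUnit A) :
    ∃ a b, a ≠ 0 ∧ A = !![a, 0; b, 1] ∧ Tendsto F l (𝓝 a) ∧ Tendsto G l (𝓝 b) := by
  have he : ∀ i j, Tendsto (fun w => spectralMatrix F G w i j) l (𝓝 (A i j)) := fun i j =>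
    tendsto_pi_nhds.1 (tendsto_pi_nhds.1 h i) j
  have h01 : A 0 1 = 0 := tendsto_nhds_unique (he 0 1) (by simp [spectralMatrix])
  have h11 : A 1 1 = 1 := tendsto_nhds_unique (he 1 1) (by simp [spectralMatrix])
  refine ⟨A 0 0, A 1 0, ?_, ?_, ?_, ?_⟩
  · intro h0
    rw [Matrix.isUnit_iff_isUnit_det, Matrix.det_fin_two, h01, h0] at hA
    simp at hA
  · ext i j; fin_cases i <;> fin_cases j <;> simp [h01, h11]
  · simpa [spectralMatrix] using he 0 0
  · simpa [spectralMatrix] using he 1 0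

/-- Real `w` must be avoided, since there the branch point lies on the axis. The sign `σ` moves the
imaginary part away from `0`. -/
lemma mem_closure_generic {k : ℂ} (hk : k.re = 0) : k ∈ closure {w : ℂ | 0 < w.re ∧ w.im ≠ 0} := by
  set σ : ℝ := if 0 ≤ k.im then 1 else -1 with hσ
  have h1 : Tendsto (fun t : ℝ => k + (t : ℂ) * ⟨1, σ⟩) (𝓝[>] 0) (𝓝 k) := by
    have : Tendsto (fun t : ℝ => k + (t : ℂ) * ⟨1, σ⟩) (𝓝 0) (𝓝 (k + ((0 : ℝ) : ℂ) * ⟨1, σ⟩)) :=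
      Continuous.tendsto (by fun_prop) _
    simp only [Complex.ofReal_zero, zero_mul, add_zero] at this
    exact this.mono_left nhdsWithin_le_nhds
  refine mem_closure_of_tendsto h1 ?_
  filter_upwards [self_mem_nhdsWithin] with t ht
  have ht' : 0 < t := ht
  constructor
  · simpa [hk] using ht'
  · have e : (k + (t : ℂ) * ⟨1, σ⟩).im = k.im + t * σ := by simp
    rw [e, hσ]
    split_ifs with h
    · linarith
    · push Not at h; linarith

end GlobalRelation

end Ernst

theorem mainTheorem4 (ρ₀ : ℝ) (hρ₀ : 0 < ρ₀) (f : ℂ → ℂ)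
    (hf : Ernst.IsErnstPotential ρ₀ f) (hsymm : Ernst.IsEquatoriallySymmetric ρ₀ f)
    (F G : ℂ → ℂ) (hFG : Ernst.IsSpectralPair ρ₀ f F G)
    (k : ℂ) (hk : k ∈ Ernst.contour ρ₀)
    (Ap Am : Matrix (Fin 2) (Fin 2) ℂ)
    (hAp : Tendsto (Ernst.spectralMatrix F G) (𝓝[{w : ℂ | 0 < w.re}] k) (𝓝 Ap))
    (hAm : Tendsto (Ernst.spectralMatrix F G) (𝓝[{w : ℂ | w.re < 0}] k) (𝓝 Am))
    (hApu : IsUnit Ap) (hAmu : IsUnit Am) :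
    Ap.map conj * Ernst.pauli1 * (Ap⁻¹).map conj * Ernst.pauli1
      = Ernst.pauli1 * Am * Ernst.pauli1 * Am⁻¹ := by
  set S : Set ℂ := {w : ℂ | 0 < w.re ∧ w.im ≠ 0}
  have hne : (𝓝[S] k).NeBot :=
    mem_closure_iff_nhdsWithin_neBot.1 (Ernst.mem_closure_generic hk.1)
  have hS : Tendsto (fun w : ℂ => w) (𝓝[S] k) (𝓝[{w : ℂ | 0 < w.re}] k) :=
    nhdsWithin_mono _ fun w hw => hw.1
  have hR : Tendsto (fun w : ℂ => -conj w) (𝓝[S] k) (𝓝[{w : ℂ | w.re < 0}] k) := by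
    refine tendsto_nhdsWithin_iff.2 ⟨?_, ?_⟩
    · have h1 : Continuous fun w : ℂ => -conj w := by fun_prop
      have h2 : -conj k = k := by apply Complex.ext <;> simp [hk.1]
      have h3 := h1.tendsto k
      rw [h2] at h3
      exact h3.mono_left nhdsWithin_le_nhds
    · filter_upwards [self_mem_nhdsWithin] with w hw
      simpa using hw.1
  have : (𝓝[{w : ℂ | 0 < w.re}] k).NeBot := hS.neBot
  have : (𝓝[{w : ℂ | w.re < 0}] k).NeBot := hR.neBot
  obtain ⟨p, g, hp, rfl, hFp, hGp⟩ := Ernst.isUnit_det_limit hAp hApu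
  obtain ⟨m, h, hm, rfl, hFm, hGm⟩ := Ernst.isUnit_det_limit hAm hAmu
  have hFp' := hFp.comp hS
  have hGp' := hGp.comp hS
  have hFm' := hFm.comp hR
  have hGm' := hGm.comp hR
  -- Invertibility of the two limits makes `F` nonzero at `w` and at `-conj w` near `k`, as
  -- `global_relation` requires.
  have hrel : ∀ᶠ w in 𝓝[S] k, G (-conj w) = -conj (G w) ∧
      F (-conj w) * conj (F w) = 1 - conj (G w) ^ 2 := by
    filter_upwards [self_mem_nhdsWithin, hFp'.eventually_ne hp, hFm'.eventually_ne hm]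
      with w hw h1 h2
    exact Ernst.global_relation hf hsymm hFG hw.1.ne' hw.2 h1 h2
  have cF := (Complex.continuous_conj.tendsto _).comp hFp'
  have cG := (Complex.continuous_conj.tendsto _).comp hGp'
  have r1 : h = -conj g := tendsto_nhds_unique_of_eventuallyEq hGm' cG.neg
    (hrel.mono fun w hw => hw.1)
  have r2 : m * conj p = 1 - conj g ^ 2 := tendsto_nhds_unique_of_eventuallyEq (hFm'.mul cF)
    ((cG.pow 2).const_sub 1) (hrel.mono fun w hw => hw.2)
  have inv : ∀ a b : ℂ, a ≠ 0 → (!![a, 0; b, 1] : Matrix (Fin 2) (Fin 2) ℂ)⁻¹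
      = !![1 / a, 0; -b / a, 1] := fun a b ha => Matrix.inv_eq_right_inv (by
    ext i j
    fin_cases i <;> fin_cases j <;> simp [Matrix.mul_apply, Fin.sum_univ_two, ha]
    field_simp
    ring)
  have hp' : conj p ≠ 0 := by simpa using hp
  -- With explicit inverses and `r1` substituted, the entries still to be checked are multiples of
  -- `r2`.
  rw [inv p g hp, inv m h hm, r1]
  ext i j
  fin_cases i <;> fin_cases j <;>
    simp [Matrix.mul_apply, Fin.sum_univ_two, Ernst.pauli1] <;> field_simp
  · linear_combination r2
  · linear_combination -r2
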